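/- Let $X$ be a \emph{spindle}: a set with a binary operation $(x,y)\mapsto x^y$ such that $(x^y)^z=(x^z)^{(y^z)}$ and $x^x=x$ for all $x,y,z$. Let $k$ be a unital commutative ring (e.g. $k=\mathbb Z$). \textbf{Setting.} Let $B=B(X,k)$ be the $k$-algebra with generators $x,e_x$ ($x\in X$) and relations $yx^y=xy$, $ye_{x^y}=e_xy$, graded by $|x|=0$, $|e_x|=1$; let $A\subset B$ be the subalgebra generated by the $x$'s. Let $d$ be the (super-)derivation with $d(e_x)=1-x$, $d(x)=0$; let $\Delta:B\to B\otimes B$ and $\varepsilon:B\to k$ be the algebra maps (Koszul sign on $B\otimes B$) with $\Delta(x)=x\otimes x$, $\Delta(e_x)=e_x\otimes x+1\otimes e_x$, $\varepsilon(x)=1$, $\varepsilon(e_x)=0$. On the positive degree part $B^+$ put, for $a$ a monomial in the $x$'s and $n\ge 1$, $$\overleftarrow\Delta(ae_{x_1}\cdots e_{x_n})=(ae_{x_1}\otimes ax_1)\,\Delta(e_{x_2}\cdots e_{x_n}),\qquad \overrightarrow\Delta(ae_{x_1}\cdots e_{x_n})=(a\otimes ae_{x_1})\,\Delta(e_{x_2}\cdots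 e_{x_n}).$$ Let $\overline B=B/\langle xb-b : x\in X,\ b\in B\rangle$, with the induced grading, $d$, $\Delta,\overleftarrow\Delta,\overrightarrow\Delta$. Let $B^{\mathrm D}\subset B$ be the two-sided ideal generated by all $e_x^2$, and $B^{\mathrm N}\subset B$ the left $A$-submodule generated by $1$ and all $(e_{x_1}-e_{x_2})(e_{x_2}-e_{x_3})\cdots(e_{x_{n-1}}-e_{x_n})e_{x_n}$, $n\ge1$; let $\overline B^{\mathrm D},\overline B^{\mathrm N}$ be their images in $\overline B$. Let $C^n=\{f:X^n\to k\}$, with $$(\partial^*f)(x_1,\dots,x_{n+1})=\sum_{i=1}^{n+1}(-1)^{i-1}\big(f(x_1,\dots,\widehat{x_i},\dots,x_{n+1})-f(x_1^{x_i},\dots,x_{i-1}^{x_i},x_{i+1},\dots,x_{n+1})\big).$$ Its cohomology is the rack cohomology $H_{\mathrm R}$. An $f\in C^n$ is identified with the linear map $B\to k$ that vanishes outside degree $n$, satisfies $f(xb)=f(b)$, and sends $e_{x_1}\cdots e_{x_n}$ to $f(x_1,\dots,x_n)$. The quandle cohomology $H_{\mathrm Q}$ is the cohomology of the complex of those $f\in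 C^n$ with $f(x_1,\dots,x_n)=0$ whenever $x_i=x_{i+1}$ for some $i$; the degenerate cohomology $H_{\mathrm D}$ is the cohomology of the complex of those $f$ that vanish on $B^{\mathrm N}$. For $f\in C^p$, $g\in C^q$, the cup product $f\smile g$ and the products $f\prec g$, $f\succ g$ in $C^{p+q}$ are $(f\otimes g)\Delta$, $(f\otimes g)\overleftarrow\Delta$, $(f\otimes g)\overrightarrow\Delta$ evaluated on the $e_{x_1}\cdots e_{x_{p+q}}$, with $(f\otimes g)(b\otimes b')=(-1)^{pq}f(b)g(b')$; in degree $0$, $\overleftarrow\Delta$ and $\overrightarrow\Delta$ are extended by $0$. A \emph{$+$-Zinbiel algebra} is a graded associative algebra $(H,\smile)$, $H=\bigoplus_{n\ge0}H^n$, with degree $0$ products $\prec: H^+\otimes H\to H^+$, $\succ: H\otimes H^+\to H^+$ such that $\smile\,=\,\prec+\succ$ in positive total degree (products extended by $0$), $(a\prec b)\prec c=a\prec(b\smile c)$, $a\succ(b\succ c)=(a\smile b)\succ c$, $a\succ(b\prec c)=(a\succ b)\prec c$, and $a\succ b=(-1)^{|a||b|}\,b\prec a$. A \emph{$+$-coZinbiel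 coalgebra} is defined dually. \textbf{Theorem.} \begin{enumerate} \item $B=B^{\mathrm N}\oplus B^{\mathrm D}$, and both summands are graded $A$-sub-bimodules stable under $d$. Moreover $B^{\mathrm D}$ is a coideal ($\Delta(B^{\mathrm D})\subseteq B^{\mathrm D}\otimes B+B\otimes B^{\mathrm D}$, $\varepsilon(B^{\mathrm D})=0$), and $\Delta$, $\overleftarrow\Delta$, $\overrightarrow\Delta$ send $B^{\mathrm N}$ (resp. its positive degree part) into the image of $B\otimes B^{\mathrm N}$ in $B\otimes B$. \item In every degree the inclusions induce an isomorphism $H_n(\overline B^{\mathrm N})\oplus H_n(\overline B^{\mathrm D})\cong H_n(\overline B)$. If $k$ is a field, $\Delta,\overleftarrow\Delta,\overrightarrow\Delta$ induce a $+$-coZinbiel coalgebra structure on $H(\overline B)$; for it $H(\overline B^{\mathrm D})$ is a coideal of the coassociative coalgebra $H(\overline B)$, and $\Delta,\overleftarrow\Delta,\overrightarrow\Delta$ restrict to $H(\overline B^{\mathrm N})$ and make it a $+$-coZinbiel coalgebra. \item In every degree the inclusions of cochains induce an isomorphism $H_{\mathrm Q}^n\oplus H_{\mathrm D}^n\cong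 H_{\mathrm R}^n$. The products $\smile,\prec,\succ$ of cochains induce a $+$-Zinbiel algebra structure on $H_{\mathrm R}$. For it: \begin{itemize} \item $H_{\mathrm Q}$ is a (unital) associative subalgebra, and $H_{\mathrm D}$ is a two-sided ideal, of $(H_{\mathrm R},\smile)$; \item $H_{\mathrm D}$ is a two-sided ideal for the Zinbiel product $\prec$. Hence $H_{\mathrm Q}$, regarded as the quotient $H_{\mathrm R}/H_{\mathrm D}$, inherits a $+$-Zinbiel algebra structure; its associative product is the restriction of the cup product. \end{itemize} \end{enumerate} -/

import Mathlib

open scoped TensorProduct DirectSum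

noncomputable section

namespace RackBialg

universe u v

/-! ### The algebra `B(X, k)` -/

/-- Exponential notation `x ^ y` for the right action of a shelf on itself.  Mathlib writes the
self-distributive action on the left, so that `x ^ y` is `Shelf.act y x`. -/
def up {X : Type u} [Shelf X] (x y : X) : X := Shelf.act y x

theorem up_up {X : Type u} [Shelf X] (x y z : X) : up (up x y) z = up (up x z) (up y z) :=
  Shelf.self_distrib

/-- The defining relations `y x^y = x y` and `y e_{x^y} = e_x y`.  The generator `x` is
`Sum.inl x`, the generator `e_x` is `Sum.inr x`. -/
inductive Rel (k : Type v) [CommRing k] (X : Type u) [Shelf X] :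
    FreeAlgebra k (X ⊕ X) → FreeAlgebra k (X ⊕ X) → Prop
  | grp (x y : X) : Rel k X
      (FreeAlgebra.ι k (Sum.inl y) * FreeAlgebra.ι k (Sum.inl (up x y)))
      (FreeAlgebra.ι k (Sum.inl x) * FreeAlgebra.ι k (Sum.inl y))
  | ext (x y : X) : Rel k X
      (FreeAlgebra.ι k (Sum.inl y) * FreeAlgebra.ι k (Sum.inr (up x y)))
      (FreeAlgebra.ι k (Sum.inr x) * FreeAlgebra.ι k (Sum.inl y))

/-- The algebra `B(X, k)` generated by two copies `x`, `e_x` of `X`. -/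
def B (k : Type v) [CommRing k] (X : Type u) [Shelf X] : Type max u v := RingQuot (Rel k X)

section

variable (k : Type v) [CommRing k] {X : Type u} [Shelf X]

instance : Ring (B k X) := inferInstanceAs (Ring (RingQuot (Rel k X)))

instance : Algebra k (B k X) := inferInstanceAs (Algebra k (RingQuot (Rel k X)))

/-- The generators of `B(X, k)`. -/
def gen (s : X ⊕ X) : B k X := RingQuot.mkAlgHom k (Rel k X) (FreeAlgebra.ι k s)

/-- The degree zero generator `x`. -/
def g (x : X) : B k X := gen k (Sum.inl x)

/-- The degree one generator `e_x`. -/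
def e (x : X) : B k X := gen k (Sum.inr x)

theorem g_mul_g (x y : X) : g k y * g k (up x y) = g k x * g k y := by
  have := RingQuot.mkAlgHom_rel k (Rel.grp (k := k) x y)
  rw [map_mul, map_mul] at this
  exact this

theorem g_mul_e (x y : X) : g k y * e k (up x y) = e k x * g k y := by
  have := RingQuot.mkAlgHom_rel k (Rel.ext (k := k) x y)
  rw [map_mul, map_mul] at this
  exact this

variable {k}

/-- The universal property of `B(X, k)`. -/
def lift {R : Type*} [Ring R] [Algebra k R] (a b : X → R)
    (h₁ : ∀ x y, a y * a (up x y) = a x * a y) (h₂ : ∀ x y, a y * b (up x y) = b x * a y) :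
    B k X →ₐ[k] R :=
  RingQuot.liftAlgHom k ⟨FreeAlgebra.lift k (Sum.elim a b), by
    rintro _ _ (⟨x, y⟩ | ⟨x, y⟩)
    · simpa using h₁ x y
    · simpa using h₂ x y⟩

@[simp] theorem lift_g {R : Type*} [Ring R] [Algebra k R] (a b : X → R) (h₁) (h₂) (x : X) :
    lift (k := k) a b h₁ h₂ (g k x) = a x := by
  change RingQuot.liftAlgHom k _ (RingQuot.mkAlgHom k (Rel k X) _) = _
  rw [RingQuot.liftAlgHom_mkAlgHom_apply]
  simp

@[simp] theorem lift_e {R : Type*} [Ring R] [Algebra k R] (a b : X → R) (h₁) (h₂) (x : X) :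
    lift (k := k) a b h₁ h₂ (e k x) = b x := by
  change RingQuot.liftAlgHom k _ (RingQuot.mkAlgHom k (Rel k X) _) = _
  rw [RingQuot.liftAlgHom_mkAlgHom_apply]
  simp

theorem algHom_ext {R : Type*} [Ring R] [Algebra k R] {φ ψ : B k X →ₐ[k] R}
    (hg : ∀ x, φ (g k x) = ψ (g k x)) (he : ∀ x, φ (e k x) = ψ (e k x)) : φ = ψ := by
  apply RingQuot.ringQuot_ext'
  apply FreeAlgebra.hom_ext
  funext s
  rcases s with x | x
  · exact hg x
  · exact he x

theorem induction {P : B k X → Prop} (hr : ∀ r : k, P (algebraMap k (B k X) r))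
    (hg : ∀ x, P (g k x)) (he : ∀ x, P (e k x)) (hadd : ∀ a b, P a → P b → P (a + b))
    (hmul : ∀ a b, P a → P b → P (a * b)) (b : B k X) : P b := by
  let π : FreeAlgebra k (X ⊕ X) →ₐ[k] B k X := RingQuot.mkAlgHom k (Rel k X)
  obtain ⟨c, rfl⟩ : ∃ c, π c = b := RingQuot.mkAlgHom_surjective k (Rel k X) b
  induction c using FreeAlgebra.induction with
  | grade0 r => rw [AlgHom.commutes]; exact hr r
  | grade1 s =>
    rcases s with x | x
    · exact hg x
    · exact he x
  | mul a b iha ihb => rw [map_mul]; exact hmul _ _ iha ihb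
  | add a b iha ihb => rw [map_add]; exact hadd _ _ iha ihb

/-! ### The grading -/

variable (k X)

/-- The degree `n` part of `B(X, k)`: the span of all monomials in the generators that contain
exactly `n` letters of the form `e_x`. -/
def deg (n : ℕ) : Submodule k (B k X) :=
  Submodule.span k {b | ∃ l : List (X ⊕ X), l.countP Sum.isRight = n ∧ b = (l.map (gen k)).prod}

variable {X}

theorem g_mem_deg (x : X) : g k x ∈ deg k X 0 :=
  Submodule.subset_span ⟨[Sum.inl x], by simp, by simp [g]⟩

theorem e_mem_deg (x : X) : e k x ∈ deg k X 1 :=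
  Submodule.subset_span ⟨[Sum.inr x], by simp, by simp [e]⟩

instance : SetLike.GradedMonoid (deg k X) where
  one_mem := Submodule.subset_span ⟨[], by simp, by simp⟩
  mul_mem := by
    intro i j a b ha hb
    have h := Submodule.mul_mem_mul ha hb
    rw [deg, deg, Submodule.span_mul_span] at h
    refine Submodule.span_mono ?_ h
    rintro _ ⟨_, ⟨l, hl, rfl⟩, _, ⟨l', hl', rfl⟩, rfl⟩
    exact ⟨l ++ l', by simp [hl, hl'], by simp⟩

/-- The homomorphism that splits an element of `B(X, k)` into its homogeneous components. -/
def toSum : B k X →ₐ[k] ⨁ n, deg k X n :=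
  lift (fun x => DirectSum.of (fun n => deg k X n) 0 ⟨g k x, g_mem_deg k x⟩)
    (fun x => DirectSum.of (fun n => deg k X n) 1 ⟨e k x, e_mem_deg k x⟩)
    (fun x y => by
      rw [DirectSum.of_mul_of, DirectSum.of_mul_of]
      exact congrArg _ (Subtype.ext (g_mul_g k x y)))
    (fun x y => by
      rw [DirectSum.of_mul_of, DirectSum.of_mul_of]
      exact DirectSum.of_eq_of_gradedMonoid_eq (Sigma.subtype_ext rfl (g_mul_e k x y)))

theorem countP_inl {X : Type u} (x : X) (l : List (X ⊕ X)) :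
    (Sum.inl x :: l).countP Sum.isRight = l.countP Sum.isRight :=
  List.countP_cons_of_neg Bool.false_ne_true

theorem countP_inr {X : Type u} (x : X) (l : List (X ⊕ X)) :
    (Sum.inr x :: l).countP Sum.isRight = l.countP Sum.isRight + 1 :=
  List.countP_cons_of_pos rfl

instance : GradedAlgebra (deg k X) :=
  GradedAlgebra.ofAlgHom _ (toSum k)
    (by
      apply algHom_ext
      · intro x; simp [toSum]
      · intro x; simp [toSum])
    (by
      rintro i ⟨b, hb⟩
      change toSum k b = _
      induction hb using Submodule.span_induction with
      | mem b h =>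
        obtain ⟨l, rfl, rfl⟩ := h
        induction l with
        | nil => exact map_one (toSum k)
        | cons s l ih =>
          have h := ih
          have hc : ((s :: l).map (gen k)).prod = gen k s * (l.map (gen k)).prod := by simp
          have hm : toSum k ((s :: l).map (gen k)).prod =
              toSum k (gen k s) * toSum k (l.map (gen k)).prod := by
            rw [hc]; exact map_mul (toSum k) _ _
          refine hm.trans ?_
          rw [h]
          rcases s with x | x
          · have hl := countP_inl x l
            change toSum k (g k x) * _ = _
            rw [toSum, lift_g, DirectSum.of_mul_of]
            exact DirectSum.of_eq_of_gradedMonoid_eq (Sigma.subtype_ext ((zero_add _).trans hl.symm) hc.symm)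
          · have hl := countP_inr x l
            change toSum k (e k x) * _ = _
            rw [toSum, lift_e, DirectSum.of_mul_of]
            exact DirectSum.of_eq_of_gradedMonoid_eq
              (Sigma.subtype_ext ((add_comm _ _).trans hl.symm) hc.symm)
      | zero => exact (map_zero (toSum k)).trans (map_zero _).symm
      | add a b ha hb iha ihb =>
        rw [map_add, iha, ihb, ← map_add]
        rfl
      | smul c a ha iha =>
        rw [map_smul, iha]
        exact (map_smul (DirectSum.lof k ℕ (fun n => deg k X n) i) c ⟨a, ha⟩).symm)

/-! ### Twisted derivations

Given algebra maps `φ, ψ : B → R`, a twisted derivation is a linear map `D` with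
`D (b c) = φ b * D c + D b * ψ c`.  Those that vanish on the generators `x` are determined by
their values on the generators `e_x`; they are read off an algebra map to upper triangular
matrices. -/

section Twisted

variable {k} {R : Type*} [Ring R] [Algebra k R]

/-- The algebra map `b ↦ (φ b, D b; 0, ψ b)`. -/
def triangular (φ ψ : B k X →ₐ[k] R) (D : X → R)
    (h : ∀ x y, φ (g k y) * D (up x y) = D x * ψ (g k y)) :
    B k X →ₐ[k] Matrix (Fin 2) (Fin 2) R :=
  lift (fun x => !![φ (g k x), 0; 0, ψ (g k x)]) (fun x => !![φ (e k x), D x; 0, ψ (e k x)])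
    (fun x y => by
      have h₁ := congrArg φ (g_mul_g k x y)
      have h₂ := congrArg ψ (g_mul_g k x y)
      rw [map_mul, map_mul] at h₁ h₂
      simp [h₁, h₂])
    (fun x y => by
      have h₁ := congrArg φ (g_mul_e k x y)
      have h₂ := congrArg ψ (g_mul_e k x y)
      rw [map_mul, map_mul] at h₁ h₂
      simp [h₁, h₂, h])

/-- The twisted derivation with `x ↦ 0` and `e_x ↦ D x`. -/
def twisted (φ ψ : B k X →ₐ[k] R) (D : X → R)
    (h : ∀ x y, φ (g k y) * D (up x y) = D x * ψ (g k y)) : B k X →ₗ[k] R :=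
  Matrix.entryLinearMap k R 0 1 ∘ₗ (triangular φ ψ D h).toLinearMap

variable (φ ψ : B k X →ₐ[k] R) (D : X → R)
  (h : ∀ x y, φ (g k y) * D (up x y) = D x * ψ (g k y))

theorem twisted_g (x : X) : twisted φ ψ D h (g k x) = 0 := by
  simp [twisted, triangular]

theorem twisted_e (x : X) : twisted φ ψ D h (e k x) = D x := by
  simp [twisted, triangular]

theorem triangular_diag (b : B k X) :
    triangular φ ψ D h b 0 0 = φ b ∧ triangular φ ψ D h b 1 0 = 0 ∧
      triangular φ ψ D h b 1 1 = ψ b := by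
  induction b using induction with
  | hr r => simp [AlgHom.commutes, Matrix.algebraMap_matrix_apply]
  | hg x => simp [triangular]
  | he x => simp [triangular]
  | hadd a b iha ihb => simp [iha, ihb]
  | hmul a b iha ihb => simp [Matrix.mul_apply, Fin.sum_univ_two, iha, ihb]

theorem twisted_mul (b c : B k X) :
    twisted φ ψ D h (b * c) = φ b * twisted φ ψ D h c + twisted φ ψ D h b * ψ c := by
  obtain ⟨h₁, -, -⟩ := triangular_diag φ ψ D h b
  obtain ⟨-, -, h₂⟩ := triangular_diag φ ψ D h c
  have hm := congrFun (congrFun (map_mul (triangular φ ψ D h) b c) 0) 1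
  rw [Matrix.mul_apply, Fin.sum_univ_two, h₁, h₂] at hm
  exact hm

end Twisted

/-! ### Differential, coproduct, and codendriform structure on `B(X, k)` -/

/-- The sign automorphism `x ↦ x`, `e_x ↦ - e_x`, i.e. `b ↦ (-1) ^ |b| b`. -/
def sgn : B k X →ₐ[k] B k X :=
  lift (g k) (fun x => - e k x) (g_mul_g k) (fun x y => by simp [g_mul_e])

/-- The projection `x ↦ x`, `e_x ↦ 0` of `B` to its degree zero part `A`. -/
def proj₀ : B k X →ₐ[k] B k X :=
  lift (g k) (fun _ => 0) (g_mul_g k) (fun x y => by simp)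

/-- The differential: the derivation (with the Koszul sign) such that `d e_x = 1 - x` and
`d x = 0`. -/
def d : B k X →ₗ[k] B k X :=
  twisted (sgn k) (AlgHom.id k (B k X)) (fun x => 1 - g k x)
    (fun x y => by simp [sgn, mul_sub, sub_mul, g_mul_g])

theorem d_g (x : X) : d k (g k x) = 0 := twisted_g _ _ _ _ x

theorem d_e (x : X) : d k (e k x) = 1 - g k x := twisted_e _ _ _ _ x

theorem d_mul (b c : B k X) : d k (b * c) = sgn k b * d k c + d k b * c :=
  twisted_mul _ _ _ _ b c

/-- The counit. -/
def counit : B k X →ₐ[k] k := lift (fun _ => 1) (fun _ => 0) (by simp) (by simp)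

/-- The tensor square of the graded algebra `B`, with the Koszul sign in its product. -/
abbrev BB (k : Type v) [CommRing k] (X : Type u) [Shelf X] := deg k X ᵍ⊗[k] deg k X

theorem gg_mul (x : X) (b c : B k X) :
    ((g k x) ᵍ⊗ₜ[k] (g k x) * b ᵍ⊗ₜ[k] c : BB k X) = (g k x * b) ᵍ⊗ₜ[k] (g k x * c) := by
  induction b using DirectSum.Decomposition.inductionOn (deg k X) with
  | zero => simp [GradedTensorProduct.tmul]
  | homogeneous b =>
    exact GradedTensorProduct.tmul_zero_coe_mul_coe_tmul (deg k X) (deg k X) (g k x)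
      ⟨g k x, g_mem_deg k x⟩ b c
  | add b b' h h' =>
    simp only [GradedTensorProduct.tmul, TensorProduct.add_tmul, map_add, mul_add] at h h' ⊢
    rw [h, h']

theorem mul_gg (x : X) (b c : B k X) :
    (b ᵍ⊗ₜ[k] c * (g k x) ᵍ⊗ₜ[k] (g k x) : BB k X) = (b * g k x) ᵍ⊗ₜ[k] (c * g k x) := by
  induction c using DirectSum.Decomposition.inductionOn (deg k X) with
  | zero => simp [GradedTensorProduct.tmul]
  | homogeneous c =>
    exact GradedTensorProduct.tmul_coe_mul_zero_coe_tmul (deg k X) (deg k X) b c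
      ⟨g k x, g_mem_deg k x⟩ (g k x)
  | add b b' h h' =>
    simp only [GradedTensorProduct.tmul, TensorProduct.tmul_add, map_add, add_mul] at h h' ⊢
    rw [h, h']

/-- The coproduct as an algebra map: `x ↦ x ⊗ x`, `e_x ↦ e_x ⊗ x + 1 ⊗ e_x`. -/
def comulAlg : B k X →ₐ[k] BB k X :=
  lift (fun x => (g k x) ᵍ⊗ₜ[k] (g k x)) (fun x => (e k x) ᵍ⊗ₜ[k] (g k x) + 1 ᵍ⊗ₜ[k] (e k x))
    (fun x y => by rw [gg_mul, gg_mul, g_mul_g])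
    (fun x y => by
      rw [mul_add, add_mul, gg_mul, gg_mul, mul_gg, mul_gg, g_mul_g, g_mul_e, mul_one, one_mul])

theorem comulAlg_g (x : X) : comulAlg k (g k x) = (g k x) ᵍ⊗ₜ[k] (g k x) := by simp [comulAlg]

theorem proj₀_g (x : X) : proj₀ k (g k x) = g k x := by simp [proj₀]

/-- The map `(B → B ⊗ B)` with `a e_{x₁} ⋯ e_{xₙ} ↦ (a e_{x₁} ⊗ a x₁) Δ(e_{x₂} ⋯ e_{xₙ})` for
`n ≥ 1`, extended by zero in degree zero; see `comulLeftAlg_canonical`. -/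
def comulLeftAlg : B k X →ₗ[k] BB k X :=
  twisted ((comulAlg k).comp (proj₀ k)) (comulAlg k) (fun x => (e k x) ᵍ⊗ₜ[k] (g k x))
    (fun x y => by
      rw [AlgHom.comp_apply, proj₀_g, comulAlg_g, gg_mul, mul_gg, g_mul_g, g_mul_e])

/-- The map `(B → B ⊗ B)` with `a e_{x₁} ⋯ e_{xₙ} ↦ (a ⊗ a e_{x₁}) Δ(e_{x₂} ⋯ e_{xₙ})` for
`n ≥ 1`, extended by zero in degree zero; see `comulRightAlg_canonical`. -/
def comulRightAlg : B k X →ₗ[k] BB k X :=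
  twisted ((comulAlg k).comp (proj₀ k)) (comulAlg k) (fun x => 1 ᵍ⊗ₜ[k] (e k x))
    (fun x y => by
      rw [AlgHom.comp_apply, proj₀_g, comulAlg_g, gg_mul, mul_gg, g_mul_e, mul_one, one_mul])

/-- The monomial `x₁ ⋯ xₙ` of `A`. -/
def gWord (l : List X) : B k X := (l.map (g k)).prod

/-- The monomial `e_{x₁} ⋯ e_{xₙ}`. -/
def eWord (l : List X) : B k X := (l.map (e k)).prod

theorem comulAlg_gWord_mul (a : List X) (b c : B k X) :
    (comulAlg k (gWord k a) * b ᵍ⊗ₜ[k] c : BB k X) = (gWord k a * b) ᵍ⊗ₜ[k] (gWord k a * c) := by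
  induction a generalizing b c with
  | nil => simp [gWord]
  | cons x a ih =>
    have h : gWord k (x :: a) = g k x * gWord k a := by simp [gWord]
    rw [h, map_mul, mul_assoc, ih, comulAlg_g, gg_mul, mul_assoc, mul_assoc]

theorem comulLeftAlg_gWord_mul (a : List X) (b : B k X) :
    comulLeftAlg k (gWord k a * b) = comulAlg k (gWord k a) * comulLeftAlg k b := by
  induction a with
  | nil => simp [gWord]
  | cons x a ih =>
    have h : gWord k (x :: a) = g k x * gWord k a := by simp [gWord]
    rw [h, mul_assoc, comulLeftAlg, twisted_mul, twisted_g, zero_mul, add_zero,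
      AlgHom.comp_apply, proj₀_g, ← comulLeftAlg, ih, map_mul (comulAlg k), mul_assoc]

theorem comulRightAlg_gWord_mul (a : List X) (b : B k X) :
    comulRightAlg k (gWord k a * b) = comulAlg k (gWord k a) * comulRightAlg k b := by
  induction a with
  | nil => simp [gWord]
  | cons x a ih =>
    have h : gWord k (x :: a) = g k x * gWord k a := by simp [gWord]
    rw [h, mul_assoc, comulRightAlg, twisted_mul, twisted_g, zero_mul, add_zero,
      AlgHom.comp_apply, proj₀_g, ← comulRightAlg, ih, map_mul (comulAlg k), mul_assoc]

theorem comulLeftAlg_canonical (a : List X) (x : X) (l : List X) :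
    comulLeftAlg k (gWord k a * eWord k (x :: l)) =
      (gWord k a * e k x) ᵍ⊗ₜ[k] (gWord k a * g k x) * comulAlg k (eWord k l) := by
  have h : eWord k (x :: l) = e k x * eWord k l := by simp [eWord]
  have h₀ : proj₀ k (e k x) = 0 := by simp [proj₀]
  rw [comulLeftAlg_gWord_mul, h, comulLeftAlg, twisted_mul, twisted_e, AlgHom.comp_apply, h₀,
    map_zero, zero_mul, zero_add, ← mul_assoc, comulAlg_gWord_mul]

theorem comulRightAlg_canonical (a : List X) (x : X) (l : List X) :
    comulRightAlg k (gWord k a * eWord k (x :: l)) =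
      (gWord k a) ᵍ⊗ₜ[k] (gWord k a * e k x) * comulAlg k (eWord k l) := by
  have h : eWord k (x :: l) = e k x * eWord k l := by simp [eWord]
  have h₀ : proj₀ k (e k x) = 0 := by simp [proj₀]
  rw [comulRightAlg_gWord_mul, h, comulRightAlg, twisted_mul, twisted_e, AlgHom.comp_apply, h₀,
    map_zero, zero_mul, zero_add, ← mul_assoc, comulAlg_gWord_mul, mul_one]

/-- Passage from `B ⊗ B` with its product to the underlying tensor product of modules. -/
def toTensor : BB k X ≃ₗ[k] B k X ⊗[k] B k X := (GradedTensorProduct.of k (deg k X) (deg k X)).symm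

/-- The coproduct `Δ`. -/
def comul : B k X →ₗ[k] B k X ⊗[k] B k X := (toTensor k).toLinearMap ∘ₗ (comulAlg k).toLinearMap

/-- The left half of the coproduct (zero in degree zero). -/
def comulLeft : B k X →ₗ[k] B k X ⊗[k] B k X := (toTensor k).toLinearMap ∘ₗ comulLeftAlg k

/-- The right half of the coproduct (zero in degree zero). -/
def comulRight : B k X →ₗ[k] B k X ⊗[k] B k X := (toTensor k).toLinearMap ∘ₗ comulRightAlg k

/-! ### The sub-bimodules `B^D` and `B^N` -/

variable (X)

/-- The structure algebra `A(X)`, as the subalgebra of `B(X)` generated by the `x`. -/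
def A : Subalgebra k (B k X) := Algebra.adjoin k (Set.range (g k))

/-- The two-sided ideal generated by the `e_x²`. -/
def BD : Submodule k (B k X) :=
  Submodule.span k {b | ∃ (p q : B k X) (x : X), b = p * (e k x * e k x) * q}

variable {X}

/-- The element `(e_{x₁} - e_{x₂}) (e_{x₂} - e_{x₃}) ⋯ (e_{xₙ₋₁} - e_{xₙ}) e_{xₙ}`, and `1` for the
empty word. -/
def nWord : List X → B k X
  | [] => 1
  | [x] => e k x
  | x :: y :: l => (e k x - e k y) * nWord (y :: l)

variable (X)

/-- The left `A`-submodule generated by `1` and the `(e_{x₁} - e_{x₂}) ⋯ (e_{xₙ₋₁} - e_{xₙ}) e_{xₙ}`. -/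
def BN : Submodule k (B k X) :=
  Submodule.span k {b | ∃ a ∈ A k X, ∃ l : List X, b = a * nWord k l}

end

/-- The image of `P ⊗ Q` in `M ⊗ N`. -/
def tens {k : Type*} [CommRing k] {M N : Type*} [AddCommGroup M] [AddCommGroup N] [Module k M]
    [Module k N] (P : Submodule k M) (Q : Submodule k N) : Submodule k (M ⊗[k] N) :=
  LinearMap.range (TensorProduct.mapIncl P Q)

/-- A differential graded `A`-sub-bimodule of `B`: it contains the homogeneous components of its
elements, and it is stable under the differential and under both actions of `A`. -/
structure IsDGSubbimodule (k : Type v) [CommRing k] (X : Type u) [Shelf X]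
    (P : Submodule k (B k X)) : Prop where
  homogeneous : ∀ b ∈ P, ∀ n, (DirectSum.decompose (deg k X) b n : B k X) ∈ P
  d_mem : ∀ b ∈ P, d k b ∈ P
  left_mem : ∀ a ∈ A k X, ∀ b ∈ P, a * b ∈ P
  right_mem : ∀ a ∈ A k X, ∀ b ∈ P, b * a ∈ P

/-! ### The d.g. coalgebra `B̄ = k ⊗_A B` -/

section

variable (k : Type v) [CommRing k] (X : Type u) [Shelf X]

/-- The span of all `x b - b`. -/
def relBar : Submodule k (B k X) := Submodule.span k {c | ∃ (x : X) (b : B k X), c = g k x * b - b}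

/-- `B̄` is the quotient of `B` by `x b ∼ b`. -/
abbrev Bbar := B k X ⧸ relBar k X

/-- The projection `B → B̄`. -/
def toBar : B k X →ₗ[k] Bbar k X := (relBar k X).mkQ

variable {X}

theorem toBar_g_mul (x : X) (b : B k X) : toBar k X (g k x * b) = toBar k X b :=
  (Submodule.Quotient.eq _).2 (Submodule.subset_span ⟨x, b, rfl⟩)

variable (X)

/-- The differential on `B̄`. -/
def dBar : Bbar k X →ₗ[k] Bbar k X :=
  (relBar k X).liftQ (toBar k X ∘ₗ d k) (Submodule.span_le.2 (by
    rintro _ ⟨x, b, rfl⟩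
    simp [d_mul, d_g, sgn, toBar_g_mul]))

variable {X}

theorem comul_bar_aux (x : X) (t : BB k X) :
    TensorProduct.map (toBar k X) (toBar k X) (toTensor k (comulAlg k (g k x) * t)) =
      TensorProduct.map (toBar k X) (toBar k X) (toTensor k t) := by
  obtain ⟨t, rfl⟩ := (GradedTensorProduct.of k (deg k X) (deg k X)).surjective t
  induction t using TensorProduct.induction_on with
  | zero => simp
  | tmul b c =>
    rw [comulAlg_g]
    have h := gg_mul k x b c
    rw [GradedTensorProduct.tmul, GradedTensorProduct.tmul] at h
    rw [h]
    simp [toTensor, toBar_g_mul]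
  | add s t hs ht => rw [map_add, mul_add, map_add, map_add, map_add, map_add, hs, ht]

variable (X)

/-- The coproduct on `B̄`. -/
def comulBar : Bbar k X →ₗ[k] Bbar k X ⊗[k] Bbar k X :=
  (relBar k X).liftQ (TensorProduct.map (toBar k X) (toBar k X) ∘ₗ comul k) (Submodule.span_le.2 (by
    rintro _ ⟨x, b, rfl⟩
    simp [comul, comul_bar_aux]))

/-- The left half of the coproduct on `B̄`. -/
def comulLeftBar : Bbar k X →ₗ[k] Bbar k X ⊗[k] Bbar k X :=
  (relBar k X).liftQ (TensorProduct.map (toBar k X) (toBar k X) ∘ₗ comulLeft k)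
    (Submodule.span_le.2 (by
      rintro _ ⟨x, b, rfl⟩
      have h := comulLeftAlg_gWord_mul k [x] b
      simp only [gWord, List.map_cons, List.map_nil, List.prod_singleton] at h
      simp [comulLeft, h, comul_bar_aux]))

/-- The right half of the coproduct on `B̄`. -/
def comulRightBar : Bbar k X →ₗ[k] Bbar k X ⊗[k] Bbar k X :=
  (relBar k X).liftQ (TensorProduct.map (toBar k X) (toBar k X) ∘ₗ comulRight k)
    (Submodule.span_le.2 (by
      rintro _ ⟨x, b, rfl⟩
      have h := comulRightAlg_gWord_mul k [x] b
      simp only [gWord, List.map_cons, List.map_nil, List.prod_singleton] at h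
      simp [comulRight, h, comul_bar_aux]))

/-- The counit on `B̄`. -/
def counitBar : Bbar k X →ₗ[k] k :=
  (relBar k X).liftQ (counit k).toLinearMap (Submodule.span_le.2 (by
    rintro _ ⟨x, b, rfl⟩
    simp [counit]))

/-- The degree `n` part of `B̄`. -/
def degBar (n : ℕ) : Submodule k (Bbar k X) := (deg k X n).map (toBar k X)

/-- `B̄^N`, the image of `B^N` in `B̄`. -/
def BbarN : Submodule k (Bbar k X) := (BN k X).map (toBar k X)

/-- `B̄^D`, the image of `B^D` in `B̄`. -/
def BbarD : Submodule k (Bbar k X) := (BD k X).map (toBar k X)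

variable {X}

/-- The cycles of degree `n` in a graded subcomplex `S` of `B̄`. -/
def cyc (S : Submodule k (Bbar k X)) (n : ℕ) : Submodule k (Bbar k X) :=
  LinearMap.ker (dBar k X) ⊓ S ⊓ degBar k X n

/-- The boundaries of degree `n` in a graded subcomplex `S` of `B̄`. -/
def bdry (S : Submodule k (Bbar k X)) (n : ℕ) : Submodule k (Bbar k X) :=
  (S ⊓ degBar k X (n + 1)).map (dBar k X)

/-- The degree `n` homology of a graded subcomplex `S` of `B̄`. -/
abbrev Hlgy (S : Submodule k (Bbar k X)) (n : ℕ) : Type max u v :=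
  ↥(cyc k S n) ⧸ (bdry k S n).submoduleOf (cyc k S n)

/-- The map in homology induced by the inclusion of a graded subcomplex `S` into `B̄`. -/
def hlgyIncl (S : Submodule k (Bbar k X)) (n : ℕ) :
    Hlgy k S n →ₗ[k] Hlgy k (⊤ : Submodule k (Bbar k X)) n :=
  Submodule.mapQ _ _
    (Submodule.inclusion (inf_le_inf_right _ (inf_le_inf_left _ le_top)))
    (fun z hz => by
      obtain ⟨b, hb, h⟩ := hz
      exact ⟨b, ⟨trivial, hb.2⟩, h⟩)

variable (X)

/-- The map `H̄_n → B̄ / im d` that sends the class of a cycle to its class modulo boundaries. -/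
def hlgyToCoker (n : ℕ) :
    Hlgy k (⊤ : Submodule k (Bbar k X)) n →ₗ[k] Bbar k X ⧸ LinearMap.range (dBar k X) :=
  Submodule.liftQ _ ((LinearMap.range (dBar k X)).mkQ ∘ₗ (cyc k ⊤ n).subtype) (by
    rintro z ⟨b, -, h⟩
    simp only [LinearMap.mem_ker, LinearMap.comp_apply, Submodule.mkQ_apply,
      Submodule.Quotient.mk_eq_zero]
    exact ⟨b, h⟩)

/-- The map `Ψ : H̄ → H̄ ⊗ H̄`, given by its components `H̄_n → H̄_p ⊗ H̄_q` for `p + q = n`, is induced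
by `Φ : B̄ → B̄ ⊗ B̄`: for each cycle `z`, the image of the class of `z` and the element `Φ z` agree
in `(B̄ / im d) ⊗ (B̄ / im d)`. -/
def InducedOnHlgy (Φ : Bbar k X →ₗ[k] Bbar k X ⊗[k] Bbar k X)
    (Ψ : ∀ n p q : ℕ, p + q = n → Hlgy k (⊤ : Submodule k (Bbar k X)) n →ₗ[k]
      Hlgy k (⊤ : Submodule k (Bbar k X)) p ⊗[k] Hlgy k (⊤ : Submodule k (Bbar k X)) q) : Prop :=
  ∀ (n : ℕ) (z : Bbar k X) (hz : z ∈ cyc k ⊤ n),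
    ∑ i ∈ (Finset.HasAntidiagonal.antidiagonal n).attach,
      TensorProduct.map (hlgyToCoker k X i.1.1) (hlgyToCoker k X i.1.2)
        (Ψ n i.1.1 i.1.2 (Finset.HasAntidiagonal.mem_antidiagonal.1 i.2) (Submodule.Quotient.mk ⟨z, hz⟩)) =
    TensorProduct.map (LinearMap.range (dBar k X)).mkQ (LinearMap.range (dBar k X)).mkQ (Φ z)

end

/-! ### `+`-coZinbiel coalgebras and `+`-Zinbiel algebras -/

/-- A graded coproduct `Δ` with a decomposition into `L : C⁺ → C⁺ ⊗ C` and `R : C⁺ → C ⊗ C⁺`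
(extended by zero to `C₀`) that makes `C = ⨁ Cₙ` a `+`-coZinbiel coalgebra.  All maps are given by
their components `Cₙ → C_p ⊗ C_q` for `p + q = n`. -/
structure IsPlusCoZinbiel (k : Type*) [CommRing k] (C : ℕ → Type*) [∀ n, AddCommGroup (C n)]
    [∀ n, Module k (C n)] (Δ L R : ∀ n p q : ℕ, p + q = n → C n →ₗ[k] C p ⊗[k] C q) : Prop where
  left_zero : ∀ n q (h : 0 + q = n), L n 0 q h = 0
  right_zero : ∀ n p (h : p + 0 = n), R n p 0 h = 0
  sum : ∀ n p q (h : p + q = n), 1 ≤ n → Δ n p q h = L n p q h + R n p q h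
  coassoc : ∀ n p q r s t (h₁ : p + q = s) (h₂ : s + r = n) (h₃ : q + r = t) (h₄ : p + t = n)
    (c : C n), TensorProduct.assoc k _ _ _ ((Δ s p q h₁).rTensor _ (Δ n s r h₂ c)) =
      (Δ t q r h₃).lTensor _ (Δ n p t h₄ c)
  dendri₁ : ∀ n p q r s t (h₁ : p + q = s) (h₂ : s + r = n) (h₃ : q + r = t) (h₄ : p + t = n)
    (c : C n), TensorProduct.assoc k _ _ _ ((L s p q h₁).rTensor _ (L n s r h₂ c)) =
      (Δ t q r h₃).lTensor _ (L n p t h₄ c)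
  dendri₂ : ∀ n p q r s t (h₁ : p + q = s) (h₂ : s + r = n) (h₃ : q + r = t) (h₄ : p + t = n)
    (c : C n), (R t q r h₃).lTensor _ (R n p t h₄ c) =
      TensorProduct.assoc k _ _ _ ((Δ s p q h₁).rTensor _ (R n s r h₂ c))
  dendri₃ : ∀ n p q r s t (h₁ : p + q = s) (h₂ : s + r = n) (h₃ : q + r = t) (h₄ : p + t = n)
    (c : C n), (L t q r h₃).lTensor _ (R n p t h₄ c) =
      TensorProduct.assoc k _ _ _ ((R s p q h₁).rTensor _ (L n s r h₂ c))
  flip : ∀ n p q (h : p + q = n) (h' : q + p = n) (c : C n),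
    R n p q h c = (-1 : k) ^ (p * q) • TensorProduct.comm k _ _ (L n q p h' c)

/-- A graded product `cup` with a decomposition into `L : C⁺ ⊗ C → C⁺` and `R : C ⊗ C⁺ → C⁺`
(extended by zero) that makes `C = ⨁ Cₙ` a `+`-Zinbiel algebra.  All maps are given by their
components `C_p ⊗ C_q → Cₙ` for `p + q = n`. -/
structure IsPlusZinbiel (k : Type*) [CommRing k] (C : ℕ → Type*) [∀ n, AddCommGroup (C n)]
    [∀ n, Module k (C n)]
    (cup L R : ∀ p q n : ℕ, p + q = n → C p →ₗ[k] C q →ₗ[k] C n) : Prop where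
  left_zero : ∀ q n (h : 0 + q = n), L 0 q n h = 0
  right_zero : ∀ p n (h : p + 0 = n), R p 0 n h = 0
  sum : ∀ p q n (h : p + q = n), 1 ≤ n → cup p q n h = L p q n h + R p q n h
  assoc : ∀ p q r s t n (h₁ : p + q = s) (h₂ : s + r = n) (h₃ : q + r = t) (h₄ : p + t = n)
    (a : C p) (b : C q) (c : C r),
    cup s r n h₂ (cup p q s h₁ a b) c = cup p t n h₄ a (cup q r t h₃ b c)
  dendri₁ : ∀ p q r s t n (h₁ : p + q = s) (h₂ : s + r = n) (h₃ : q + r = t) (h₄ : p + t = n)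
    (a : C p) (b : C q) (c : C r),
    L s r n h₂ (L p q s h₁ a b) c = L p t n h₄ a (cup q r t h₃ b c)
  dendri₂ : ∀ p q r s t n (h₁ : p + q = s) (h₂ : s + r = n) (h₃ : q + r = t) (h₄ : p + t = n)
    (a : C p) (b : C q) (c : C r),
    R p t n h₄ a (R q r t h₃ b c) = R s r n h₂ (cup p q s h₁ a b) c
  dendri₃ : ∀ p q r s t n (h₁ : p + q = s) (h₂ : s + r = n) (h₃ : q + r = t) (h₄ : p + t = n)
    (a : C p) (b : C q) (c : C r),
    R p t n h₄ a (L q r t h₃ b c) = L s r n h₂ (R p q s h₁ a b) c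
  flip : ∀ p q n (h : p + q = n) (h' : q + p = n) (a : C p) (b : C q),
    R p q n h a b = (-1 : k) ^ (p * q) • L q p n h' b a

/-! ### Rack and quandle cohomology -/

section

variable (k : Type v) [CommRing k] (X : Type u) [Shelf X]

/-- Rack cochains of degree `n`: functions on `Xⁿ`. -/
abbrev Cochain (n : ℕ) : Type max u v := (Fin n → X) → k

variable {X}

/-- Omit the `i`-th entry. -/
def face₀ {n : ℕ} (i : Fin (n + 1)) (x : Fin (n + 1) → X) : Fin n → X :=
  fun j => x (i.succAbove j)

/-- Omit the `i`-th entry and let it act on the entries before it. -/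
def face₁ {n : ℕ} (i : Fin (n + 1)) (x : Fin (n + 1) → X) : Fin n → X :=
  fun j => if j.castSucc < i then up (x j.castSucc) (x i) else x j.succ

variable (X)

/-- The rack differential `∂*` in degree `n`. -/
def delta (n : ℕ) : Cochain k X n →ₗ[k] Cochain k X (n + 1) where
  toFun f x := ∑ i : Fin (n + 1), (-1 : k) ^ (i : ℕ) * (f (face₀ i x) - f (face₁ i x))
  map_add' f f' := by
    funext x
    simp only [Pi.add_apply, ← Finset.sum_add_distrib]
    exact Finset.sum_congr rfl fun i _ => by ring
  map_smul' c f := by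
    funext x
    simp only [Pi.smul_apply, smul_eq_mul, Finset.mul_sum, RingHom.id_apply]
    exact Finset.sum_congr rfl fun i _ => by ring

/-- The coboundaries of degree `n` of a graded subcomplex `S` of `C^•(X, k)`. -/
def cobdry (S : ∀ n, Submodule k (Cochain k X n)) : ∀ n, Submodule k (Cochain k X n)
  | 0 => ⊥
  | n + 1 => (S n).map (delta k X n)

/-- The cocycles of degree `n` of a graded subcomplex `S` of `C^•(X, k)`. -/
def cocyc (S : ∀ n, Submodule k (Cochain k X n)) (n : ℕ) : Submodule k (Cochain k X n) :=
  LinearMap.ker (delta k X n) ⊓ S n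

/-- The degree `n` cohomology of a graded subcomplex `S` of `C^•(X, k)`. -/
abbrev Coh (S : ∀ n, Submodule k (Cochain k X n)) (n : ℕ) : Type max u v :=
  ↥(cocyc k X S n) ⧸ (cobdry k X S n).submoduleOf (cocyc k X S n)

/-- Rack cohomology. -/
abbrev HR (n : ℕ) : Type max u v := Coh k X (fun _ => ⊤) n

theorem cobdry_mono (S : ∀ n, Submodule k (Cochain k X n)) (n : ℕ) :
    cobdry k X S n ≤ cobdry k X (fun _ => ⊤) n := by
  cases n with
  | zero => exact le_rfl
  | succ n => exact Submodule.map_mono le_top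

/-- The map in cohomology induced by the inclusion of a graded subcomplex. -/
def cohIncl (S : ∀ n, Submodule k (Cochain k X n)) (n : ℕ) : Coh k X S n →ₗ[k] HR k X n :=
  Submodule.mapQ _ _ (Submodule.inclusion (inf_le_inf_left _ le_top))
    (fun _ hz => cobdry_mono k X S n hz)

/-- Quandle cochains: the cochains on the quotient of `C_n(X, k)` by the span of all words with
repeating neighbours. -/
def CQ (n : ℕ) : Submodule k (Cochain k X n) where
  carrier := {f | ∀ (x : Fin n → X) (i j : Fin n), (i : ℕ) + 1 = j → x i = x j → f x = 0}
  add_mem' hf hf' x i j h hx := by simp [hf x i j h hx, hf' x i j h hx]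
  zero_mem' _ _ _ _ _ := rfl
  smul_mem' c f hf x i j h hx := by simp [hf x i j h hx]

variable {X}

/-! Cochains are identified with the `A`-linear maps `B → k`, via `x₁ ⋯ xₙ ↔ e_{x₁} ⋯ e_{xₙ}`. -/

/-- The right action of `B` on the free module on all words in `X`: the generator `e_x` appends
the letter `x`, the generator `x` acts on every letter. -/
def wordAction : B k X →ₐ[k] (Module.End k (List X →₀ k))ᵐᵒᵖ :=
  lift (fun x => MulOpposite.op (Finsupp.lmapDomain k k (List.map fun y => up y x)))
    (fun x => MulOpposite.op (Finsupp.lmapDomain k k fun w => w ++ [x]))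
    (fun x y => by
      rw [← MulOpposite.op_mul, ← MulOpposite.op_mul]
      congr 1
      ext w : 2
      simp [Function.comp_def, up_up _ x y])
    (fun x y => by
      rw [← MulOpposite.op_mul, ← MulOpposite.op_mul]
      congr 1
      ext w : 2
      simp)

/-- The map `B → k⟨X⟩` with `x b ↦ b` and `e_{x₁} ⋯ e_{xₙ} ↦ x₁ ⋯ xₙ`. -/
def toWords : B k X →ₗ[k] (List X →₀ k) :=
  (LinearMap.applyₗ (Finsupp.single [] 1) : Module.End k (List X →₀ k) →ₗ[k] _) ∘ₗ
    (MulOpposite.opLinearEquiv k).symm.toLinearMap ∘ₗ (wordAction k).toLinearMap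

variable {k}

/-- The `A`-linear map `B → k` that corresponds to a cochain `f` of degree `n`; see `ev_g_mul` and
`ev_eWord`. -/
def ev {n : ℕ} (f : Cochain k X n) : B k X →ₗ[k] k :=
  Finsupp.linearCombination k
    (fun w : List X => if h : w.length = n then f fun i => w.get (i.cast h.symm) else 0) ∘ₗ
      toWords k

theorem toWords_g_mul (x : X) (b : B k X) : toWords k (g k x * b) = toWords k b := by
  simp [toWords, wordAction]

theorem toWords_eWord (l : List X) : toWords k (eWord k l) = Finsupp.single l 1 := by
  have h : ∀ (l w : List X), MulOpposite.unop (wordAction k (eWord k l)) (Finsupp.single w 1) =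
      Finsupp.single (w ++ l) 1 := by
    intro l
    induction l with
    | nil => intro w; simp [eWord]
    | cons x l ih =>
      intro w
      have hx : eWord k (x :: l) = e k x * eWord k l := by simp [eWord]
      rw [hx, map_mul, MulOpposite.unop_mul, Module.End.mul_apply]
      have h₁ : MulOpposite.unop (wordAction k (e k x)) (Finsupp.single w 1) =
          Finsupp.single (w ++ [x]) 1 := by simp [wordAction]
      rw [h₁, ih]
      simp
  exact h l []

theorem ev_g_mul {n : ℕ} (f : Cochain k X n) (x : X) (b : B k X) : ev f (g k x * b) = ev f b := by
  simp [ev, toWords_g_mul]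

theorem ev_eWord {n : ℕ} (f : Cochain k X n) (l : List X) :
    ev f (eWord k l) =
      if h : l.length = n then f fun i => l.get (i.cast h.symm) else 0 := by
  simp [ev, toWords_eWord]

theorem ev_add {n : ℕ} (f f' : Cochain k X n) : ev (f + f') = ev f + ev f' := by
  ext b
  simp only [ev, LinearMap.comp_apply, LinearMap.add_apply, Finsupp.linearCombination_apply,
    Finsupp.sum, ← Finset.sum_add_distrib]
  refine Finset.sum_congr rfl fun w _ => ?_
  by_cases h : w.length = n <;> simp [h, mul_add]

theorem ev_smul {n : ℕ} (c : k) (f : Cochain k X n) : ev (c • f) = c • ev f := by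
  ext b
  simp only [ev, LinearMap.comp_apply, LinearMap.smul_apply, Finsupp.linearCombination_apply,
    Finsupp.sum, Finset.smul_sum]
  refine Finset.sum_congr rfl fun w _ => ?_
  by_cases h : w.length = n <;> simp [h]; ring

variable (k X)

/-- The degenerate cochains: the cochains that vanish on `B̄^N`, i.e. the dual of the degenerate
subcomplex for the decomposition `B̄ = B̄^N ⊕ B̄^D`. -/
def CD (n : ℕ) : Submodule k (Cochain k X n) where
  carrier := {f | ∀ b ∈ BN k X, ev f b = 0}
  add_mem' hf hf' b hb := by simp [ev_add, hf b hb, hf' b hb]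
  zero_mem' b hb := by
    have h := ev_smul (0 : k) (0 : Cochain k X n)
    rw [zero_smul, zero_smul] at h
    rw [h]
    rfl
  smul_mem' c f hf b hb := by simp [ev_smul, hf b hb]

/-- Quandle cohomology. -/
abbrev HQ (n : ℕ) : Type max u v := Coh k X (CQ k X) n

/-- The degenerate part of rack cohomology. -/
abbrev HD (n : ℕ) : Type max u v := Coh k X (CD k X) n

variable {k X}

/-- The product of cochains of degrees `p`, `q` dual to `Φ : B → B ⊗ B`, in degree `n`:
`(f · f')(x₁ ⋯ xₙ) = (f ⊗ f') Φ(e_{x₁} ⋯ e_{xₙ})`, where, by the Koszul sign rule,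
`(f ⊗ f')(b ⊗ b') = (-1) ^ (p q) f(b) f'(b')`. -/
def dualProd (Φ : B k X →ₗ[k] B k X ⊗[k] B k X) {p q : ℕ} (f : Cochain k X p) (f' : Cochain k X q)
    (n : ℕ) : Cochain k X n :=
  fun x => (-1 : k) ^ (p * q) *
    LinearMap.mul' k k (TensorProduct.map (ev f) (ev f') (Φ (eWord k (List.ofFn x))))

variable (k X)

/-- A family of bilinear maps on rack cohomology is induced by the product of cochains dual to `Φ`:
the product of cocycles is a cocycle, and the maps send the classes of two cocycles to the class of
their product. -/
def InducedOnCoh (Φ : B k X →ₗ[k] B k X ⊗[k] B k X)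
    (m : ∀ p q n : ℕ, p + q = n → HR k X p →ₗ[k] HR k X q →ₗ[k] HR k X n) : Prop :=
  ∀ (p q n : ℕ) (h : p + q = n) (f : Cochain k X p) (f' : Cochain k X q)
    (hf : f ∈ cocyc k X (fun _ => ⊤) p) (hf' : f' ∈ cocyc k X (fun _ => ⊤) q),
    ∃ hm : dualProd Φ f f' n ∈ cocyc k X (fun _ => ⊤) n,
      m p q n h (Submodule.Quotient.mk ⟨f, hf⟩) (Submodule.Quotient.mk ⟨f', hf'⟩) =
        Submodule.Quotient.mk ⟨dualProd Φ f f' n, hm⟩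

end

end RackBialg

end

/-! Everything rests on one explicit projection. Send `e_x` to the 2 × 2 matrix that is the product
of the column `(1, -e_x)` and the row `(e_x, 1)`, and `x` to the scalar matrix `x`. The row of `x`
times the column of `y` is `e_x - e_y`, so the matrix of `e_x` has square zero, and the upper left
entry of the matrix of `e_{x₁} ⋯ e_{xₙ}` is `(e_{x₁} - e_{x₂}) ⋯ (e_{xₙ₋₁} - e_{xₙ}) e_{xₙ}`. That
entry defines a linear map `norm` which kills `B^D`, takes values in `B^N` and differs from the
identity by elements of `B^D`. It is therefore idempotent with image `B^N` and kernel `B^D`. The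
axiom `x^x = x` makes `x` commute with `e_x`; hence `d (e_x²) = 0` and `Δ (e_x²) = e_x² ⊗ x² + 1 ⊗
e_x²`, so that `B^D` is a subcomplex and a coideal. On the other side, `B^N` is stable under left
multiplication by `A` and by the differences `e_x - e_y` (`e_sub_e_mul_mem_BN`), and this gives
stability under `d` and the inclusion of the coproducts of `B^N` in `B ⊗ B^N`. Thus `norm` commutes
with `d`, and both decompositions, in homology and in cohomology, follow.

The quotient `B̄` has the words in the `e_x` as a basis. Linear maps out of it are compared by
appending one letter on the right (`bar_ext`). The coproduct and its two halves satisfy the same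
recursion with different initial values, encoded in `IsCoprod`; from it the chain map property and
all four coassociativity laws are derived uniformly (`IsCoprod.dBar`, `IsCoprod.coassoc`). These
laws hold before passing to homology. Only the symmetry between the halves needs a homotopy: the
identity `d (e_x ⊗ e_x) = Δ e_x - Δ^op e_x` yields a recursive homotopy between the left half and
the signed flip of the right half (`dSq_htpy`).

That symmetry also supplies what chains do not. On chains only the right tensor factor of a
coproduct of `B^N` is known to be normalized; in homology the flip exchanges the halves, hence the
factors, and so gives both (`map_hlgyNorm_comulLeft`). Dually, a product with a degenerate right
factor is degenerate already on cochains, and with a degenerate left factor it is so in cohomology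
(`comulLeft_mem_range_CD'`).

Over a field, the homology of the tensor square is avoided. One chooses linear maps `r n` from `B̄`
to homology that extend the class maps on cycles and kill boundaries, and takes `(r p ⊗ r q) Φ` as
the induced coproduct. A cycle of `B̄ ⊗ B̄` does not distinguish maps that agree on cycles, as long
as the map on the other factor kills boundaries (`map_eq_map_of_cycles_left`,
`map_eq_map_of_cycles_right`); this carries the chain identities over to homology. In cohomology no
field is needed, because products of cochains pass to classes by the Leibniz rule `delta_cochProd`.
-/

noncomputable section

namespace RackBialg

universe u v

/-! ### Normal forms of monomials and the sign automorphism of `B`. -/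

section Monomials

variable (k : Type v) [CommRing k] {X : Type u} [Shelf X]

@[simp] theorem gWord_nil : gWord k ([] : List X) = 1 := rfl

@[simp] theorem eWord_nil : eWord k ([] : List X) = 1 := rfl

theorem gWord_cons (x : X) (l : List X) : gWord k (x :: l) = g k x * gWord k l := by simp [gWord]

theorem eWord_cons (x : X) (l : List X) : eWord k (x :: l) = e k x * eWord k l := by simp [eWord]

theorem gWord_append (l l' : List X) : gWord k (l ++ l') = gWord k l * gWord k l' := by
  simp [gWord]

theorem eWord_append (l l' : List X) : eWord k (l ++ l') = eWord k l * eWord k l' := by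
  simp [eWord]

@[simp] theorem gWord_singleton (x : X) : gWord k [x] = g k x := by simp [gWord]

@[simp] theorem eWord_singleton (x : X) : eWord k [x] = e k x := by simp [eWord]

/-- Moving a degree zero generator to the left of a word. -/
theorem eWord_mul_g (l : List X) (x : X) :
    eWord k l * g k x = g k x * eWord k (l.map fun y => up y x) := by
  induction l with
  | nil => simp
  | cons y l ih =>
    rw [eWord_cons, mul_assoc, ih, List.map_cons, eWord_cons, ← mul_assoc, ← g_mul_e, mul_assoc]

/-- A generator `x` passes a difference `e_y - e_z` by acting on both letters, so the shape of these
products survives. This makes `B^N` stable under right multiplication by `A`. -/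
theorem nWord_mul_g (l : List X) (x : X) :
    nWord k l * g k x = g k x * nWord k (l.map fun y => up y x) := by
  induction l with
  | nil => simp [nWord]
  | cons y l ih =>
    cases l with
    | nil => simp [nWord, g_mul_e]
    | cons z l =>
      simp only [nWord, List.map_cons] at ih ⊢
      rw [mul_assoc, ih, ← mul_assoc, ← mul_assoc, sub_mul, mul_sub, g_mul_e, g_mul_e]

/-- Each monomial in the generators is of the form `x₁ ⋯ x_m e_{y₁} ⋯ e_{yₙ}`. -/
theorem exists_gWord_mul_eWord (s : List (X ⊕ X)) :
    ∃ a l : List X, l.length = s.countP Sum.isRight ∧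
      (s.map (gen k)).prod = gWord k a * eWord k l := by
  induction s using List.reverseRecOn with
  | nil => exact ⟨[], [], by simp⟩
  | append_singleton s c ih =>
    obtain ⟨a, l, hl, h⟩ := ih
    rcases c with x | x
    · refine ⟨a ++ [x], l.map fun y => up y x, by simp [hl], ?_⟩
      rw [List.map_append, List.prod_append, h, gWord_append, mul_assoc, mul_assoc,
        gWord_singleton, ← eWord_mul_g]
      simp [g]
    · refine ⟨a, l ++ [x], by simp [hl], ?_⟩
      rw [List.map_append, List.prod_append, h, eWord_append, mul_assoc, eWord_singleton]
      simp [e]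

theorem gWord_mul_eWord_mem_deg (a l : List X) : gWord k a * eWord k l ∈ deg k X l.length := by
  refine Submodule.subset_span ⟨a.map Sum.inl ++ l.map Sum.inr, ?_, ?_⟩
  · rw [List.countP_append, List.countP_map, List.countP_map]
    have h₁ : (Sum.isRight ∘ (Sum.inl : X → X ⊕ X)) = fun _ => false := rfl
    have h₂ : (Sum.isRight ∘ (Sum.inr : X → X ⊕ X)) = fun _ => true := rfl
    rw [h₁, h₂]
    simp
  · simp only [gWord, eWord, List.map_append, List.map_map, List.prod_append]
    rfl

theorem gWord_mem_deg (a : List X) : gWord k a ∈ deg k X 0 := by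
  simpa using gWord_mul_eWord_mem_deg k a []

variable (X) in
theorem deg_eq_span (n : ℕ) :
    deg k X n = Submodule.span k {b | ∃ a l : List X, l.length = n ∧ b = gWord k a * eWord k l} := by
  apply le_antisymm
  · refine Submodule.span_le.2 ?_
    rintro _ ⟨s, hs, rfl⟩
    obtain ⟨a, l, hl, h⟩ := exists_gWord_mul_eWord k s
    exact Submodule.subset_span ⟨a, l, hl.trans hs, h⟩
  · refine Submodule.span_le.2 ?_
    rintro _ ⟨a, l, rfl, rfl⟩
    exact gWord_mul_eWord_mem_deg k a l

variable {k}

/-- Only the spanning property of the normal forms is used; their linear independence in `B` is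
never needed. -/
theorem monomial_induction {P : B k X → Prop} (hmon : ∀ a l, P (gWord k a * eWord k l))
    (hzero : P 0) (hadd : ∀ a b, P a → P b → P (a + b)) (hsmul : ∀ (c : k) b, P b → P (c • b))
    (b : B k X) : P b := by
  induction b using DirectSum.Decomposition.inductionOn (deg k X) with
  | zero => exact hzero
  | @homogeneous n b =>
    obtain ⟨b, hb⟩ := b
    change P b
    rw [deg_eq_span] at hb
    induction hb using Submodule.span_induction with
    | mem b h => obtain ⟨a, l, -, rfl⟩ := h; exact hmon a l
    | zero => exact hzero
    | add a b _ _ iha ihb => exact hadd _ _ iha ihb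
    | smul c b _ ih => exact hsmul _ _ ih
  | add a b ha hb => exact hadd _ _ ha hb

theorem linearMap_ext_monomial {M : Type*} [AddCommGroup M] [Module k M] {φ ψ : B k X →ₗ[k] M}
    (h : ∀ a l, φ (gWord k a * eWord k l) = ψ (gWord k a * eWord k l)) : φ = ψ := by
  ext b
  induction b using monomial_induction with
  | hmon a l => exact h a l
  | hzero => simp
  | hadd a b ha hb => simp [ha, hb]
  | hsmul c b hb => simp [hb]

variable (k X)

theorem gWord_mem_A (a : List X) : gWord k a ∈ A k X :=
  Subalgebra.list_prod_mem _ (by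
    intro b hb
    obtain ⟨x, -, rfl⟩ := List.mem_map.1 hb
    exact Algebra.subset_adjoin ⟨x, rfl⟩)

theorem g_mem_A (x : X) : g k x ∈ A k X := Algebra.subset_adjoin ⟨x, rfl⟩

variable {X}

/-- A submodule that is stable under left multiplication by the generators `x` is stable under
left multiplication by `A`. -/
theorem left_mem_of_g {P : Submodule k (B k X)} (h : ∀ x, ∀ b ∈ P, g k x * b ∈ P) {a : B k X}
    (ha : a ∈ A k X) : ∀ b ∈ P, a * b ∈ P := by
  induction ha using Algebra.adjoin_induction with
  | mem a h' => obtain ⟨x, rfl⟩ := h'; exact h x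
  | algebraMap r =>
    intro b hb
    rw [Algebra.algebraMap_eq_smul_one, smul_mul_assoc, one_mul]
    exact P.smul_mem _ hb
  | add a b _ _ ha hb => intro c hc; rw [add_mul]; exact add_mem (ha c hc) (hb c hc)
  | mul a b _ _ ha hb => intro c hc; rw [mul_assoc]; exact ha _ (hb c hc)

theorem right_mem_of_g {P : Submodule k (B k X)} (h : ∀ x, ∀ b ∈ P, b * g k x ∈ P) {a : B k X}
    (ha : a ∈ A k X) : ∀ b ∈ P, b * a ∈ P := by
  induction ha using Algebra.adjoin_induction with
  | mem a h' => obtain ⟨x, rfl⟩ := h'; exact h x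
  | algebraMap r =>
    intro b hb
    rw [Algebra.algebraMap_eq_smul_one, mul_smul_comm, mul_one]
    exact P.smul_mem _ hb
  | add a b _ _ ha hb => intro c hc; rw [mul_add]; exact add_mem (ha c hc) (hb c hc)
  | mul a b _ _ ha hb => intro c hc; rw [← mul_assoc]; exact hb _ (ha c hc)

@[simp] theorem sgn_g (x : X) : sgn k (g k x) = g k x := by simp [sgn]

@[simp] theorem sgn_e (x : X) : sgn k (e k x) = - e k x := by simp [sgn]

theorem sgn_gWord_mul (a : List X) (b : B k X) :
    sgn k (gWord k a * b) = gWord k a * sgn k b := by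
  induction a with
  | nil => simp
  | cons x a ih => rw [gWord_cons, mul_assoc, map_mul, ih, sgn_g, mul_assoc]

theorem sgn_eWord (l : List X) : sgn k (eWord k l) = (-1 : k) ^ l.length • eWord k l := by
  induction l with
  | nil => simp
  | cons x l ih => rw [eWord_cons, map_mul, ih]; simp [pow_succ]

theorem sgn_of_mem_deg {n : ℕ} {b : B k X} (hb : b ∈ deg k X n) : sgn k b = (-1 : k) ^ n • b := by
  rw [deg_eq_span] at hb
  induction hb using Submodule.span_induction with
  | mem b h => obtain ⟨a, l, rfl, rfl⟩ := h; rw [sgn_gWord_mul, sgn_eWord, mul_smul_comm]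
  | zero => simp
  | add a b _ _ iha ihb => rw [map_add, iha, ihb, smul_add]
  | smul c b _ ih => rw [map_smul, ih, smul_comm]

end Monomials

/-! ### The projection to `B^N` along `B^D` -/

section Projection

variable (k : Type v) [CommRing k] {X : Type u} [Shelf X]

/-- The algebra map to matrices whose first entry is the projection to `B^N` along `B^D`. -/
def normMatrix : B k X →ₐ[k] Matrix (Fin 2) (Fin 2) (B k X) :=
  -- The matrix of `e_x` is the column `(1, -e_x)` times the row `(e_x, 1)`. The row of `x` times
  -- the column of `y` is `e_x - e_y`.
  lift (fun x => !![g k x, 0; 0, g k x]) (fun x => !![e k x, 1; -(e k x * e k x), - e k x])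
    (fun x y => by simp [g_mul_g])
    (fun x y => by
      have h : g k y * (e k (up x y) * e k (up x y)) = e k x * e k x * g k y := by
        rw [← mul_assoc, g_mul_e, mul_assoc, g_mul_e, mul_assoc]
      simp [g_mul_e, h])

/-- The projection of `B` to `B^N` along `B^D`. -/
def norm : B k X →ₗ[k] B k X :=
  Matrix.entryLinearMap k (B k X) 0 0 ∘ₗ (normMatrix k).toLinearMap

theorem norm_apply (b : B k X) : norm k b = normMatrix k b 0 0 := rfl

@[simp] theorem normMatrix_g (x : X) : normMatrix k (g k x) = !![g k x, 0; 0, g k x] := by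
  simp [normMatrix]

@[simp] theorem normMatrix_e (x : X) :
    normMatrix k (e k x) = !![e k x, 1; -(e k x * e k x), - e k x] := by
  simp [normMatrix]

theorem norm_g_mul (x : X) (b : B k X) : norm k (g k x * b) = g k x * norm k b := by
  simp [norm_apply, Matrix.mul_apply]

theorem norm_gWord_mul (a : List X) (b : B k X) : norm k (gWord k a * b) = gWord k a * norm k b := by
  induction a with
  | nil => simp
  | cons x a ih => rw [gWord_cons, mul_assoc, norm_g_mul, ih, mul_assoc]

/-- The first column is `(1, -e_x)` times the normalized word. The induction carries both entries
because the new upper entry involves the old lower one. -/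
theorem normMatrix_eWord (x : X) (l : List X) :
    normMatrix k (eWord k (x :: l)) 0 0 = nWord k (x :: l) ∧
      normMatrix k (eWord k (x :: l)) 1 0 = - (e k x * nWord k (x :: l)) := by
  induction l generalizing x with
  | nil => simp [eWord, nWord]
  | cons y l ih =>
    obtain ⟨h₀, h₁⟩ := ih y
    rw [eWord_cons k x, map_mul, Matrix.mul_apply, Matrix.mul_apply, Fin.sum_univ_two,
      Fin.sum_univ_two, h₀, h₁, normMatrix_e]
    constructor
    · simp only [nWord, sub_mul]
      simp [sub_eq_add_neg]
    · simp only [nWord, sub_mul, mul_sub]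
      simp [mul_assoc]
      abel

theorem norm_eWord (l : List X) : norm k (eWord k l) = nWord k l := by
  cases l with
  | nil => simp [norm_apply, nWord]
  | cons x l => exact (normMatrix_eWord k x l).1

/-- The matrix of `e_x²` vanishes because the row `(e_x, 1)` kills the column `(1, -e_x)`. As
`normMatrix` is multiplicative, the whole ideal generated by these squares goes to zero. -/
theorem norm_of_mem_BD {b : B k X} (hb : b ∈ BD k X) : norm k b = 0 := by
  induction hb using Submodule.span_induction with
  | mem b h =>
    obtain ⟨p, q, x, rfl⟩ := h
    have h : normMatrix k (e k x * e k x) = 0 := by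
      rw [map_mul, normMatrix_e]
      ext i j
      fin_cases i <;> fin_cases j <;> simp [Matrix.mul_apply, mul_assoc]
    rw [norm_apply, map_mul, map_mul, h]
    simp
  | zero => simp
  | add a b _ _ iha ihb => rw [map_add, iha, ihb, add_zero]
  | smul c b _ ih => rw [map_smul, ih, smul_zero]

/-- The span of the words with equal neighbours. -/
def repSpan (n : ℕ) : Submodule k (B k X) :=
  Submodule.span k {b | ∃ (l l' : List X) (x : X), (l ++ x :: x :: l').length = n ∧
    b = eWord k (l ++ x :: x :: l')}

theorem repSpan_le_BD (n : ℕ) : repSpan k n ≤ BD k X := by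
  refine Submodule.span_le.2 ?_
  rintro _ ⟨l, l', x, -, rfl⟩
  refine Submodule.subset_span ⟨eWord k l, eWord k l', x, ?_⟩
  simp [eWord_append, eWord_cons, mul_assoc]

theorem e_mul_mem_repSpan (x : X) {n : ℕ} {b : B k X} (hb : b ∈ repSpan k n) :
    e k x * b ∈ repSpan k (n + 1) := by
  induction hb using Submodule.span_induction with
  | mem b h =>
    obtain ⟨l, l', y, hn, rfl⟩ := h
    exact Submodule.subset_span ⟨x :: l, l', y, by simp at hn ⊢; omega,
      by rw [List.cons_append, eWord_cons]⟩
  | zero => simp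
  | add a b _ _ iha ihb => rw [mul_add]; exact add_mem iha ihb
  | smul c b _ ih => rw [mul_smul_comm]; exact Submodule.smul_mem _ _ ih

/-- For a word `w` that begins with `y` and its normalization `n`, one has `e_x w - (e_x - e_y) n =
e_x (w - n) - e_y (w - n) + e_y w`, and `e_y w` has equal neighbours. Staying inside the span of
words, instead of the larger ideal `B^D`, lets quandle cochains be evaluated directly on this
difference. -/
theorem eWord_sub_nWord_mem (l : List X) : eWord k l - nWord k l ∈ repSpan k l.length := by
  induction l with
  | nil => simp [nWord]
  | cons x l ih =>
    cases l with
    | nil => simp [nWord]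
    | cons y l =>
      have h : eWord k (x :: y :: l) - nWord k (x :: y :: l) =
          e k x * (eWord k (y :: l) - nWord k (y :: l)) -
            e k y * (eWord k (y :: l) - nWord k (y :: l)) + eWord k ([] ++ y :: y :: l) := by
        simp only [nWord, eWord_cons, List.nil_append]
        noncomm_ring
      rw [h]
      exact add_mem (sub_mem (e_mul_mem_repSpan k x ih) (e_mul_mem_repSpan k y ih))
        (Submodule.subset_span ⟨[], l, y, by simp, rfl⟩)

theorem left_mem_BD (b c : B k X) (hc : c ∈ BD k X) : b * c ∈ BD k X := by
  induction hc using Submodule.span_induction with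
  | mem c h =>
    obtain ⟨p, q, x, rfl⟩ := h
    exact Submodule.subset_span ⟨b * p, q, x, by simp only [mul_assoc]⟩
  | zero => simp
  | add a b _ _ iha ihb => rw [mul_add]; exact add_mem iha ihb
  | smul r c _ ih => rw [mul_smul_comm]; exact Submodule.smul_mem _ _ ih

theorem right_mem_BD (b c : B k X) (hc : c ∈ BD k X) : c * b ∈ BD k X := by
  induction hc using Submodule.span_induction with
  | mem c h =>
    obtain ⟨p, q, x, rfl⟩ := h
    exact Submodule.subset_span ⟨p, q * b, x, by simp only [mul_assoc]⟩
  | zero => simp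
  | add a b _ _ iha ihb => rw [add_mul]; exact add_mem iha ihb
  | smul r c _ ih => rw [smul_mul_assoc]; exact Submodule.smul_mem _ _ ih

theorem sub_norm_mem_BD (b : B k X) : b - norm k b ∈ BD k X := by
  induction b using monomial_induction with
  | hmon a l =>
    rw [norm_gWord_mul, norm_eWord, ← mul_sub]
    exact left_mem_BD k _ _ (repSpan_le_BD k _ (eWord_sub_nWord_mem k l))
  | hzero => simp
  | hadd a b ha hb => rw [map_add, add_sub_add_comm]; exact add_mem ha hb
  | hsmul c b hb => rw [map_smul, ← smul_sub]; exact Submodule.smul_mem _ _ hb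

theorem nWord_mem_BN (l : List X) : nWord k l ∈ BN k X :=
  Submodule.subset_span ⟨1, one_mem _, l, by simp⟩

theorem left_mem_BN {a : B k X} (ha : a ∈ A k X) : ∀ b ∈ BN k X, a * b ∈ BN k X := by
  intro b hb
  induction hb using Submodule.span_induction with
  | mem b h =>
    obtain ⟨a', ha', l, rfl⟩ := h
    exact Submodule.subset_span ⟨a * a', mul_mem ha ha', l, by simp only [mul_assoc]⟩
  | zero => simp
  | add a b _ _ iha ihb => rw [mul_add]; exact add_mem iha ihb
  | smul r c _ ih => rw [mul_smul_comm]; exact Submodule.smul_mem _ _ ih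

theorem A_eq_span : Subalgebra.toSubmodule (A k X) = Submodule.span k (Set.range (gWord k)) := by
  apply le_antisymm
  · intro a ha
    rw [Subalgebra.mem_toSubmodule] at ha
    have h := left_mem_of_g k (P := Submodule.span k (Set.range (gWord k (X := X)))) (fun x b hb => by
      induction hb using Submodule.span_induction with
      | mem b h =>
        obtain ⟨a, rfl⟩ := h
        exact Submodule.subset_span ⟨x :: a, gWord_cons k x a⟩
      | zero => simp
      | add a b _ _ iha ihb => rw [mul_add]; exact add_mem iha ihb
      | smul r c _ ih => rw [mul_smul_comm]; exact Submodule.smul_mem _ _ ih) ha 1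
      (Submodule.subset_span ⟨[], rfl⟩)
    rwa [mul_one] at h
  · refine Submodule.span_le.2 ?_
    rintro _ ⟨a, rfl⟩
    exact gWord_mem_A k X a

/-- `B^N` is spanned by the products of a word in the `x` with one of the given generators. -/
theorem BN_eq_span :
    BN k X = Submodule.span k {b | ∃ a l : List X, b = gWord k a * nWord k l} := by
  apply le_antisymm
  · refine Submodule.span_le.2 ?_
    rintro _ ⟨a, ha, l, rfl⟩
    have ha' : a ∈ Submodule.span k (Set.range (gWord k (X := X))) := by
      rw [← A_eq_span]; exact ha
    change a * nWord k l ∈ _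
    clear ha
    induction ha' using Submodule.span_induction with
    | mem b h => obtain ⟨a, rfl⟩ := h; exact Submodule.subset_span ⟨a, l, rfl⟩
    | zero => simp
    | add a b _ _ iha ihb => rw [add_mul]; exact add_mem iha ihb
    | smul r c _ ih => rw [smul_mul_assoc]; exact Submodule.smul_mem _ _ ih
  · refine Submodule.span_le.2 ?_
    rintro _ ⟨a, l, rfl⟩
    exact left_mem_BN k (gWord_mem_A k X a) _ (nWord_mem_BN k l)

theorem norm_mem_BN (b : B k X) : norm k b ∈ BN k X := by
  induction b using monomial_induction with
  | hmon a l =>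
    rw [norm_gWord_mul, norm_eWord]
    exact left_mem_BN k (gWord_mem_A k X a) _ (nWord_mem_BN k l)
  | hzero => simp
  | hadd a b ha hb => rw [map_add]; exact add_mem ha hb
  | hsmul c b hb => rw [map_smul]; exact Submodule.smul_mem _ _ hb

/-- No computation with words is required: `b - norm b` lies in `B^D`, which `norm` kills. -/
theorem norm_norm (b : B k X) : norm k (norm k b) = norm k b := by
  have h := norm_of_mem_BD k (sub_norm_mem_BD k b)
  rw [map_sub, sub_eq_zero] at h
  exact h.symm

theorem norm_of_mem_BN {b : B k X} (hb : b ∈ BN k X) : norm k b = b := by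
  rw [BN_eq_span] at hb
  induction hb using Submodule.span_induction with
  | mem b h =>
    obtain ⟨a, l, rfl⟩ := h
    rw [← norm_eWord, ← norm_gWord_mul, norm_norm]
  | zero => simp
  | add a b _ _ iha ihb => rw [map_add, iha, ihb]
  | smul c b _ ih => rw [map_smul, ih]

theorem mem_BD_iff {b : B k X} : b ∈ BD k X ↔ norm k b = 0 := by
  refine ⟨norm_of_mem_BD k, fun h => ?_⟩
  have := sub_norm_mem_BD k b
  rwa [h, sub_zero] at this

theorem mem_BN_iff {b : B k X} : b ∈ BN k X ↔ norm k b = b :=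
  ⟨norm_of_mem_BN k, fun h => h ▸ norm_mem_BN k b⟩

variable (X) in
theorem isCompl_BN_BD : IsCompl (BN k X) (BD k X) := by
  constructor
  · rw [Submodule.disjoint_def]
    intro b hN hD
    rw [← norm_of_mem_BN k hN, norm_of_mem_BD k hD]
  · rw [codisjoint_iff, eq_top_iff]
    intro b _
    rw [← add_sub_cancel (norm k b) b]
    exact Submodule.add_mem_sup (norm_mem_BN k b) (sub_norm_mem_BD k b)

theorem nWord_mem_deg (l : List X) : nWord k l ∈ deg k X l.length := by
  induction l with
  | nil => exact SetLike.GradedOne.one_mem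
  | cons x l ih =>
    cases l with
    | nil => exact e_mem_deg k x
    | cons y l =>
      have h := SetLike.GradedMul.mul_mem (A := deg k X) (sub_mem (e_mem_deg k x) (e_mem_deg k y)) ih
      rwa [add_comm] at h

theorem norm_mem_deg {n : ℕ} {b : B k X} (hb : b ∈ deg k X n) : norm k b ∈ deg k X n := by
  rw [deg_eq_span] at hb
  induction hb using Submodule.span_induction with
  | mem b h =>
    obtain ⟨a, l, rfl, rfl⟩ := h
    rw [norm_gWord_mul, norm_eWord]
    have h := SetLike.GradedMul.mul_mem (A := deg k X) (gWord_mem_deg k a) (nWord_mem_deg k l)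
    rwa [zero_add] at h
  | zero => simp
  | add a b _ _ iha ihb => rw [map_add]; exact add_mem iha ihb
  | smul c b _ ih => rw [map_smul]; exact Submodule.smul_mem _ _ ih

theorem decompose_norm (b : B k X) (n : ℕ) :
    (DirectSum.decompose (deg k X) (norm k b) n : B k X) =
      norm k (DirectSum.decompose (deg k X) b n) := by
  induction b using DirectSum.Decomposition.inductionOn (deg k X) with
  | zero => simp
  | @homogeneous m b =>
    by_cases h : m = n
    · subst h
      rw [DirectSum.decompose_of_mem_same _ (norm_mem_deg k b.2),
        DirectSum.decompose_of_mem_same _ b.2]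
    · rw [DirectSum.decompose_of_mem_ne _ (norm_mem_deg k b.2) h,
        DirectSum.decompose_of_mem_ne _ b.2 h, map_zero]
  | add a b ha hb => simp [DirectSum.decompose_add, ha, hb]

/-- A single `e_x` need not preserve `B^N` from the left, but differences do. The stability of `B^N`
under `d` and the coproducts is reduced to this. Letters of `A` in front of a normalized word are
passed by `(e_x - e_y) z = z (e_{x^z} - e_{y^z})`, which is why the induction generalizes over both
letters. -/
theorem e_sub_e_mul_mem_BN (x y : X) {b : B k X} (hb : b ∈ BN k X) :
    (e k x - e k y) * b ∈ BN k X := by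
  rw [BN_eq_span] at hb
  induction hb using Submodule.span_induction with
  | mem b h =>
    obtain ⟨a, l, rfl⟩ := h
    induction a generalizing x y with
    | nil =>
      rw [gWord_nil, one_mul]
      cases l with
      | nil =>
        rw [nWord, mul_one]
        exact sub_mem (nWord_mem_BN k [x]) (nWord_mem_BN k [y])
      | cons z l =>
        -- The first letter `z` of the word is inserted between the two: `e_x - e_y = (e_x - e_z) -
        -- (e_y - e_z)`.
        rw [← sub_sub_sub_cancel_right _ _ (e k z), sub_mul]
        exact sub_mem (nWord_mem_BN k (x :: z :: l)) (nWord_mem_BN k (y :: z :: l))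
    | cons z a ih =>
      rw [gWord_cons, mul_assoc, ← mul_assoc, sub_mul, ← g_mul_e, ← g_mul_e, ← mul_sub, mul_assoc]
      exact left_mem_BN k (g_mem_A k X z) _ (ih _ _)
  | zero => simp
  | add a b _ _ iha ihb => rw [mul_add]; exact add_mem iha ihb
  | smul c b _ ih => rw [mul_smul_comm]; exact Submodule.smul_mem _ _ ih

theorem d_gWord_mul (a : List X) (b : B k X) : d k (gWord k a * b) = gWord k a * d k b := by
  induction a with
  | nil => simp
  | cons x a ih =>
    rw [gWord_cons, mul_assoc, d_mul, ih, d_g, zero_mul, add_zero, sgn_g, mul_assoc]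

theorem d_one : d k (1 : B k X) = 0 := by
  have h := d_mul k (1 : B k X) 1
  rw [mul_one, map_one (sgn k), one_mul, mul_one] at h
  exact left_eq_add.1 h

/-- The Leibniz rule gives `d ((e_x - e_y) w) = (e_y - e_x) d w + (y - x) w`, in which the constant
terms of `d e_x` and `d e_y` have cancelled. Both summands stay in `B^N`. -/
theorem d_nWord_mem (l : List X) : d k (nWord k l) ∈ BN k X := by
  induction l with
  | nil => rw [nWord, d_one]; exact zero_mem _
  | cons x l ih =>
    cases l with
    | nil =>
      rw [nWord, d_e]
      have h := left_mem_BN k (g_mem_A k X x) _ (nWord_mem_BN k [])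
      exact sub_mem (nWord_mem_BN k []) (by simpa [nWord] using h)
    | cons y l =>
      rw [nWord, d_mul, map_sub (d k), d_e, d_e, map_sub, sgn_e, sgn_e, neg_sub_neg]
      refine add_mem (e_sub_e_mul_mem_BN k y x ih) (left_mem_BN k ?_ _ (nWord_mem_BN k _))
      exact sub_mem (sub_mem (one_mem _) (g_mem_A k X x)) (sub_mem (one_mem _) (g_mem_A k X y))

variable (X) in
theorem isDGSubbimodule_BN : IsDGSubbimodule k X (BN k X) where
  homogeneous b hb n := by
    rw [mem_BN_iff] at hb ⊢
    rw [← decompose_norm, hb]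
  d_mem b hb := by
    rw [BN_eq_span] at hb
    induction hb using Submodule.span_induction with
    | mem b h =>
      obtain ⟨a, l, rfl⟩ := h
      rw [d_gWord_mul]
      exact left_mem_BN k (gWord_mem_A k X a) _ (d_nWord_mem k l)
    | zero => simp
    | add a b _ _ iha ihb => rw [map_add]; exact add_mem iha ihb
    | smul c b _ ih => rw [map_smul]; exact Submodule.smul_mem _ _ ih
  left_mem a ha := left_mem_BN k ha
  right_mem a ha := right_mem_of_g k (fun x b hb => by
    rw [BN_eq_span] at hb
    induction hb using Submodule.span_induction with
    | mem b h =>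
      obtain ⟨a, l, rfl⟩ := h
      rw [mul_assoc, nWord_mul_g]
      exact left_mem_BN k (gWord_mem_A k X a) _
        (left_mem_BN k (g_mem_A k X x) _ (nWord_mem_BN k _))
    | zero => simp
    | add a b _ _ iha ihb => rw [add_mul]; exact add_mem iha ihb
    | smul c b _ ih => rw [smul_mul_assoc]; exact Submodule.smul_mem _ _ ih) ha

theorem sgn_mem_BD {b : B k X} (hb : b ∈ BD k X) : sgn k b ∈ BD k X := by
  induction hb using Submodule.span_induction with
  | mem b h =>
    obtain ⟨p, q, x, rfl⟩ := h
    exact Submodule.subset_span ⟨sgn k p, sgn k q, x, by simp⟩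
  | zero => simp
  | add a b _ _ iha ihb => rw [map_add]; exact add_mem iha ihb
  | smul c b _ ih => rw [map_smul]; exact Submodule.smul_mem _ _ ih

theorem up_self (hX : ∀ x : X, Shelf.act x x = x) (x : X) : up x x = x := hX x

theorem g_mul_e_self (hX : ∀ x : X, Shelf.act x x = x) (x : X) :
    g k x * e k x = e k x * g k x := by
  have h := g_mul_e k x x
  rwa [up_self hX] at h

/-- Here `x^x = x` enters: `d (e_x²) = e_x x - x e_x`, which vanishes because `x` and `e_x` commute.
Homogeneity is read off from `norm`, which preserves degrees and has kernel `B^D`. -/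
theorem isDGSubbimodule_BD (hX : ∀ x : X, Shelf.act x x = x) : IsDGSubbimodule k X (BD k X) where
  homogeneous b hb n := by
    rw [mem_BD_iff] at hb ⊢
    rw [← decompose_norm, hb]
    simp
  d_mem b hb := by
    induction hb using Submodule.span_induction with
    | mem b h =>
      obtain ⟨p, q, x, rfl⟩ := h
      have h : d k (e k x * e k x) = 0 := by
        rw [d_mul, d_e, sgn_e, mul_sub, sub_mul, g_mul_e_self k hX]
        noncomm_ring
      rw [d_mul, d_mul, h, mul_zero, zero_add]
      have hx : e k x * e k x ∈ BD k X := Submodule.subset_span ⟨1, 1, x, by simp⟩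
      refine add_mem (right_mem_BD k _ _ (sgn_mem_BD k (left_mem_BD k _ _ hx))) ?_
      exact right_mem_BD k _ _ (left_mem_BD k _ _ hx)
    | zero => simp
    | add a b _ _ iha ihb => rw [map_add]; exact add_mem iha ihb
    | smul c b _ ih => rw [map_smul]; exact Submodule.smul_mem _ _ ih
  left_mem a _ b hb := left_mem_BD k a b hb
  right_mem a _ b hb := right_mem_BD k a b hb

theorem counit_of_mem_BD {b : B k X} (hb : b ∈ BD k X) : counit k b = 0 := by
  induction hb using Submodule.span_induction with
  | mem b h =>
    obtain ⟨p, q, x, rfl⟩ := h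
    simp [counit]
  | zero => simp
  | add a b _ _ iha ihb => rw [map_add, iha, ihb, add_zero]
  | smul c b _ ih => rw [map_smul, ih, smul_zero]

end Projection

/-! ### Images of `P ⊗ Q` in a tensor product. -/

section Tens

variable {k : Type*} [CommRing k] {M N M' N' : Type*} [AddCommGroup M] [AddCommGroup N]
  [Module k M] [Module k N] [AddCommGroup M'] [AddCommGroup N'] [Module k M'] [Module k N']

theorem tmul_mem_tens {P : Submodule k M} {Q : Submodule k N} {m : M} {n : N} (hm : m ∈ P)
    (hn : n ∈ Q) : m ⊗ₜ[k] n ∈ tens P Q :=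
  ⟨(⟨m, hm⟩ : P) ⊗ₜ (⟨n, hn⟩ : Q), rfl⟩

theorem tens_le {P : Submodule k M} {Q : Submodule k N} {S : Submodule k (M ⊗[k] N)}
    (h : ∀ m ∈ P, ∀ n ∈ Q, m ⊗ₜ[k] n ∈ S) : tens P Q ≤ S := by
  rintro _ ⟨t, rfl⟩
  induction t using TensorProduct.induction_on with
  | zero => simp
  | tmul m n => exact h m m.2 n n.2
  | add s t hs ht => rw [map_add]; exact add_mem hs ht

theorem map_tens_le {P : Submodule k M} {Q : Submodule k N} {P' : Submodule k M'}
    {Q' : Submodule k N'} {φ : M →ₗ[k] M'} {ψ : N →ₗ[k] N'} (hφ : ∀ m ∈ P, φ m ∈ P')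
    (hψ : ∀ n ∈ Q, ψ n ∈ Q') : tens P Q ≤ (tens P' Q').comap (TensorProduct.map φ ψ) :=
  tens_le fun m hm n hn => tmul_mem_tens (hφ m hm) (hψ n hn)

theorem map_tens_sup_le {P : Submodule k M} {Q : Submodule k N} {P' : Submodule k M'}
    {Q' : Submodule k N'} {φ : M →ₗ[k] M'} {ψ : N →ₗ[k] N'} (hφ : ∀ m ∈ P, φ m ∈ P')
    (hψ : ∀ n ∈ Q, ψ n ∈ Q') :
    tens P ⊤ ⊔ tens ⊤ Q ≤ (tens P' ⊤ ⊔ tens ⊤ Q').comap (TensorProduct.map φ ψ) :=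
  sup_le ((map_tens_le hφ fun _ _ => Submodule.mem_top).trans (Submodule.comap_mono le_sup_left))
    ((map_tens_le (fun _ _ => Submodule.mem_top) hψ).trans (Submodule.comap_mono le_sup_right))

end Tens

/-! ### Multiplication in `B ⊗ B` and the coproducts of the two summands. -/

section Coproduct

variable (k : Type v) [CommRing k] {X : Type u} [Shelf X]

/-- Right multiplication by `b` on `B`. -/
abbrev mulR (b : B k X) : B k X →ₗ[k] B k X := LinearMap.mulRight k b

/-- Left multiplication by `b` on `B`. -/
abbrev mulL (b : B k X) : B k X →ₗ[k] B k X := LinearMap.mulLeft k b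

theorem toTensor_tmul (b c : B k X) : toTensor k (b ᵍ⊗ₜ[k] c : BB k X) = b ⊗ₜ[k] c := rfl

/-- The Koszul sign in the product of `B ⊗ B`, for a right factor of degree one. -/
theorem tmul_mul_of_deg_one {b₁ c₁ b₂ c₂ : B k X} (hb : b₂ ∈ deg k X 1) :
    (b₁ ᵍ⊗ₜ[k] c₁ * b₂ ᵍ⊗ₜ[k] c₂ : BB k X) = (b₁ * b₂) ᵍ⊗ₜ[k] (sgn k c₁ * c₂) := by
  induction c₁ using DirectSum.Decomposition.inductionOn (deg k X) with
  | zero => simp [GradedTensorProduct.tmul]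
  | @homogeneous n c =>
    have h := GradedTensorProduct.tmul_coe_mul_coe_tmul (R := k) (deg k X) (deg k X) b₁ c ⟨b₂, hb⟩ c₂
    refine h.trans ?_
    rw [sgn_of_mem_deg k c.2, mul_one, smul_mul_assoc]
    rw [GradedTensorProduct.tmul, GradedTensorProduct.tmul, TensorProduct.tmul_smul]
    rcases Nat.even_or_odd n with hn | hn
    · simp [hn.neg_one_pow]
    · simp [hn.neg_one_pow]
  | add c c' h h' =>
    simp only [GradedTensorProduct.tmul, TensorProduct.tmul_add, map_add, add_mul] at h h' ⊢
    rw [h, h']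

/-- The Koszul sign in the product of `B ⊗ B`, for a left factor of degree one. -/
theorem tmul_mul_of_deg_one' {b₁ c₁ b₂ c₂ : B k X} (hc : c₁ ∈ deg k X 1) :
    (b₁ ᵍ⊗ₜ[k] c₁ * b₂ ᵍ⊗ₜ[k] c₂ : BB k X) = (b₁ * sgn k b₂) ᵍ⊗ₜ[k] (c₁ * c₂) := by
  induction b₂ using DirectSum.Decomposition.inductionOn (deg k X) with
  | zero => simp [GradedTensorProduct.tmul]
  | @homogeneous n b =>
    have h := GradedTensorProduct.tmul_coe_mul_coe_tmul (R := k) (deg k X) (deg k X) b₁ ⟨c₁, hc⟩ b c₂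
    refine h.trans ?_
    rw [sgn_of_mem_deg k b.2, one_mul, mul_smul_comm]
    rw [GradedTensorProduct.tmul, GradedTensorProduct.tmul, ← TensorProduct.smul_tmul']
    rcases Nat.even_or_odd n with hn | hn
    · simp [hn.neg_one_pow]
    · simp [hn.neg_one_pow]
  | add c c' h h' =>
    simp only [GradedTensorProduct.tmul, TensorProduct.add_tmul, map_add, mul_add] at h h' ⊢
    rw [h, h']

theorem tmul_zero_mul {b₁ c₁ b₂ c₂ : B k X} (hc : c₁ ∈ deg k X 0) :
    (b₁ ᵍ⊗ₜ[k] c₁ * b₂ ᵍ⊗ₜ[k] c₂ : BB k X) = (b₁ * b₂) ᵍ⊗ₜ[k] (c₁ * c₂) := by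
  induction b₂ using DirectSum.Decomposition.inductionOn (deg k X) with
  | zero => simp [GradedTensorProduct.tmul]
  | homogeneous b =>
    exact GradedTensorProduct.tmul_zero_coe_mul_coe_tmul (deg k X) (deg k X) b₁ ⟨c₁, hc⟩ b c₂
  | add c c' h h' =>
    simp only [GradedTensorProduct.tmul, TensorProduct.add_tmul, map_add, mul_add] at h h' ⊢
    rw [h, h']

theorem tmul_mul_zero {b₁ c₁ b₂ c₂ : B k X} (hb : b₂ ∈ deg k X 0) :
    (b₁ ᵍ⊗ₜ[k] c₁ * b₂ ᵍ⊗ₜ[k] c₂ : BB k X) = (b₁ * b₂) ᵍ⊗ₜ[k] (c₁ * c₂) := by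
  induction c₁ using DirectSum.Decomposition.inductionOn (deg k X) with
  | zero => simp [GradedTensorProduct.tmul]
  | homogeneous c =>
    exact GradedTensorProduct.tmul_coe_mul_zero_coe_tmul (deg k X) (deg k X) b₁ c ⟨b₂, hb⟩ c₂
  | add c c' h h' =>
    simp only [GradedTensorProduct.tmul, TensorProduct.tmul_add, map_add, add_mul] at h h' ⊢
    rw [h, h']

theorem one_mem_deg : (1 : B k X) ∈ deg k X 0 := SetLike.GradedOne.one_mem

-- Multiplication in the graded tensor product is translated into linear maps of the underlying
-- tensor product of modules, where `map_tens_le` applies. It suffices to know it on pure tensors.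
variable {k} in
theorem toTensor_mul_eq_left {s : BB k X} {ψ : B k X ⊗[k] B k X →ₗ[k] B k X ⊗[k] B k X}
    (h : ∀ b c : B k X, toTensor k (s * b ᵍ⊗ₜ[k] c) = ψ (b ⊗ₜ[k] c)) (t : BB k X) :
    toTensor k (s * t) = ψ (toTensor k t) := by
  obtain ⟨t, rfl⟩ := (GradedTensorProduct.of k (deg k X) (deg k X)).surjective t
  induction t using TensorProduct.induction_on with
  | zero => simp
  | tmul b c => exact h b c
  | add s t hs ht => rw [map_add, mul_add, map_add, map_add, map_add, hs, ht]

variable {k} in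
theorem toTensor_mul_eq_right {s : BB k X} {ψ : B k X ⊗[k] B k X →ₗ[k] B k X ⊗[k] B k X}
    (h : ∀ b c : B k X, toTensor k (b ᵍ⊗ₜ[k] c * s) = ψ (b ⊗ₜ[k] c)) (t : BB k X) :
    toTensor k (t * s) = ψ (toTensor k t) := by
  obtain ⟨t, rfl⟩ := (GradedTensorProduct.of k (deg k X) (deg k X)).surjective t
  induction t using TensorProduct.induction_on with
  | zero => simp
  | tmul b c => exact h b c
  | add s t hs ht => rw [map_add, add_mul, map_add, map_add, map_add, hs, ht]

theorem toTensor_eg_mul (x : X) (t : BB k X) :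
    toTensor k ((e k x) ᵍ⊗ₜ[k] (g k x) * t) =
      TensorProduct.map (mulL k (e k x)) (mulL k (g k x)) (toTensor k t) :=
  toTensor_mul_eq_left (fun b c => by
    rw [tmul_zero_mul k (g_mem_deg k x), toTensor_tmul, TensorProduct.map_tmul]
    rfl) t

theorem toTensor_one_e_mul (x : X) (t : BB k X) :
    toTensor k (1 ᵍ⊗ₜ[k] (e k x) * t) =
      TensorProduct.map (sgn k).toLinearMap (mulL k (e k x)) (toTensor k t) :=
  toTensor_mul_eq_left (fun b c => by
    rw [tmul_mul_of_deg_one' k (e_mem_deg k x), toTensor_tmul, TensorProduct.map_tmul, one_mul]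
    rfl) t

theorem toTensor_mul_eg (x : X) (t : BB k X) :
    toTensor k (t * (e k x) ᵍ⊗ₜ[k] (g k x)) =
      TensorProduct.map (mulR k (e k x)) (mulR k (g k x) ∘ₗ (sgn k).toLinearMap) (toTensor k t) :=
  toTensor_mul_eq_right (fun b c => by
    rw [tmul_mul_of_deg_one k (e_mem_deg k x), toTensor_tmul, TensorProduct.map_tmul]
    rfl) t

theorem toTensor_mul_one_e (x : X) (t : BB k X) :
    toTensor k (t * 1 ᵍ⊗ₜ[k] (e k x)) =
      TensorProduct.map LinearMap.id (mulR k (e k x)) (toTensor k t) :=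
  toTensor_mul_eq_right (fun b c => by
    rw [tmul_mul_zero k (one_mem_deg k), toTensor_tmul, TensorProduct.map_tmul, mul_one]
    rfl) t

theorem toTensor_gg_mul (x : X) (t : BB k X) :
    toTensor k ((g k x) ᵍ⊗ₜ[k] (g k x) * t) =
      TensorProduct.map (mulL k (g k x)) (mulL k (g k x)) (toTensor k t) :=
  toTensor_mul_eq_left (fun b c => by
    rw [gg_mul, toTensor_tmul, TensorProduct.map_tmul]
    rfl) t

theorem toTensor_mul_gg (x : X) (t : BB k X) :
    toTensor k (t * (g k x) ᵍ⊗ₜ[k] (g k x)) =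
      TensorProduct.map (mulR k (g k x)) (mulR k (g k x)) (toTensor k t) :=
  toTensor_mul_eq_right (fun b c => by
    rw [mul_gg, toTensor_tmul, TensorProduct.map_tmul]
    rfl) t

theorem comulAlg_e (x : X) :
    comulAlg k (e k x) = (e k x) ᵍ⊗ₜ[k] (g k x) + 1 ᵍ⊗ₜ[k] (e k x) := by simp [comulAlg]

/-! ### `B^D` is a coideal -/

variable (X) in
/-- The submodule `B^D ⊗ B + B ⊗ B^D`, as a submodule of the algebra `B ⊗ B`. -/
def coidealBD : Submodule k (BB k X) :=
  (tens (BD k X) ⊤ ⊔ tens ⊤ (BD k X)).comap (toTensor k).toLinearMap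

theorem mem_coidealBD {t : BB k X} :
    t ∈ coidealBD k X ↔ toTensor k t ∈ tens (BD k X) ⊤ ⊔ tens ⊤ (BD k X) := Iff.rfl

/-- The elements `b` with this two-sided stability form a subalgebra, so the generators suffice. The
coideal property of `B^D` is thereby reduced to the elements `e_x²`. -/
theorem comulAlg_mul_mem_coidealBD (b : B k X) :
    ∀ t ∈ coidealBD k X, comulAlg k b * t ∈ coidealBD k X ∧ t * comulAlg k b ∈ coidealBD k X := by
  have hL : ∀ c : B k X, ∀ m ∈ BD k X, mulL k c m ∈ BD k X := fun c m hm => left_mem_BD k c m hm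
  have hR : ∀ c : B k X, ∀ m ∈ BD k X, mulR k c m ∈ BD k X := fun c m hm => right_mem_BD k c m hm
  have hs : ∀ m ∈ BD k X, (sgn k).toLinearMap m ∈ BD k X := fun m hm => sgn_mem_BD k hm
  have hRs : ∀ c : B k X, ∀ m ∈ BD k X, (mulR k c ∘ₗ (sgn k).toLinearMap) m ∈ BD k X :=
    fun c m hm => hR c _ (hs m hm)
  have hid : ∀ m ∈ BD k X, (LinearMap.id : B k X →ₗ[k] B k X) m ∈ BD k X := fun m hm => hm
  induction b using induction with
  | hr r =>
    intro t ht
    rw [AlgHom.commutes, Algebra.algebraMap_eq_smul_one, smul_mul_assoc, one_mul, mul_smul_comm,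
      mul_one]
    exact ⟨Submodule.smul_mem _ _ ht, Submodule.smul_mem _ _ ht⟩
  | hg x =>
    intro t ht
    rw [comulAlg_g, mem_coidealBD, mem_coidealBD, toTensor_gg_mul, toTensor_mul_gg]
    exact ⟨map_tens_sup_le (hL _) (hL _) ht, map_tens_sup_le (hR _) (hR _) ht⟩
  | he x =>
    intro t ht
    rw [comulAlg_e, add_mul, mul_add, mem_coidealBD, mem_coidealBD, map_add, map_add,
      toTensor_eg_mul, toTensor_mul_eg, toTensor_one_e_mul, toTensor_mul_one_e]
    exact ⟨add_mem (map_tens_sup_le (hL _) (hL _) ht) (map_tens_sup_le hs (hL _) ht),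
      add_mem (map_tens_sup_le (hR _) (hRs _) ht)
        (map_tens_sup_le hid (hR _) ht)⟩
  | hadd a b ha hb =>
    intro t ht
    rw [map_add, add_mul, mul_add]
    exact ⟨add_mem (ha t ht).1 (hb t ht).1, add_mem (ha t ht).2 (hb t ht).2⟩
  | hmul a b ha hb =>
    intro t ht
    rw [map_mul, mul_assoc, ← mul_assoc t]
    exact ⟨(ha _ (hb t ht).1).1, (hb _ (ha t ht).2).2⟩

/-- The cross terms are `e_x ⊗ x e_x` and, with the Koszul sign, `-e_x ⊗ e_x x`. They cancel because
`x^x = x`. -/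
theorem comulAlg_e_sq (hX : ∀ x : X, Shelf.act x x = x) (x : X) :
    comulAlg k (e k x * e k x) =
      (e k x * e k x) ᵍ⊗ₜ[k] (g k x * g k x) + 1 ᵍ⊗ₜ[k] (e k x * e k x) := by
  rw [map_mul, comulAlg_e, add_mul, mul_add, mul_add, tmul_mul_of_deg_one k (e_mem_deg k x),
    tmul_mul_zero k (one_mem_deg k), tmul_mul_of_deg_one k (e_mem_deg k x),
    tmul_mul_zero k (one_mem_deg k), sgn_g, sgn_e, g_mul_e_self k hX]
  simp only [one_mul, mul_one, neg_mul, GradedTensorProduct.tmul, TensorProduct.tmul_neg, map_neg]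
  abel

theorem comul_of_mem_BD (hX : ∀ x : X, Shelf.act x x = x) {b : B k X} (hb : b ∈ BD k X) :
    comul k b ∈ tens (BD k X) ⊤ ⊔ tens ⊤ (BD k X) := by
  change comulAlg k b ∈ coidealBD k X
  induction hb using Submodule.span_induction with
  | mem b h =>
    obtain ⟨p, q, x, rfl⟩ := h
    have hx : e k x * e k x ∈ BD k X := Submodule.subset_span ⟨1, 1, x, by simp⟩
    rw [map_mul, map_mul]
    refine (comulAlg_mul_mem_coidealBD k q _ (comulAlg_mul_mem_coidealBD k p _ ?_).1).2
    rw [comulAlg_e_sq k hX, mem_coidealBD, map_add, toTensor_tmul, toTensor_tmul]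
    exact add_mem (Submodule.mem_sup_left (tmul_mem_tens hx trivial))
      (Submodule.mem_sup_right (tmul_mem_tens trivial hx))
  | zero => simp
  | add a b _ _ iha ihb => rw [map_add]; exact add_mem iha ihb
  | smul c b _ ih => rw [map_smul]; exact Submodule.smul_mem _ _ ih

/-! ### The coproducts of `B^N` -/

theorem toTensor_comulAlg_gWord_mul_mem (a : List X) {t : BB k X}
    (ht : toTensor k t ∈ tens (⊤ : Submodule k (B k X)) (BN k X)) :
    toTensor k (comulAlg k (gWord k a) * t) ∈ tens (⊤ : Submodule k (B k X)) (BN k X) := by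
  induction a with
  | nil => simpa using ht
  | cons x a ih =>
    rw [gWord_cons, map_mul (comulAlg k), mul_assoc, comulAlg_g, toTensor_gg_mul]
    exact map_tens_le (fun _ _ => Submodule.mem_top) (fun b hb => left_mem_BN k (g_mem_A k X x) b hb) ih

theorem toTensor_eg_mul_mem (x : X) {t : BB k X}
    (ht : toTensor k t ∈ tens (⊤ : Submodule k (B k X)) (BN k X)) :
    toTensor k ((e k x) ᵍ⊗ₜ[k] (g k x) * t) ∈ tens (⊤ : Submodule k (B k X)) (BN k X) := by
  rw [toTensor_eg_mul]
  exact map_tens_le (fun _ _ => Submodule.mem_top) (fun b hb => left_mem_BN k (g_mem_A k X x) b hb) ht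

theorem toTensor_one_e_sub_mul_mem (x y : X) {t : BB k X}
    (ht : toTensor k t ∈ tens (⊤ : Submodule k (B k X)) (BN k X)) :
    toTensor k ((1 ᵍ⊗ₜ[k] (e k x) - 1 ᵍ⊗ₜ[k] (e k y)) * t) ∈
      tens (⊤ : Submodule k (B k X)) (BN k X) := by
  have h : toTensor k ((1 ᵍ⊗ₜ[k] (e k x) - 1 ᵍ⊗ₜ[k] (e k y)) * t) =
      TensorProduct.map (sgn k).toLinearMap (mulL k (e k x - e k y)) (toTensor k t) := by
    have h' : mulL k (e k x) = mulL k (e k x - e k y) + mulL k (e k y) := by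
      ext b; simp [sub_mul]
    rw [sub_mul, map_sub, toTensor_one_e_mul, toTensor_one_e_mul, h', TensorProduct.map_add_right,
      LinearMap.add_apply, add_sub_cancel_right]
  rw [h]
  exact map_tens_le (fun _ _ => Submodule.mem_top) (fun b hb => e_sub_e_mul_mem_BN k x y hb) ht

/-- Since `Δ (e_x - e_y) = e_x ⊗ x - e_y ⊗ y + 1 ⊗ (e_x - e_y)`, the right tensor factor is
multiplied only by elements of `A` and by differences. The left factor receives single letters
`e_x`, so the argument says nothing about it. -/
theorem comulAlg_nWord_mem (l : List X) :
    toTensor k (comulAlg k (nWord k l)) ∈ tens (⊤ : Submodule k (B k X)) (BN k X) := by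
  induction l with
  | nil =>
    rw [nWord, map_one]
    exact tmul_mem_tens (m := (1 : B k X)) trivial (nWord_mem_BN k [])
  | cons x l ih =>
    cases l with
    | nil =>
      rw [nWord, comulAlg_e, map_add, toTensor_tmul, toTensor_tmul]
      refine add_mem (tmul_mem_tens trivial ?_) (tmul_mem_tens trivial (nWord_mem_BN k [x]))
      simpa [nWord] using left_mem_BN k (g_mem_A k X x) _ (nWord_mem_BN k [])
    | cons y l =>
      rw [nWord, map_mul, map_sub, comulAlg_e, comulAlg_e, add_sub_add_comm, add_mul, map_add,
        sub_mul, map_sub]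
      exact add_mem (sub_mem (toTensor_eg_mul_mem k x ih) (toTensor_eg_mul_mem k y ih))
        (toTensor_one_e_sub_mul_mem k x y ih)

@[simp] theorem proj₀_e (x : X) : proj₀ k (e k x) = 0 := by simp [proj₀]

theorem comulLeftAlg_e_mul (x : X) (b : B k X) :
    comulLeftAlg k (e k x * b) = (e k x) ᵍ⊗ₜ[k] (g k x) * comulAlg k b := by
  rw [comulLeftAlg, twisted_mul, twisted_e, AlgHom.comp_apply, proj₀_e, map_zero, zero_mul, zero_add]

theorem comulRightAlg_e_mul (x : X) (b : B k X) :
    comulRightAlg k (e k x * b) = 1 ᵍ⊗ₜ[k] (e k x) * comulAlg k b := by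
  rw [comulRightAlg, twisted_mul, twisted_e, AlgHom.comp_apply, proj₀_e, map_zero, zero_mul, zero_add]

theorem comulLeftAlg_one : comulLeftAlg k (1 : B k X) = 0 := by
  have h := twisted_mul ((comulAlg k).comp (proj₀ k)) (comulAlg k)
    (fun x => (e k x) ᵍ⊗ₜ[k] (g k x)) (fun x y => by
      rw [AlgHom.comp_apply, proj₀_g, comulAlg_g, gg_mul, mul_gg, g_mul_g, g_mul_e]) (1 : B k X) 1
  rw [mul_one, map_one (comulAlg k), map_one ((comulAlg k).comp (proj₀ k)), one_mul, mul_one] at h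
  exact left_eq_add.1 h

theorem comulRightAlg_one : comulRightAlg k (1 : B k X) = 0 := by
  have h := twisted_mul ((comulAlg k).comp (proj₀ k)) (comulAlg k)
    (fun x => 1 ᵍ⊗ₜ[k] (e k x)) (fun x y => by
      rw [AlgHom.comp_apply, proj₀_g, comulAlg_g, gg_mul, mul_gg, g_mul_e, mul_one, one_mul])
    (1 : B k X) 1
  rw [mul_one, map_one (comulAlg k), map_one ((comulAlg k).comp (proj₀ k)), one_mul, mul_one] at h
  exact left_eq_add.1 h

/-- No induction is needed: after the first letter is split off, the remaining normalized word
enters through the full coproduct. -/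
theorem comulLeftAlg_nWord_mem (l : List X) :
    toTensor k (comulLeftAlg k (nWord k l)) ∈ tens (⊤ : Submodule k (B k X)) (BN k X) := by
  cases l with
  | nil => rw [nWord, comulLeftAlg_one, map_zero]; exact zero_mem _
  | cons x l =>
    cases l with
    | nil =>
      rw [nWord, ← mul_one (e k x), comulLeftAlg_e_mul, map_one]
      exact toTensor_eg_mul_mem k x (tmul_mem_tens (m := (1 : B k X)) trivial (nWord_mem_BN k []))
    | cons y l =>
      rw [nWord, sub_mul, map_sub, comulLeftAlg_e_mul, comulLeftAlg_e_mul, map_sub]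
      exact sub_mem (toTensor_eg_mul_mem k x (comulAlg_nWord_mem k _))
        (toTensor_eg_mul_mem k y (comulAlg_nWord_mem k _))

theorem comulRightAlg_nWord_mem (l : List X) :
    toTensor k (comulRightAlg k (nWord k l)) ∈ tens (⊤ : Submodule k (B k X)) (BN k X) := by
  cases l with
  | nil => rw [nWord, comulRightAlg_one, map_zero]; exact zero_mem _
  | cons x l =>
    cases l with
    | nil =>
      rw [nWord, ← mul_one (e k x), comulRightAlg_e_mul, map_one, mul_one]
      exact tmul_mem_tens (m := (1 : B k X)) trivial (nWord_mem_BN k [x])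
    | cons y l =>
      rw [nWord, sub_mul, map_sub, comulRightAlg_e_mul, comulRightAlg_e_mul, ← sub_mul]
      exact toTensor_one_e_sub_mul_mem k x y (comulAlg_nWord_mem k _)

theorem mem_tens_of_mem_BN {φ : B k X →ₗ[k] BB k X}
    (hφ : ∀ a b, φ (gWord k a * b) = comulAlg k (gWord k a) * φ b)
    (h : ∀ l, toTensor k (φ (nWord k l)) ∈ tens (⊤ : Submodule k (B k X)) (BN k X)) {b : B k X}
    (hb : b ∈ BN k X) : toTensor k (φ b) ∈ tens (⊤ : Submodule k (B k X)) (BN k X) := by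
  rw [BN_eq_span] at hb
  induction hb using Submodule.span_induction with
  | mem b hb =>
    obtain ⟨a, l, rfl⟩ := hb
    rw [hφ]
    exact toTensor_comulAlg_gWord_mul_mem k a (h l)
  | zero => simp
  | add a b _ _ iha ihb => rw [map_add, map_add]; exact add_mem iha ihb
  | smul c b _ ih => rw [map_smul, map_smul]; exact Submodule.smul_mem _ _ ih

theorem comul_of_mem_BN {b : B k X} (hb : b ∈ BN k X) : comul k b ∈ tens ⊤ (BN k X) :=
  mem_tens_of_mem_BN k (φ := (comulAlg k).toLinearMap) (fun _ _ => map_mul (comulAlg k) _ _)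
    (comulAlg_nWord_mem k) hb

theorem comulLeft_of_mem_BN {b : B k X} (hb : b ∈ BN k X) : comulLeft k b ∈ tens ⊤ (BN k X) :=
  mem_tens_of_mem_BN k (comulLeftAlg_gWord_mul k) (comulLeftAlg_nWord_mem k) hb

theorem comulRight_of_mem_BN {b : B k X} (hb : b ∈ BN k X) : comulRight k b ∈ tens ⊤ (BN k X) :=
  mem_tens_of_mem_BN k (comulRightAlg_gWord_mul k) (comulRightAlg_nWord_mem k) hb

end Coproduct

/-! ### The complex `B̄` has the words in the `e_x` as a basis -/

section Bar

variable (k : Type v) [CommRing k] {X : Type u} [Shelf X]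

theorem toBar_surjective : Function.Surjective (toBar k X) := Submodule.mkQ_surjective _

theorem toBar_gWord_mul (a : List X) (b : B k X) : toBar k X (gWord k a * b) = toBar k X b := by
  induction a with
  | nil => simp
  | cons x a ih => rw [gWord_cons, mul_assoc, toBar_g_mul, ih]

/-- The class of `e_{x₁} ⋯ e_{xₙ}` in `B̄`. -/
def wBar (l : List X) : Bbar k X := toBar k X (eWord k l)

theorem toWords_gWord_mul (a : List X) (b : B k X) : toWords k (gWord k a * b) = toWords k b := by
  induction a with
  | nil => simp
  | cons x a ih => rw [gWord_cons, mul_assoc, toWords_g_mul, ih]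

variable (X) in
/-- The map `B̄ → k⟨X⟩` induced by `toWords`. -/
def wordsBar : Bbar k X →ₗ[k] (List X →₀ k) :=
  (relBar k X).liftQ (toWords k) (Submodule.span_le.2 (by
    rintro _ ⟨x, b, rfl⟩
    simp [toWords_g_mul]))

theorem wordsBar_toBar (b : B k X) : wordsBar k X (toBar k X b) = toWords k b := rfl

variable (X) in
/-- The basis of `B̄` that consists of the words in the `e_x`. -/
def barBasis : Module.Basis (List X) k (Bbar k X) :=
  -- Independence of the words comes from the right action of `B` on `k⟨X⟩`, which sends the class
  -- of a word to that word. Spanning comes from the normal forms, whose `A`-part dies in `B̄`.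
  Module.Basis.ofRepr <| LinearEquiv.ofLinearMap (wordsBar k X) (Finsupp.linearCombination k (wBar k))
    (by
      ext l : 2
      simp [wBar, wordsBar_toBar, toWords_eWord])
    (by
      refine LinearMap.ext fun u => ?_
      obtain ⟨b, rfl⟩ := toBar_surjective k u
      change (Finsupp.linearCombination k (wBar k) ∘ₗ toWords k) b = toBar k X b
      congr 1
      refine linearMap_ext_monomial fun a l => ?_
      rw [LinearMap.comp_apply, toWords_gWord_mul, toWords_eWord, toBar_gWord_mul]
      simp [wBar])

@[simp] theorem barBasis_apply (l : List X) : barBasis k X l = wBar k l := by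
  simp [barBasis]

variable {k} in
/-- A map of `B` that commutes with the left action of the `x` induces a map of `B̄`. -/
def barMap (φ : B k X →ₗ[k] B k X) (h : ∀ x b, φ (g k x * b) = g k x * φ b) :
    Bbar k X →ₗ[k] Bbar k X :=
  (relBar k X).liftQ (toBar k X ∘ₗ φ) (Submodule.span_le.2 (by
    rintro _ ⟨x, b, rfl⟩
    simp [h, toBar_g_mul]))

/-- Right multiplication by `e_x` on `B̄`. -/
def rE (x : X) : Bbar k X →ₗ[k] Bbar k X := barMap (mulR k (e k x)) fun _ _ => mul_assoc _ _ _

/-- Right multiplication by `x` on `B̄`. -/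
def rG (x : X) : Bbar k X →ₗ[k] Bbar k X := barMap (mulR k (g k x)) fun _ _ => mul_assoc _ _ _

variable (X) in
/-- The sign automorphism of `B̄`. -/
def sBar : Bbar k X →ₗ[k] Bbar k X :=
  barMap (sgn k).toLinearMap fun x b => by simp

variable (X) in
/-- The projection of `B̄` to `B̄^N` along `B̄^D`. -/
def normBar : Bbar k X →ₗ[k] Bbar k X := barMap (norm k) (norm_g_mul k)

variable (X) in
/-- The class of `1` in `B̄`. -/
def oneBar : Bbar k X := toBar k X 1

theorem rE_toBar (x : X) (b : B k X) : rE k x (toBar k X b) = toBar k X (b * e k x) := rfl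

theorem rG_toBar (x : X) (b : B k X) : rG k x (toBar k X b) = toBar k X (b * g k x) := rfl

theorem sBar_toBar (b : B k X) : sBar k X (toBar k X b) = toBar k X (sgn k b) := rfl

theorem normBar_toBar (b : B k X) : normBar k X (toBar k X b) = toBar k X (norm k b) := rfl

theorem dBar_toBar (b : B k X) : dBar k X (toBar k X b) = toBar k X (d k b) := rfl

theorem counitBar_toBar (b : B k X) : counitBar k X (toBar k X b) = counit k b := rfl

theorem comulBar_toBar (b : B k X) : comulBar k X (toBar k X b) =
    TensorProduct.map (toBar k X) (toBar k X) (comul k b) := rfl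

theorem comulLeftBar_toBar (b : B k X) : comulLeftBar k X (toBar k X b) =
    TensorProduct.map (toBar k X) (toBar k X) (comulLeft k b) := rfl

theorem comulRightBar_toBar (b : B k X) : comulRightBar k X (toBar k X b) =
    TensorProduct.map (toBar k X) (toBar k X) (comulRight k b) := rfl

theorem wBar_nil : wBar k ([] : List X) = oneBar k X := rfl

theorem wBar_concat (l : List X) (x : X) : wBar k (l ++ [x]) = rE k x (wBar k l) := by
  rw [wBar, wBar, rE_toBar, eWord_append, eWord_singleton]

theorem wBar_singleton (x : X) : wBar k [x] = rE k x (oneBar k X) := wBar_concat k [] x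

variable {k} in
/-- Linear maps out of `B̄` may be compared by induction on the length of words. -/
theorem bar_ext {M : Type*} [AddCommGroup M] [Module k M] {φ ψ : Bbar k X →ₗ[k] M}
    (h₁ : φ (oneBar k X) = ψ (oneBar k X))
    (hE : ∀ x u, φ u = ψ u → φ (rE k x u) = ψ (rE k x u)) : φ = ψ := by
  refine (barBasis k X).ext fun l => ?_
  rw [barBasis_apply]
  induction l using List.reverseRecOn with
  | nil => exact h₁
  | append_singleton l x ih => rw [wBar_concat]; exact hE x _ ih

theorem rG_rE (x y : X) (u : Bbar k X) : rG k y (rE k x u) = rE k (up x y) (rG k y u) := by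
  obtain ⟨b, rfl⟩ := toBar_surjective k u
  rw [rE_toBar, rG_toBar, rG_toBar, rE_toBar, mul_assoc, mul_assoc, g_mul_e]

@[simp] theorem sBar_rE (x : X) (u : Bbar k X) : sBar k X (rE k x u) = - rE k x (sBar k X u) := by
  obtain ⟨b, rfl⟩ := toBar_surjective k u
  rw [rE_toBar, sBar_toBar, sBar_toBar, rE_toBar, map_mul, sgn_e, mul_neg, map_neg]

theorem sBar_rG (x : X) (u : Bbar k X) : sBar k X (rG k x u) = rG k x (sBar k X u) := by
  obtain ⟨b, rfl⟩ := toBar_surjective k u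
  rw [rG_toBar, sBar_toBar, sBar_toBar, rG_toBar, map_mul, sgn_g]

@[simp] theorem sBar_one : sBar k X (oneBar k X) = oneBar k X := by
  rw [oneBar, sBar_toBar, map_one]

@[simp] theorem rG_one (x : X) : rG k x (oneBar k X) = oneBar k X := by
  rw [oneBar, rG_toBar, one_mul, ← mul_one (g k x), toBar_g_mul]

@[simp] theorem dBar_one : dBar k X (oneBar k X) = 0 := by
  rw [oneBar, dBar_toBar, d_one, map_zero]

@[simp] theorem counitBar_one : counitBar k X (oneBar k X) = 1 := by
  rw [oneBar, counitBar_toBar, map_one]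

@[simp] theorem sBar_sBar (u : Bbar k X) : sBar k X (sBar k X u) = u := by
  have h : sBar k X ∘ₗ sBar k X = LinearMap.id := bar_ext (by simp) fun x u h => by
    simp only [LinearMap.comp_apply, LinearMap.id_apply] at h
    simp [h]
  exact LinearMap.congr_fun h u

theorem dBar_rE (x : X) (u : Bbar k X) : dBar k X (rE k x u) =
    rE k x (dBar k X u) + sBar k X u - rG k x (sBar k X u) := by
  obtain ⟨b, rfl⟩ := toBar_surjective k u
  rw [rE_toBar, dBar_toBar, dBar_toBar, sBar_toBar, rE_toBar, rG_toBar, d_mul, d_e, mul_sub,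
    mul_one, map_add, map_sub]
  abel

theorem dBar_rG (x : X) (u : Bbar k X) : dBar k X (rG k x u) = rG k x (dBar k X u) := by
  obtain ⟨b, rfl⟩ := toBar_surjective k u
  rw [rG_toBar, dBar_toBar, dBar_toBar, rG_toBar, d_mul, d_g, mul_zero, zero_add]

@[simp] theorem counitBar_rE (x : X) (u : Bbar k X) : counitBar k X (rE k x u) = 0 := by
  obtain ⟨b, rfl⟩ := toBar_surjective k u
  rw [rE_toBar, counitBar_toBar, map_mul]
  simp [counit]

@[simp] theorem counitBar_rG (x : X) (u : Bbar k X) :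
    counitBar k X (rG k x u) = counitBar k X u := by
  obtain ⟨b, rfl⟩ := toBar_surjective k u
  rw [rG_toBar, counitBar_toBar, counitBar_toBar, map_mul]
  simp [counit]

@[simp] theorem counitBar_sBar (u : Bbar k X) : counitBar k X (sBar k X u) = counitBar k X u := by
  have h : counitBar k X ∘ₗ sBar k X = counitBar k X := bar_ext (by simp) fun x u h => by simp
  exact LinearMap.congr_fun h u

@[simp] theorem counitBar_dBar (u : Bbar k X) : counitBar k X (dBar k X u) = 0 := by
  have h : counitBar k X ∘ₗ dBar k X = 0 := bar_ext (by simp) fun x u h => by simp [dBar_rE]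
  exact LinearMap.congr_fun h u

theorem sBar_dBar (u : Bbar k X) : sBar k X (dBar k X u) = - dBar k X (sBar k X u) := by
  have h : sBar k X ∘ₗ dBar k X = - (dBar k X ∘ₗ sBar k X) := bar_ext (by simp) fun x u h => by
    simp only [LinearMap.comp_apply, LinearMap.neg_apply] at h
    simp [dBar_rE, h, sBar_rG]
  exact LinearMap.congr_fun h u

-- When `e_x` is appended, the two contributions of `d e_x = 1 - x` to `d²` cancel, because the sign
-- automorphism anticommutes with `d`.
@[simp] theorem dBar_dBar (u : Bbar k X) : dBar k X (dBar k X u) = 0 := by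
  have h : dBar k X ∘ₗ dBar k X = 0 := bar_ext (by simp) fun x u h => by
    simp only [LinearMap.comp_apply, LinearMap.zero_apply] at h
    simp [dBar_rE, h, sBar_dBar, dBar_rG]
  exact LinearMap.congr_fun h u

theorem sBar_wBar (l : List X) : sBar k X (wBar k l) = (-1 : k) ^ l.length • wBar k l := by
  rw [wBar, sBar_toBar, sgn_eWord, map_smul]

/-! ### The coproducts of `B̄` -/

/-- The right action of `Δ e_x = e_x ⊗ x + 1 ⊗ e_x` on `B̄ ⊗ B̄`. -/
def rEE (x : X) : Bbar k X ⊗[k] Bbar k X →ₗ[k] Bbar k X ⊗[k] Bbar k X :=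
  TensorProduct.map (rE k x) (rG k x ∘ₗ sBar k X) + TensorProduct.map LinearMap.id (rE k x)

/-- The right action of `Δ x = x ⊗ x` on `B̄ ⊗ B̄`. -/
def rGG (x : X) : Bbar k X ⊗[k] Bbar k X →ₗ[k] Bbar k X ⊗[k] Bbar k X :=
  TensorProduct.map (rG k x) (rG k x)

theorem rEE_tmul (x : X) (u v : Bbar k X) : rEE k x (u ⊗ₜ v) =
    rE k x u ⊗ₜ rG k x (sBar k X v) + u ⊗ₜ rE k x v := rfl

theorem rGG_tmul (x : X) (u v : Bbar k X) : rGG k x (u ⊗ₜ v) = rG k x u ⊗ₜ rG k x v := rfl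

variable (X) in
/-- The sign automorphism of `B̄ ⊗ B̄`. -/
def sSq : Bbar k X ⊗[k] Bbar k X →ₗ[k] Bbar k X ⊗[k] Bbar k X :=
  TensorProduct.map (sBar k X) (sBar k X)

variable (X) in
/-- The differential of `B̄ ⊗ B̄`. -/
def dSq : Bbar k X ⊗[k] Bbar k X →ₗ[k] Bbar k X ⊗[k] Bbar k X :=
  TensorProduct.map (dBar k X) LinearMap.id + TensorProduct.map (sBar k X) (dBar k X)

theorem sSq_tmul (u v : Bbar k X) : sSq k X (u ⊗ₜ v) = sBar k X u ⊗ₜ sBar k X v := rfl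

theorem dSq_tmul (u v : Bbar k X) : dSq k X (u ⊗ₜ v) =
    dBar k X u ⊗ₜ v + sBar k X u ⊗ₜ dBar k X v := rfl

variable (X) in
/-- The maps `Δ`, `Δ⃖`, `Δ⃗` from `B̄` to `B̄ ⊗ B̄` are determined by their value at `1`, and by their
failure to commute with the action of `e_x`. -/
structure IsCoprod (Φ : Bbar k X →ₗ[k] Bbar k X ⊗[k] Bbar k X) (α β γ : k) : Prop where
  map_one : Φ (oneBar k X) = α • (oneBar k X ⊗ₜ oneBar k X)
  map_rE : ∀ x u, Φ (rE k x u) = rEE k x (Φ u) + counitBar k X u •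
    (β • (rE k x (oneBar k X) ⊗ₜ oneBar k X) + γ • (oneBar k X ⊗ₜ rE k x (oneBar k X)))
  map_rG : ∀ x u, Φ (rG k x u) = rGG k x (Φ u)

theorem map_toBar_mul_comulAlg_e (x : X) (t : BB k X) :
    TensorProduct.map (toBar k X) (toBar k X) (toTensor k (t * comulAlg k (e k x))) =
      rEE k x (TensorProduct.map (toBar k X) (toBar k X) (toTensor k t)) := by
  rw [comulAlg_e, mul_add, map_add, toTensor_mul_eg, toTensor_mul_one_e]
  induction toTensor k t using TensorProduct.induction_on with
  | zero => simp
  | tmul b c => rfl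
  | add s t hs ht =>
    simp only [map_add] at hs ht ⊢
    rw [← hs, ← ht]
    abel

theorem map_toBar_mul_comulAlg_g (x : X) (t : BB k X) :
    TensorProduct.map (toBar k X) (toBar k X) (toTensor k (t * comulAlg k (g k x))) =
      rGG k x (TensorProduct.map (toBar k X) (toBar k X) (toTensor k t)) := by
  rw [comulAlg_g, toTensor_mul_gg]
  induction toTensor k t using TensorProduct.induction_on with
  | zero => simp
  | tmul b c => rfl
  | add s t hs ht => simp only [map_add, hs, ht]

/-- After projection to `B̄ ⊗ B̄`, left multiplication by `x ⊗ x` is trivial, so the degree zero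
part of `b` acts through the counit. The term `Δ (proj₀ b) D (e_x)` of a twisted derivation thus
becomes the counit term in `IsCoprod`, which only matters when a letter is appended to a degree zero
element. -/
theorem map_toBar_comulAlg_proj₀_mul (b : B k X) : ∀ t : BB k X,
    TensorProduct.map (toBar k X) (toBar k X) (toTensor k (comulAlg k (proj₀ k b) * t)) =
      counit k b • TensorProduct.map (toBar k X) (toBar k X) (toTensor k t) := by
  induction b using induction with
  | hr r =>
    intro t
    rw [AlgHom.commutes, AlgHom.commutes, AlgHom.commutes, Algebra.algebraMap_eq_smul_one,
      smul_mul_assoc, one_mul, map_smul, map_smul]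
    rfl
  | hg x => intro t; rw [proj₀_g, comul_bar_aux]; simp [counit]
  | he x => intro t; simp [counit]
  | hadd a b ha hb => intro t; simp only [map_add, add_mul, add_smul, ha, hb]
  | hmul a b ha hb =>
    intro t
    rw [map_mul (proj₀ k), map_mul (comulAlg k), mul_assoc, ha, hb, map_mul, mul_smul]

variable (X) in
theorem isCoprod_comulBar : IsCoprod k X (comulBar k X) 1 0 0 where
  map_one := by
    rw [oneBar, comulBar_toBar, one_smul, comul, LinearMap.comp_apply, AlgHom.toLinearMap_apply,
      map_one]
    rfl
  map_rE x u := by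
    obtain ⟨b, rfl⟩ := toBar_surjective k u
    rw [rE_toBar, comulBar_toBar, comulBar_toBar, comul, LinearMap.comp_apply,
      LinearMap.comp_apply, AlgHom.toLinearMap_apply, AlgHom.toLinearMap_apply, map_mul]
    refine (map_toBar_mul_comulAlg_e k x _).trans ?_
    simp
  map_rG x u := by
    obtain ⟨b, rfl⟩ := toBar_surjective k u
    rw [rG_toBar, comulBar_toBar, comulBar_toBar, comul, LinearMap.comp_apply,
      LinearMap.comp_apply, AlgHom.toLinearMap_apply, AlgHom.toLinearMap_apply, map_mul]
    exact map_toBar_mul_comulAlg_g k x _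

theorem comulLeftAlg_mul (b c : B k X) : comulLeftAlg k (b * c) =
    comulAlg k (proj₀ k b) * comulLeftAlg k c + comulLeftAlg k b * comulAlg k c :=
  twisted_mul _ _ _ _ b c

theorem comulRightAlg_mul (b c : B k X) : comulRightAlg k (b * c) =
    comulAlg k (proj₀ k b) * comulRightAlg k c + comulRightAlg k b * comulAlg k c :=
  twisted_mul _ _ _ _ b c

theorem toBar_g (x : X) : toBar k X (g k x) = oneBar k X := by
  rw [← mul_one (g k x), toBar_g_mul, oneBar]

variable (X) in
theorem isCoprod_comulLeftBar : IsCoprod k X (comulLeftBar k X) 0 1 0 where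
  map_one := by
    rw [oneBar, comulLeftBar_toBar, zero_smul, comulLeft, LinearMap.comp_apply, comulLeftAlg_one,
      map_zero, map_zero]
  map_rE x u := by
    obtain ⟨b, rfl⟩ := toBar_surjective k u
    have h : comulLeftAlg k (e k x) = (e k x) ᵍ⊗ₜ[k] (g k x) := twisted_e _ _ _ _ x
    rw [rE_toBar, comulLeftBar_toBar, comulLeftBar_toBar, comulLeft, LinearMap.comp_apply,
      LinearMap.comp_apply, comulLeftAlg_mul, map_add, map_add, LinearEquiv.coe_coe,
      map_toBar_comulAlg_proj₀_mul, map_toBar_mul_comulAlg_e, h, toTensor_tmul,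
      TensorProduct.map_tmul, toBar_g, add_comm, counitBar_toBar, one_smul, zero_smul, add_zero]
    simp only [oneBar, rE_toBar, one_mul]
  map_rG x u := by
    obtain ⟨b, rfl⟩ := toBar_surjective k u
    have h : comulLeftAlg k (g k x) = 0 := twisted_g _ _ _ _ x
    rw [rG_toBar, comulLeftBar_toBar, comulLeftBar_toBar, comulLeft, LinearMap.comp_apply,
      LinearMap.comp_apply, comulLeftAlg_mul, h, mul_zero, zero_add, LinearEquiv.coe_coe,
      map_toBar_mul_comulAlg_g]

variable (X) in
theorem isCoprod_comulRightBar : IsCoprod k X (comulRightBar k X) 0 0 1 where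
  map_one := by
    rw [oneBar, comulRightBar_toBar, zero_smul, comulRight, LinearMap.comp_apply, comulRightAlg_one,
      map_zero, map_zero]
  map_rE x u := by
    obtain ⟨b, rfl⟩ := toBar_surjective k u
    have h : comulRightAlg k (e k x) = 1 ᵍ⊗ₜ[k] (e k x) := twisted_e _ _ _ _ x
    rw [rE_toBar, comulRightBar_toBar, comulRightBar_toBar, comulRight, LinearMap.comp_apply,
      LinearMap.comp_apply, comulRightAlg_mul, map_add, map_add, LinearEquiv.coe_coe,
      map_toBar_comulAlg_proj₀_mul, map_toBar_mul_comulAlg_e, h, toTensor_tmul,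
      TensorProduct.map_tmul, add_comm, counitBar_toBar, one_smul, zero_smul, zero_add]
    simp only [oneBar, rE_toBar, one_mul]
  map_rG x u := by
    obtain ⟨b, rfl⟩ := toBar_surjective k u
    have h : comulRightAlg k (g k x) = 0 := twisted_g _ _ _ _ x
    rw [rG_toBar, comulRightBar_toBar, comulRightBar_toBar, comulRight, LinearMap.comp_apply,
      LinearMap.comp_apply, comulRightAlg_mul, h, mul_zero, zero_add, LinearEquiv.coe_coe,
      map_toBar_mul_comulAlg_g]

end Bar

/-! ### The coproducts of `B̄` as chain maps. -/

section BarCoprod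

variable (k : Type v) [CommRing k] {X : Type u} [Shelf X]

theorem sSq_rEE (x : X) (t : Bbar k X ⊗[k] Bbar k X) :
    sSq k X (rEE k x t) = - rEE k x (sSq k X t) := by
  induction t using TensorProduct.induction_on with
  | zero => simp
  | tmul u v =>
    simp only [rEE_tmul, sSq_tmul, map_add, sBar_rE, sBar_rG, sBar_sBar, TensorProduct.neg_tmul,
      TensorProduct.tmul_neg]
    abel
  | add s t hs ht => simp only [map_add, hs, ht, neg_add]

/-- This is the Leibniz rule in `B̄ ⊗ B̄` for right multiplication by `Δ e_x`, whose differential is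
`1 ⊗ 1 - x ⊗ x`. -/
theorem dSq_rEE (x : X) (t : Bbar k X ⊗[k] Bbar k X) :
    dSq k X (rEE k x t) = rEE k x (dSq k X t) + sSq k X t - rGG k x (sSq k X t) := by
  induction t using TensorProduct.induction_on with
  | zero => simp
  | tmul u v =>
    simp only [rEE_tmul, sSq_tmul, dSq_tmul, rGG_tmul, map_add, sBar_rE, sBar_dBar, dBar_rE,
      dBar_rG, TensorProduct.neg_tmul, TensorProduct.tmul_neg, TensorProduct.add_tmul,
      TensorProduct.tmul_add, TensorProduct.sub_tmul, TensorProduct.tmul_sub, map_neg]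
    abel
  | add s t hs ht =>
    simp only [map_add, hs, ht]
    abel

theorem dBar_rE_one (x : X) : dBar k X (rE k x (oneBar k X)) = 0 := by simp [dBar_rE]

variable {k} {Φ : Bbar k X →ₗ[k] Bbar k X ⊗[k] Bbar k X} {α β γ : k}

theorem IsCoprod.sBar (h : IsCoprod k X Φ α β γ) (u : Bbar k X) :
    Φ (sBar k X u) = sSq k X (Φ u) := by
  suffices h' : Φ ∘ₗ RackBialg.sBar k X = sSq k X ∘ₗ Φ from LinearMap.congr_fun h' u
  refine bar_ext ?_ fun x u ih => ?_
  · simp [h.map_one, sSq_tmul]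
  · simp only [LinearMap.comp_apply] at ih ⊢
    rw [sBar_rE, map_neg, h.map_rE, h.map_rE, ih, map_add, sSq_rEE, counitBar_sBar]
    simp only [map_smul, map_add, sSq_tmul, sBar_rE, sBar_one, TensorProduct.neg_tmul,
      TensorProduct.tmul_neg, neg_add, smul_neg, smul_add]

/-- Both sides obey the same recursion when a letter is appended. The counit terms drop out because
the counit kills boundaries and `e_x` is a cycle in `B̄`. -/
theorem IsCoprod.dBar (h : IsCoprod k X Φ α β γ) (u : Bbar k X) :
    Φ (dBar k X u) = dSq k X (Φ u) := by
  suffices h' : Φ ∘ₗ RackBialg.dBar k X = dSq k X ∘ₗ Φ from LinearMap.congr_fun h' u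
  refine bar_ext ?_ fun x u ih => ?_
  · simp [h.map_one, dSq_tmul]
  · simp only [LinearMap.comp_apply] at ih ⊢
    rw [dBar_rE, map_sub, map_add, h.map_rE, h.map_rE, h.map_rG, h.sBar, ih, map_add, dSq_rEE,
      counitBar_dBar]
    simp only [map_smul, map_add, dSq_tmul, dBar_rE_one, dBar_one, TensorProduct.zero_tmul,
      TensorProduct.tmul_zero, add_zero, smul_zero, zero_smul]

/-! ### Coassociativity -/

variable (k) in
/-- The right action of `e_x` on `B̄ ⊗ B̄ ⊗ B̄`. -/
def rEEE (x : X) :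
    Bbar k X ⊗[k] (Bbar k X ⊗[k] Bbar k X) →ₗ[k] Bbar k X ⊗[k] (Bbar k X ⊗[k] Bbar k X) :=
  TensorProduct.map (rE k x) (rGG k x ∘ₗ sSq k X) + TensorProduct.map LinearMap.id (rEE k x)

theorem rEEE_tmul (x : X) (u : Bbar k X) (t : Bbar k X ⊗[k] Bbar k X) :
    rEEE k x (u ⊗ₜ t) = rE k x u ⊗ₜ rGG k x (sSq k X t) + u ⊗ₜ rEE k x t := rfl

theorem assoc_rEE_tmul (x : X) (t : Bbar k X ⊗[k] Bbar k X) (v : Bbar k X) :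
    TensorProduct.assoc k _ _ _ (rEE k x t ⊗ₜ rG k x (RackBialg.sBar k X v) + t ⊗ₜ rE k x v) =
      rEEE k x (TensorProduct.assoc k _ _ _ (t ⊗ₜ v)) := by
  induction t using TensorProduct.induction_on with
  | zero => simp
  | tmul a b =>
    simp only [rEE_tmul, rEEE_tmul, rGG_tmul, sSq_tmul, TensorProduct.add_tmul, map_add,
      TensorProduct.assoc_tmul, TensorProduct.tmul_add, add_assoc]
  | add s t hs ht =>
    simp only [map_add, TensorProduct.add_tmul] at hs ht ⊢
    rw [← hs, ← ht]
    abel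

/-- Applying `Φ` to the left factor commutes with appending `e_x`, except for the counit term of
`Φ`. That term sees only the degree zero part of the left factor of `t`. -/
theorem IsCoprod.assoc_rTensor (h : IsCoprod k X Φ α β γ) (x : X) (t : Bbar k X ⊗[k] Bbar k X) :
    TensorProduct.assoc k _ _ _ (Φ.rTensor _ (rEE k x t)) =
      rEEE k x (TensorProduct.assoc k _ _ _ (Φ.rTensor _ t)) +
      TensorProduct.assoc k _ _ _ ((β • (rE k x (oneBar k X) ⊗ₜ oneBar k X) +
        γ • (oneBar k X ⊗ₜ rE k x (oneBar k X))) ⊗ₜ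
        rG k x (RackBialg.sBar k X (TensorProduct.lid k _ ((counitBar k X).rTensor _ t)))) := by
  induction t using TensorProduct.induction_on with
  | zero => simp
  | tmul u v =>
    rw [LinearMap.rTensor_tmul, LinearMap.rTensor_tmul, ← assoc_rEE_tmul, rEE_tmul, map_add,
      LinearMap.rTensor_tmul, LinearMap.rTensor_tmul, h.map_rE, TensorProduct.lid_tmul]
    generalize β • (rE k x (oneBar k X) ⊗ₜ[k] oneBar k X) +
      γ • (oneBar k X ⊗ₜ[k] rE k x (oneBar k X)) = c
    rw [map_smul, map_smul, TensorProduct.tmul_smul, TensorProduct.add_tmul,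
      ← TensorProduct.smul_tmul', map_add, map_add, map_add]
    abel
  | add s t hs ht =>
    simp only [map_add, TensorProduct.tmul_add] at hs ht ⊢
    rw [hs, ht]
    abel

theorem IsCoprod.lTensor (h : IsCoprod k X Φ α β γ) (x : X) (t : Bbar k X ⊗[k] Bbar k X) :
    Φ.lTensor _ (rEE k x t) = rEEE k x (Φ.lTensor _ t) +
      TensorProduct.rid k _ ((counitBar k X).lTensor _ t) ⊗ₜ
        (β • (rE k x (oneBar k X) ⊗ₜ oneBar k X) +
          γ • (oneBar k X ⊗ₜ[k] rE k x (oneBar k X))) := by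
  induction t using TensorProduct.induction_on with
  | zero => simp
  | tmul u v =>
    rw [LinearMap.lTensor_tmul, LinearMap.lTensor_tmul, rEEE_tmul, rEE_tmul, map_add,
      LinearMap.lTensor_tmul, LinearMap.lTensor_tmul, h.map_rE, h.map_rG, h.sBar,
      TensorProduct.rid_tmul, TensorProduct.smul_tmul, TensorProduct.tmul_add, add_assoc]
  | add s t hs ht =>
    simp only [map_add, TensorProduct.add_tmul] at hs ht ⊢
    rw [hs, ht]
    abel

theorem counit_rTensor_rEE (x : X) (t : Bbar k X ⊗[k] Bbar k X) :
    TensorProduct.lid k _ ((counitBar k X).rTensor _ (rEE k x t)) =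
      rE k x (TensorProduct.lid k _ ((counitBar k X).rTensor _ t)) := by
  induction t using TensorProduct.induction_on with
  | zero => simp
  | tmul u v => simp [rEE_tmul]
  | add s t hs ht => simp only [map_add, hs, ht]

theorem counit_lTensor_rEE (x : X) (t : Bbar k X ⊗[k] Bbar k X) :
    TensorProduct.rid k _ ((counitBar k X).lTensor _ (rEE k x t)) =
      rE k x (TensorProduct.rid k _ ((counitBar k X).lTensor _ t)) := by
  induction t using TensorProduct.induction_on with
  | zero => simp
  | tmul u v => simp [rEE_tmul]
  | add s t hs ht => simp only [map_add, hs, ht]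

/-- The condition on `γ` is needed because the counit on the left factor sends the term `γ (1 ⊗
e_x)` to `γ e_x`. For the left half `α` is zero as well, so its component with left factor in degree
zero vanishes. -/
theorem IsCoprod.counit_rTensor (h : IsCoprod k X Φ α β γ) (hγ : γ = 0) (u : Bbar k X) :
    TensorProduct.lid k _ ((counitBar k X).rTensor _ (Φ u)) = α • u := by
  suffices h' : (TensorProduct.lid k _).toLinearMap ∘ₗ (counitBar k X).rTensor _ ∘ₗ Φ =
    α • LinearMap.id from LinearMap.congr_fun h' u
  subst hγ
  refine bar_ext ?_ fun x u ih => ?_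
  · simp [h.map_one]
  · simp only [LinearMap.comp_apply, LinearEquiv.coe_coe, LinearMap.smul_apply,
      LinearMap.id_apply] at ih ⊢
    rw [h.map_rE, map_add, map_add, counit_rTensor_rEE, ih]
    simp

theorem IsCoprod.counit_lTensor (h : IsCoprod k X Φ α β γ) (hβ : β = 0) (u : Bbar k X) :
    TensorProduct.rid k _ ((counitBar k X).lTensor _ (Φ u)) = α • u := by
  suffices h' : (TensorProduct.rid k _).toLinearMap ∘ₗ (counitBar k X).lTensor _ ∘ₗ Φ =
    α • LinearMap.id from LinearMap.congr_fun h' u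
  subst hβ
  refine bar_ext ?_ fun x u ih => ?_
  · simp [h.map_one]
  · simp only [LinearMap.comp_apply, LinearEquiv.coe_coe, LinearMap.smul_apply,
      LinearMap.id_apply] at ih ⊢
    rw [h.map_rE, map_add, map_add, counit_lTensor_rEE, ih]
    simp

theorem IsCoprod.map_x (h : IsCoprod k X Φ α β γ) (x : X) : Φ (rE k x (oneBar k X)) =
    (α + β) • (rE k x (oneBar k X) ⊗ₜ oneBar k X) +
      (α + γ) • (oneBar k X ⊗ₜ rE k x (oneBar k X)) := by
  rw [h.map_rE, h.map_one, map_smul, rEE_tmul, sBar_one, rG_one, counitBar_one, one_smul,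
    smul_add, add_smul, add_smul]
  abel

/-- Two composites of coproducts agree as soon as they agree on words of length at most one. -/
theorem IsCoprod.coassoc {Φ₁ Φ₂ Φ₃ Φ₄ : Bbar k X →ₗ[k] Bbar k X ⊗[k] Bbar k X}
    {α₁ β₁ γ₁ α₂ β₂ γ₂ α₃ β₃ γ₃ α₄ β₄ γ₄ : k}
    (h₁ : IsCoprod k X Φ₁ α₁ β₁ γ₁) (h₂ : IsCoprod k X Φ₂ α₂ β₂ γ₂)
    (h₃ : IsCoprod k X Φ₃ α₃ β₃ γ₃) (h₄ : IsCoprod k X Φ₄ α₄ β₄ γ₄)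
    (hl : (β₁ = 0 ∧ γ₁ = 0) ∨ (α₂ = 0 ∧ γ₂ = 0)) (hr : (β₃ = 0 ∧ γ₃ = 0) ∨ (α₄ = 0 ∧ β₄ = 0))
    (e₀ : α₂ * α₁ = α₄ * α₃) (e₁ : β₂ * (α₁ + β₁) = β₄ * α₃)
    (e₂ : β₂ * (α₁ + γ₁) = γ₄ * (α₃ + β₃)) (e₃ : γ₂ * α₁ = γ₄ * (α₃ + γ₃)) (u : Bbar k X) :
    TensorProduct.assoc k _ _ _ (Φ₁.rTensor _ (Φ₂ u)) = Φ₃.lTensor _ (Φ₄ u) := by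
  suffices h : (TensorProduct.assoc k _ _ _).toLinearMap ∘ₗ Φ₁.rTensor _ ∘ₗ Φ₂ =
    Φ₃.lTensor _ ∘ₗ Φ₄ from LinearMap.congr_fun h u
  refine bar_ext ?_ fun x u ih => ?_
  · simp only [LinearMap.comp_apply, LinearEquiv.coe_coe, h₂.map_one, h₄.map_one, map_smul,
      LinearMap.rTensor_tmul, LinearMap.lTensor_tmul, h₁.map_one, h₃.map_one,
      TensorProduct.tmul_smul, ← TensorProduct.smul_tmul', TensorProduct.assoc_tmul, smul_smul, e₀]
  · simp only [LinearMap.comp_apply, LinearEquiv.coe_coe] at ih ⊢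
    -- The counit term of `Φ₁` disappears for one of two reasons: `Φ₁` has none, or the counit
    -- applied to the left factor of `Φ₂ u` gives `α₂ u = 0`.
    have hl' : TensorProduct.assoc k _ _ _ (Φ₁.rTensor _ (rEE k x (Φ₂ u))) =
        rEEE k x (TensorProduct.assoc k _ _ _ (Φ₁.rTensor _ (Φ₂ u))) := by
      rw [h₁.assoc_rTensor]
      rcases hl with ⟨rfl, rfl⟩ | ⟨rfl, hγ⟩
      · simp
      · rw [h₂.counit_rTensor hγ]
        simp
    have hr' : Φ₃.lTensor _ (rEE k x (Φ₄ u)) = rEEE k x (Φ₃.lTensor _ (Φ₄ u)) := by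
      rw [h₃.lTensor]
      rcases hr with ⟨rfl, rfl⟩ | ⟨rfl, hβ⟩
      · simp
      · rw [h₄.counit_lTensor hβ]
        simp
    -- What remains are the counit terms of `Φ₂` and `Φ₄`. The hypotheses `e₁`, `e₂`, `e₃` compare
    -- their coefficients at `e_x ⊗ 1 ⊗ 1`, `1 ⊗ e_x ⊗ 1` and `1 ⊗ 1 ⊗ e_x`.
    rw [h₂.map_rE, h₄.map_rE, map_add, map_add, map_add, hl', hr', ih]
    simp only [map_add, map_smul, LinearMap.rTensor_tmul, LinearMap.lTensor_tmul, h₁.map_one,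
      h₃.map_one, h₁.map_x, h₃.map_x, TensorProduct.tmul_smul, ← TensorProduct.smul_tmul',
      TensorProduct.assoc_tmul, TensorProduct.tmul_add, TensorProduct.add_tmul, smul_add, smul_smul,
      mul_assoc, e₁, e₂, e₃]
    abel

variable (k X)

theorem comulBar_coassoc (u : Bbar k X) :
    TensorProduct.assoc k _ _ _ ((comulBar k X).rTensor _ (comulBar k X u)) =
      (comulBar k X).lTensor _ (comulBar k X u) :=
  (isCoprod_comulBar k X).coassoc (isCoprod_comulBar k X) (isCoprod_comulBar k X)
    (isCoprod_comulBar k X) (by simp) (by simp) (by simp) (by simp) (by simp) (by simp) u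

theorem comulBar_dendri₁ (u : Bbar k X) :
    TensorProduct.assoc k _ _ _ ((comulLeftBar k X).rTensor _ (comulLeftBar k X u)) =
      (comulBar k X).lTensor _ (comulLeftBar k X u) :=
  (isCoprod_comulLeftBar k X).coassoc (isCoprod_comulLeftBar k X) (isCoprod_comulBar k X)
    (isCoprod_comulLeftBar k X) (by simp) (by simp) (by simp) (by simp) (by simp) (by simp) u

theorem comulBar_dendri₂ (u : Bbar k X) :
    TensorProduct.assoc k _ _ _ ((comulBar k X).rTensor _ (comulRightBar k X u)) =
      (comulRightBar k X).lTensor _ (comulRightBar k X u) :=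
  (isCoprod_comulBar k X).coassoc (isCoprod_comulRightBar k X) (isCoprod_comulRightBar k X)
    (isCoprod_comulRightBar k X) (by simp) (by simp) (by simp) (by simp) (by simp) (by simp) u

theorem comulBar_dendri₃ (u : Bbar k X) :
    TensorProduct.assoc k _ _ _ ((comulRightBar k X).rTensor _ (comulLeftBar k X u)) =
      (comulLeftBar k X).lTensor _ (comulRightBar k X u) :=
  (isCoprod_comulRightBar k X).coassoc (isCoprod_comulLeftBar k X) (isCoprod_comulLeftBar k X)
    (isCoprod_comulRightBar k X) (by simp) (by simp) (by simp) (by simp) (by simp) (by simp) u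

/-- The last term accounts for degree zero, where both halves are zero while `Δ 1 = 1 ⊗ 1`. -/
theorem comulBar_eq_add (u : Bbar k X) : comulBar k X u =
    comulLeftBar k X u + comulRightBar k X u + counitBar k X u • (oneBar k X ⊗ₜ oneBar k X) := by
  suffices h : comulBar k X = comulLeftBar k X + comulRightBar k X +
    (counitBar k X).smulRight (oneBar k X ⊗ₜ oneBar k X) from LinearMap.congr_fun h u
  refine bar_ext ?_ fun x u ih => ?_
  · simp [(isCoprod_comulBar k X).map_one, (isCoprod_comulLeftBar k X).map_one,
      (isCoprod_comulRightBar k X).map_one]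
  · simp only [LinearMap.add_apply, LinearMap.smulRight_apply] at ih ⊢
    rw [(isCoprod_comulBar k X).map_rE, (isCoprod_comulLeftBar k X).map_rE,
      (isCoprod_comulRightBar k X).map_rE, ih, counitBar_rE, map_add, map_add, map_smul, rEE_tmul,
      sBar_one, rG_one]
    simp only [zero_smul, one_smul, zero_add, add_zero, smul_add, smul_zero]
    abel

variable {k X}

/-! ### The grading of `B̄` -/

theorem toBar_mem_degBar {n : ℕ} {b : B k X} (hb : b ∈ deg k X n) : toBar k X b ∈ degBar k X n :=
  ⟨b, hb, rfl⟩

variable (k X) in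
theorem degBar_eq_span (n : ℕ) :
    degBar k X n = Submodule.span k {u | ∃ l : List X, l.length = n ∧ u = wBar k l} := by
  rw [degBar, deg_eq_span, Submodule.map_span]
  congr 1
  ext u
  constructor
  · rintro ⟨_, ⟨a, l, hl, rfl⟩, rfl⟩
    exact ⟨l, hl, toBar_gWord_mul k a _⟩
  · rintro ⟨l, hl, rfl⟩
    exact ⟨_, ⟨[], l, hl, rfl⟩, by simp [wBar]⟩

theorem wBar_mem_degBar (l : List X) : wBar k l ∈ degBar k X l.length := by
  rw [degBar_eq_span]
  exact Submodule.subset_span ⟨l, rfl, rfl⟩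

variable (k X) in
/-- The projection of `B̄` to its degree `n` part. -/
def prBar (n : ℕ) : Bbar k X →ₗ[k] Bbar k X :=
  (barBasis k X).constr k fun l => if l.length = n then wBar k l else 0

theorem prBar_wBar (n : ℕ) (l : List X) :
    prBar k X n (wBar k l) = if l.length = n then wBar k l else 0 := by
  rw [← barBasis_apply, prBar, Module.Basis.constr_basis, barBasis_apply]

/-- Linear maps out of `B̄` may be compared on words. -/
theorem bar_ext_wBar {M : Type*} [AddCommGroup M] [Module k M] {φ ψ : Bbar k X →ₗ[k] M}
    (h : ∀ l, φ (wBar k l) = ψ (wBar k l)) : φ = ψ :=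
  (barBasis k X).ext fun l => by rw [barBasis_apply]; exact h l

theorem prBar_mem (n : ℕ) (u : Bbar k X) : prBar k X n u ∈ degBar k X n := by
  have h : u ∈ Submodule.span k (Set.range (barBasis k X)) := by
    rw [(barBasis k X).span_eq]; trivial
  induction h using Submodule.span_induction with
  | mem u hu =>
    obtain ⟨l, rfl⟩ := hu
    rw [barBasis_apply, prBar_wBar]
    split_ifs with hl
    · rw [← hl]; exact wBar_mem_degBar l
    · exact zero_mem _
  | zero => simp
  | add u v _ _ hu hv => rw [map_add]; exact add_mem hu hv
  | smul c u _ hu => rw [map_smul]; exact Submodule.smul_mem _ _ hu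

theorem prBar_of_mem {n m : ℕ} {u : Bbar k X} (hu : u ∈ degBar k X m) :
    prBar k X n u = if m = n then u else 0 := by
  rw [degBar_eq_span] at hu
  induction hu using Submodule.span_induction with
  | mem u hu => obtain ⟨l, rfl, rfl⟩ := hu; exact prBar_wBar n l
  | zero => simp
  | add u v _ _ hu hv => rw [map_add, hu, hv]; split_ifs <;> simp
  | smul c u _ hu => rw [map_smul, hu]; split_ifs <;> simp

theorem prBar_of_mem_same {n : ℕ} {u : Bbar k X} (hu : u ∈ degBar k X n) : prBar k X n u = u := by
  rw [prBar_of_mem hu, if_pos rfl]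

theorem prBar_of_mem_ne {n m : ℕ} {u : Bbar k X} (hu : u ∈ degBar k X m) (h : m ≠ n) :
    prBar k X n u = 0 := by
  rw [prBar_of_mem hu, if_neg h]

/-- Quantifying over all large bounds lets the bounds of two summands be merged by their maximum. -/
theorem exists_sum_prBar (u : Bbar k X) : ∃ N, ∀ M, N ≤ M → ∑ n ∈ Finset.range M, prBar k X n u = u := by
  have h : u ∈ Submodule.span k (Set.range (barBasis k X)) := by
    rw [(barBasis k X).span_eq]; trivial
  induction h using Submodule.span_induction with
  | mem u hu =>
    obtain ⟨l, rfl⟩ := hu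
    refine ⟨l.length + 1, fun M hM => ?_⟩
    simp only [barBasis_apply, prBar_wBar]
    rw [Finset.sum_ite_eq, if_pos (Finset.mem_range.2 hM)]
  | zero => exact ⟨0, by simp⟩
  | add u v _ _ hu hv =>
    obtain ⟨N, hN⟩ := hu
    obtain ⟨N', hN'⟩ := hv
    refine ⟨max N N', fun M hM => ?_⟩
    simp only [map_add, Finset.sum_add_distrib]
    rw [hN M (le_trans (le_max_left _ _) hM), hN' M (le_trans (le_max_right _ _) hM)]
  | smul c u _ hu =>
    obtain ⟨N, hN⟩ := hu
    refine ⟨N, fun M hM => ?_⟩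
    simp only [map_smul, ← Finset.smul_sum]
    rw [hN M hM]

theorem oneBar_mem_degBar : oneBar k X ∈ degBar k X 0 := wBar_mem_degBar []

theorem rE_mem_degBar (x : X) {n : ℕ} {u : Bbar k X} (hu : u ∈ degBar k X n) :
    rE k x u ∈ degBar k X (n + 1) := by
  obtain ⟨b, hb, rfl⟩ := hu
  exact ⟨b * e k x, SetLike.GradedMul.mul_mem (A := deg k X) hb (e_mem_deg k x), rfl⟩

theorem rG_mem_degBar (x : X) {n : ℕ} {u : Bbar k X} (hu : u ∈ degBar k X n) :
    rG k x u ∈ degBar k X n := by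
  obtain ⟨b, hb, rfl⟩ := hu
  have h : b * g k x ∈ deg k X (n + 0) :=
    SetLike.GradedMul.mul_mem (A := deg k X) hb (g_mem_deg k x)
  rw [rG_toBar]
  exact toBar_mem_degBar h

theorem sBar_of_mem {n : ℕ} {u : Bbar k X} (hu : u ∈ degBar k X n) :
    RackBialg.sBar k X u = (-1 : k) ^ n • u := by
  obtain ⟨b, hb, rfl⟩ := hu
  rw [sBar_toBar, sgn_of_mem_deg k hb, map_smul]

theorem sBar_mem_degBar {n : ℕ} {u : Bbar k X} (hu : u ∈ degBar k X n) :
    RackBialg.sBar k X u ∈ degBar k X n := by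
  rw [sBar_of_mem hu]
  exact Submodule.smul_mem _ _ hu

theorem normBar_mem_degBar {n : ℕ} {u : Bbar k X} (hu : u ∈ degBar k X n) :
    normBar k X u ∈ degBar k X n := by
  obtain ⟨b, hb, rfl⟩ := hu
  exact ⟨norm k b, norm_mem_deg k hb, rfl⟩

theorem dBar_mem_degBar {n : ℕ} {u : Bbar k X} (hu : u ∈ degBar k X (n + 1)) :
    RackBialg.dBar k X u ∈ degBar k X n := by
  rw [degBar_eq_span] at hu
  induction hu using Submodule.span_induction with
  | mem u hu =>
    obtain ⟨l, hl, rfl⟩ := hu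
    induction n generalizing l with
    | zero =>
      obtain ⟨x, rfl⟩ := List.length_eq_one_iff.1 hl
      rw [wBar_singleton, dBar_rE_one]
      exact zero_mem _
    | succ n ih =>
      induction l using List.reverseRecOn with
      | nil => simp at hl
      | append_singleton l x _ =>
        have hl' : l.length = n + 1 := by simpa using hl
        have hw := wBar_mem_degBar (k := k) l
        rw [hl'] at hw
        rw [wBar_concat, dBar_rE]
        exact sub_mem (add_mem (rE_mem_degBar x (ih l hl')) (sBar_mem_degBar hw))
          (rG_mem_degBar x (sBar_mem_degBar hw))
  | zero => simp
  | add u v _ _ hu hv => rw [map_add]; exact add_mem hu hv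
  | smul c u _ hu => rw [map_smul]; exact Submodule.smul_mem _ _ hu

theorem dBar_of_mem_zero {u : Bbar k X} (hu : u ∈ degBar k X 0) : RackBialg.dBar k X u = 0 := by
  rw [degBar_eq_span] at hu
  induction hu using Submodule.span_induction with
  | mem u hu =>
    obtain ⟨l, hl, rfl⟩ := hu
    rw [List.length_eq_zero_iff.1 hl, wBar_nil, dBar_one]
  | zero => simp
  | add u v _ _ hu hv => rw [map_add, hu, hv, add_zero]
  | smul c u _ hu => rw [map_smul, hu, smul_zero]

theorem prBar_dBar (n : ℕ) (u : Bbar k X) :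
    prBar k X n (RackBialg.dBar k X u) = RackBialg.dBar k X (prBar k X (n + 1) u) := by
  suffices h : prBar k X n ∘ₗ RackBialg.dBar k X = RackBialg.dBar k X ∘ₗ prBar k X (n + 1) from
    LinearMap.congr_fun h u
  refine bar_ext_wBar fun l => ?_
  rw [LinearMap.comp_apply, LinearMap.comp_apply, prBar_wBar]
  rcases hl : l.length with _ | m
  · have h := wBar_mem_degBar (k := k) l
    rw [hl] at h
    rw [dBar_of_mem_zero h, map_zero, if_neg (by omega), map_zero]
  · have h := wBar_mem_degBar (k := k) l
    rw [hl] at h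
    rw [prBar_of_mem (dBar_mem_degBar h)]
    simp only [Nat.add_right_cancel_iff]
    split_ifs <;> simp

variable (k X) in
/-- The degree `n` part of `B̄ ⊗ B̄`. -/
def degSq (n : ℕ) : Submodule k (Bbar k X ⊗[k] Bbar k X) :=
  Submodule.span k {t | ∃ p q u v, p + q = n ∧ u ∈ degBar k X p ∧ v ∈ degBar k X q ∧ t = u ⊗ₜ[k] v}

theorem tmul_mem_degSq {p q n : ℕ} (h : p + q = n) {u v : Bbar k X} (hu : u ∈ degBar k X p)
    (hv : v ∈ degBar k X q) : u ⊗ₜ[k] v ∈ degSq k X n :=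
  Submodule.subset_span ⟨p, q, u, v, h, hu, hv, rfl⟩

theorem rEE_mem_degSq (x : X) {n : ℕ} {t : Bbar k X ⊗[k] Bbar k X} (ht : t ∈ degSq k X n) :
    rEE k x t ∈ degSq k X (n + 1) := by
  induction ht using Submodule.span_induction with
  | mem t ht =>
    obtain ⟨p, q, u, v, rfl, hu, hv, rfl⟩ := ht
    rw [rEE_tmul]
    exact add_mem (tmul_mem_degSq (by omega) (rE_mem_degBar x hu)
      (rG_mem_degBar x (sBar_mem_degBar hv))) (tmul_mem_degSq (by omega) hu (rE_mem_degBar x hv))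
  | zero => simp
  | add u v _ _ hu hv => rw [map_add]; exact add_mem hu hv
  | smul c u _ hu => rw [map_smul]; exact Submodule.smul_mem _ _ hu

theorem IsCoprod.mem_degSq (h : IsCoprod k X Φ α β γ) {n : ℕ} {u : Bbar k X}
    (hu : u ∈ degBar k X n) : Φ u ∈ degSq k X n := by
  rw [degBar_eq_span] at hu
  induction hu using Submodule.span_induction with
  | mem u hu =>
    obtain ⟨l, rfl, rfl⟩ := hu
    induction l using List.reverseRecOn with
    | nil =>
      rw [wBar_nil, h.map_one]
      exact Submodule.smul_mem _ _ (tmul_mem_degSq (by simp) oneBar_mem_degBar oneBar_mem_degBar)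
    | append_singleton l x ih =>
      rw [wBar_concat, h.map_rE, List.length_append, List.length_singleton]
      refine add_mem (rEE_mem_degSq x ih) ?_
      -- The counit term of `Φ` contributes only when the letter is appended to the empty word, and
      -- there it has degree one.
      induction l using List.reverseRecOn with
      | nil =>
        have hx : rE k x (oneBar k X) ∈ degBar k X 1 := rE_mem_degBar x oneBar_mem_degBar
        have h₁ : rE k x (oneBar k X) ⊗ₜ[k] oneBar k X ∈ degSq k X (([] : List X).length + 1) :=
          tmul_mem_degSq (by simp) hx oneBar_mem_degBar
        have h₂ : oneBar k X ⊗ₜ[k] rE k x (oneBar k X) ∈ degSq k X (([] : List X).length + 1) :=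
          tmul_mem_degSq (by simp) oneBar_mem_degBar hx
        exact Submodule.smul_mem _ _ (add_mem (Submodule.smul_mem _ _ h₁)
          (Submodule.smul_mem _ _ h₂))
      | append_singleton l y _ =>
        rw [wBar_concat, counitBar_rE, zero_smul]
        exact zero_mem _
  | zero => simp
  | add u v _ _ hu hv => rw [map_add]; exact add_mem hu hv
  | smul c u _ hu => rw [map_smul]; exact Submodule.smul_mem _ _ hu

/-- Maps that vanish outside degrees `p` and `q` kill the other parts of `B̄ ⊗ B̄`. -/
theorem map_eq_zero_of_mem_degSq {M N : Type*} [AddCommGroup M] [Module k M] [AddCommGroup N]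
    [Module k N] {φ : Bbar k X →ₗ[k] M} {ψ : Bbar k X →ₗ[k] N} {p q n : ℕ}
    (hφ : ∀ m, m ≠ p → ∀ u ∈ degBar k X m, φ u = 0)
    (hψ : ∀ m, m ≠ q → ∀ u ∈ degBar k X m, ψ u = 0) (h : p + q ≠ n)
    {t : Bbar k X ⊗[k] Bbar k X} (ht : t ∈ degSq k X n) : TensorProduct.map φ ψ t = 0 := by
  induction ht using Submodule.span_induction with
  | mem t ht =>
    obtain ⟨p', q', u, v, rfl, hu, hv, rfl⟩ := ht
    rw [TensorProduct.map_tmul]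
    by_cases hp : p' = p
    · rw [hψ q' (by omega) v hv, TensorProduct.tmul_zero]
    · rw [hφ p' hp u hu, TensorProduct.zero_tmul]
  | zero => simp
  | add u v _ _ hu hv => rw [map_add, hu, hv, add_zero]
  | smul c u _ hu => rw [map_smul, hu, smul_zero]

end BarCoprod

/-! ### Commutativity of the coproducts up to homotopy. -/

section Homotopy

variable (k : Type v) [CommRing k] {X : Type u} [Shelf X]

variable {k} in
theorem sq_ext {M : Type*} [AddCommGroup M] [Module k M]
    {φ ψ : Bbar k X ⊗[k] Bbar k X →ₗ[k] M}
    (h : ∀ a b, φ (wBar k a ⊗ₜ wBar k b) = ψ (wBar k a ⊗ₜ wBar k b)) : φ = ψ :=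
  ((barBasis k X).tensorProduct (barBasis k X)).ext fun p => by
    rw [Module.Basis.tensorProduct_apply', barBasis_apply, barBasis_apply]
    exact h p.1 p.2

variable (X) in
/-- The flip of `B̄ ⊗ B̄`, with the Koszul sign. -/
def swapBar : Bbar k X ⊗[k] Bbar k X →ₗ[k] Bbar k X ⊗[k] Bbar k X :=
  ((barBasis k X).tensorProduct (barBasis k X)).constr k fun p =>
    (-1 : k) ^ (p.1.length * p.2.length) • (wBar k p.2 ⊗ₜ wBar k p.1)

theorem swapBar_wBar (a b : List X) : swapBar k X (wBar k a ⊗ₜ wBar k b) =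
    (-1 : k) ^ (a.length * b.length) • (wBar k b ⊗ₜ wBar k a) := by
  have h := ((barBasis k X).tensorProduct (barBasis k X)).constr_basis k
    (fun p => (-1 : k) ^ (p.1.length * p.2.length) • (wBar k p.2 ⊗ₜ[k] wBar k p.1)) (a, b)
  rwa [Module.Basis.tensorProduct_apply, barBasis_apply, barBasis_apply] at h

theorem swapBar_tmul {p q : ℕ} {u v : Bbar k X} (hu : u ∈ degBar k X p) (hv : v ∈ degBar k X q) :
    swapBar k X (u ⊗ₜ v) = (-1 : k) ^ (p * q) • (v ⊗ₜ u) := by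
  rw [degBar_eq_span] at hu hv
  induction hu using Submodule.span_induction with
  | mem u hu =>
    obtain ⟨a, rfl, rfl⟩ := hu
    induction hv using Submodule.span_induction with
    | mem v hv => obtain ⟨b, rfl, rfl⟩ := hv; exact swapBar_wBar k a b
    | zero => simp
    | add v v' _ _ hv hv' =>
      rw [TensorProduct.tmul_add, map_add, hv, hv', TensorProduct.add_tmul, smul_add]
    | smul c v _ hv =>
      rw [TensorProduct.tmul_smul, map_smul, hv, ← TensorProduct.smul_tmul', smul_comm]
  | zero => simp
  | add v v' _ _ hv hv' =>
    rw [TensorProduct.add_tmul, map_add, hv, hv', TensorProduct.tmul_add, smul_add]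
  | smul c v _ hv =>
    rw [← TensorProduct.smul_tmul', map_smul, hv, TensorProduct.tmul_smul, smul_comm]

/-- The right action of the opposite of `Δ e_x` on `B̄ ⊗ B̄`. -/
def rEEop (x : X) : Bbar k X ⊗[k] Bbar k X →ₗ[k] Bbar k X ⊗[k] Bbar k X :=
  TensorProduct.map (rG k x) (rE k x) + TensorProduct.map (rE k x) (sBar k X)

/-- The right action of `e_x ⊗ e_x` on `B̄ ⊗ B̄`. -/
def rF (x : X) : Bbar k X ⊗[k] Bbar k X →ₗ[k] Bbar k X ⊗[k] Bbar k X :=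
  TensorProduct.map (rE k x) (rE k x ∘ₗ sBar k X)

theorem rEEop_tmul (x : X) (u v : Bbar k X) : rEEop k x (u ⊗ₜ v) =
    rG k x u ⊗ₜ rE k x v + rE k x u ⊗ₜ sBar k X v := rfl

theorem rF_tmul (x : X) (u v : Bbar k X) : rF k x (u ⊗ₜ v) = rE k x u ⊗ₜ rE k x (sBar k X v) := rfl

theorem neg_one_pow_eq_of_even {a b : ℕ} (h : Even (a + b)) : (-1 : k) ^ a = (-1) ^ b := by
  rw [Nat.even_add] at h
  by_cases ha : Even a
  · rw [ha.neg_one_pow, (h.1 ha).neg_one_pow]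
  · have hb : ¬ Even b := fun hb => ha (h.2 hb)
    rw [(Nat.not_even_iff_odd.1 ha).neg_one_pow, (Nat.not_even_iff_odd.1 hb).neg_one_pow]

theorem swapBar_rEE (x : X) (t : Bbar k X ⊗[k] Bbar k X) :
    swapBar k X (rEE k x t) = rEEop k x (swapBar k X t) := by
  suffices h : swapBar k X ∘ₗ rEE k x = rEEop k x ∘ₗ swapBar k X from LinearMap.congr_fun h t
  refine sq_ext fun a b => ?_
  have ha := wBar_mem_degBar (k := k) a
  have hb := wBar_mem_degBar (k := k) b
  rw [LinearMap.comp_apply, LinearMap.comp_apply, swapBar_wBar, rEE_tmul, map_add, map_smul,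
    rEEop_tmul, sBar_of_mem ha, sBar_of_mem hb, map_smul, TensorProduct.tmul_smul, map_smul,
    swapBar_tmul k (rE_mem_degBar x ha) (rG_mem_degBar x hb),
    swapBar_tmul k ha (rE_mem_degBar x hb), TensorProduct.tmul_smul, smul_smul, smul_add,
    smul_smul, ← pow_add, ← pow_add]
  congr 2
  · exact neg_one_pow_eq_of_even k (by ring_nf; simp [Nat.even_add, parity_simps])

/-- The exponent `p q + q` has the parity of `(p - 1) q` and avoids subtraction; for `p = 0` both
sides are zero. -/
theorem swapBar_dBar_tmul {p q : ℕ} {u v : Bbar k X} (hu : u ∈ degBar k X p)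
    (hv : v ∈ degBar k X q) :
    swapBar k X (dBar k X u ⊗ₜ v) = (-1 : k) ^ (p * q + q) • (v ⊗ₜ dBar k X u) := by
  cases p with
  | zero => simp [dBar_of_mem_zero hu]
  | succ p =>
    rw [swapBar_tmul k (dBar_mem_degBar hu) hv]
    congr 1
    exact neg_one_pow_eq_of_even k (by ring_nf; simp [Nat.even_add, parity_simps])

theorem swapBar_tmul_dBar {p q : ℕ} {u v : Bbar k X} (hu : u ∈ degBar k X p)
    (hv : v ∈ degBar k X q) :
    swapBar k X (u ⊗ₜ dBar k X v) = (-1 : k) ^ (p * q + p) • (dBar k X v ⊗ₜ u) := by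
  cases q with
  | zero => simp [dBar_of_mem_zero hv]
  | succ q =>
    rw [swapBar_tmul k hu (dBar_mem_degBar hv)]
    congr 1
    exact neg_one_pow_eq_of_even k (by ring_nf; simp [Nat.even_add, parity_simps])

theorem swapBar_dSq (t : Bbar k X ⊗[k] Bbar k X) :
    swapBar k X (dSq k X t) = dSq k X (swapBar k X t) := by
  suffices h : swapBar k X ∘ₗ dSq k X = dSq k X ∘ₗ swapBar k X from LinearMap.congr_fun h t
  refine sq_ext fun a b => ?_
  have ha := wBar_mem_degBar (k := k) a
  have hb := wBar_mem_degBar (k := k) b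
  rw [LinearMap.comp_apply, LinearMap.comp_apply, swapBar_wBar, dSq_tmul, map_add, map_smul,
    dSq_tmul, sBar_of_mem ha, sBar_of_mem hb, ← TensorProduct.smul_tmul',
    ← TensorProduct.smul_tmul', map_smul, swapBar_dBar_tmul k ha hb, swapBar_tmul_dBar k ha hb,
    smul_add, smul_smul, smul_smul, ← pow_add, ← pow_add, add_comm]
  congr 2
  exact neg_one_pow_eq_of_even k (by ring_nf; simp [Nat.even_add, parity_simps])

theorem swapBar_sSq (t : Bbar k X ⊗[k] Bbar k X) :
    swapBar k X (sSq k X t) = sSq k X (swapBar k X t) := by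
  suffices h : swapBar k X ∘ₗ sSq k X = sSq k X ∘ₗ swapBar k X from LinearMap.congr_fun h t
  refine sq_ext fun a b => ?_
  simp only [LinearMap.comp_apply, swapBar_wBar, sSq_tmul, sBar_wBar, map_smul,
    ← TensorProduct.smul_tmul', TensorProduct.tmul_smul]
  simp only [smul_smul]
  congr 1
  ring

theorem swapBar_rGG (x : X) (t : Bbar k X ⊗[k] Bbar k X) :
    swapBar k X (rGG k x t) = rGG k x (swapBar k X t) := by
  suffices h : swapBar k X ∘ₗ rGG k x = rGG k x ∘ₗ swapBar k X from LinearMap.congr_fun h t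
  refine sq_ext fun a b => ?_
  have ha := wBar_mem_degBar (k := k) a
  have hb := wBar_mem_degBar (k := k) b
  rw [LinearMap.comp_apply, LinearMap.comp_apply, swapBar_wBar, rGG_tmul,
    swapBar_tmul k (rG_mem_degBar x ha) (rG_mem_degBar x hb), map_smul, rGG_tmul]

theorem sSq_rF (x : X) (t : Bbar k X ⊗[k] Bbar k X) :
    sSq k X (rF k x t) = rF k x (sSq k X t) := by
  induction t using TensorProduct.induction_on with
  | zero => simp
  | tmul u v => simp [rF_tmul, sSq_tmul, TensorProduct.neg_tmul, TensorProduct.tmul_neg]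
  | add s t hs ht => simp only [map_add, hs, ht]

theorem rGG_rEE (x y : X) (t : Bbar k X ⊗[k] Bbar k X) :
    rGG k y (rEE k x t) = rEE k (up x y) (rGG k y t) := by
  induction t using TensorProduct.induction_on with
  | zero => simp
  | tmul u v =>
    have h : rG k y (rG k x (sBar k X v)) = rG k (up x y) (rG k y (sBar k X v)) := by
      obtain ⟨b, hb⟩ := toBar_surjective k (sBar k X v)
      rw [← hb, rG_toBar, rG_toBar, rG_toBar, rG_toBar, mul_assoc, mul_assoc, g_mul_g]
    simp only [rEE_tmul, rGG_tmul, map_add, rG_rE, h, sBar_rG]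
  | add s t hs ht => simp only [map_add, hs, ht]

theorem rGG_rF (x y : X) (t : Bbar k X ⊗[k] Bbar k X) :
    rGG k y (rF k x t) = rF k (up x y) (rGG k y t) := by
  induction t using TensorProduct.induction_on with
  | zero => simp
  | tmul u v => simp only [rF_tmul, rGG_tmul, rG_rE, sBar_rG]
  | add s t hs ht => simp only [map_add, hs, ht]

/-- The source of the homotopy: the differential of `e_x ⊗ e_x` is `(1 - x) ⊗ e_x - e_x ⊗ (1 - x)`,
and this is `Δ e_x - Δ^op e_x`. -/
theorem dSq_rF (x : X) (t : Bbar k X ⊗[k] Bbar k X) :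
    dSq k X (rF k x t) = rF k x (dSq k X t) + rEE k x (sSq k X t) - rEEop k x (sSq k X t) := by
  induction t using TensorProduct.induction_on with
  | zero => simp
  | tmul u v =>
    simp only [rEE_tmul, sSq_tmul, dSq_tmul, rF_tmul, rEEop_tmul, map_add, sBar_rE, sBar_dBar,
      dBar_rE, TensorProduct.neg_tmul, TensorProduct.tmul_neg, TensorProduct.add_tmul,
      TensorProduct.tmul_add, TensorProduct.sub_tmul, TensorProduct.tmul_sub, map_neg, sBar_sBar]
    abel
  | add s t hs ht =>
    simp only [map_add, hs, ht]
    abel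

/-- The values of the homotopy on words, read from right to left. -/
def htpyAux : List X → Bbar k X ⊗[k] Bbar k X
  | [] => 0
  | x :: l => rEE k x (htpyAux l) +
      rF k x (swapBar k X (comulRightBar k X (sBar k X (wBar k l.reverse))))

variable (X) in
/-- A homotopy between the left half of the coproduct and the flip of the right half. -/
def htpy : Bbar k X →ₗ[k] Bbar k X ⊗[k] Bbar k X :=
  (barBasis k X).constr k fun l => htpyAux k l.reverse

theorem htpy_wBar (l : List X) : htpy k X (wBar k l) = htpyAux k l.reverse := by
  rw [← barBasis_apply, htpy, Module.Basis.constr_basis]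

@[simp] theorem htpy_one : htpy k X (oneBar k X) = 0 := htpy_wBar k []

/-- The second term multiplies the flipped right half by `e_x ⊗ e_x`. By `dSq_rF` its differential
supplies the discrepancy between multiplying that half by `Δ e_x` and by `Δ^op e_x`. -/
theorem htpy_rE (x : X) (u : Bbar k X) : htpy k X (rE k x u) = rEE k x (htpy k X u) +
    rF k x (swapBar k X (comulRightBar k X (sBar k X u))) := by
  suffices h : htpy k X ∘ₗ rE k x = rEE k x ∘ₗ htpy k X +
    rF k x ∘ₗ swapBar k X ∘ₗ comulRightBar k X ∘ₗ sBar k X from LinearMap.congr_fun h u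
  refine bar_ext_wBar fun l => ?_
  simp only [LinearMap.comp_apply, LinearMap.add_apply]
  rw [← wBar_concat, htpy_wBar, htpy_wBar, List.reverse_append, List.reverse_singleton,
    List.singleton_append, htpyAux, List.reverse_reverse]

theorem htpy_sBar (u : Bbar k X) : htpy k X (sBar k X u) = - sSq k X (htpy k X u) := by
  suffices h : htpy k X ∘ₗ sBar k X = -(sSq k X ∘ₗ htpy k X) from LinearMap.congr_fun h u
  refine bar_ext ?_ fun x u ih => ?_
  · simp
  · simp only [LinearMap.comp_apply, LinearMap.neg_apply] at ih ⊢
    rw [sBar_rE, map_neg, htpy_rE, htpy_rE, ih, map_add, sSq_rEE, sSq_rF, ← swapBar_sSq,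
      (isCoprod_comulRightBar k X).sBar, (isCoprod_comulRightBar k X).sBar, map_neg]

theorem htpy_rG (x : X) (u : Bbar k X) : htpy k X (rG k x u) = rGG k x (htpy k X u) := by
  suffices h : htpy k X ∘ₗ rG k x = rGG k x ∘ₗ htpy k X from LinearMap.congr_fun h u
  refine bar_ext ?_ fun y u ih => ?_
  · simp
  · simp only [LinearMap.comp_apply] at ih ⊢
    rw [rG_rE, htpy_rE, htpy_rE, ih, map_add, rGG_rEE, rGG_rF, ← swapBar_rGG, sBar_rG,
      (isCoprod_comulRightBar k X).map_rG]

/-- Appending `e_x` multiplies the left half by `Δ e_x` and the flipped right half by `Δ^op e_x`,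
and adds the same term `ε(u) e_x ⊗ 1` to both. The difference is therefore the old difference times
`Δ e_x`, plus the flipped right half times `Δ e_x - Δ^op e_x`. The induction hypothesis handles the
first summand and `dSq_rF` the second. The remaining terms cancel because the right half and the
flip commute with the differentials and sign automorphisms. -/
theorem dSq_htpy (u : Bbar k X) : dSq k X (htpy k X u) + htpy k X (dBar k X u) =
    comulLeftBar k X u - swapBar k X (comulRightBar k X u) := by
  suffices h : dSq k X ∘ₗ htpy k X + htpy k X ∘ₗ dBar k X =
    comulLeftBar k X - swapBar k X ∘ₗ comulRightBar k X from LinearMap.congr_fun h u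
  refine bar_ext ?_ fun x u ih => ?_
  · simp [(isCoprod_comulLeftBar k X).map_one, (isCoprod_comulRightBar k X).map_one]
  · simp only [LinearMap.comp_apply, LinearMap.add_apply, LinearMap.sub_apply] at ih ⊢
    have hR := isCoprod_comulRightBar k X
    have hx : swapBar k X (oneBar k X ⊗ₜ rE k x (oneBar k X)) = rE k x (oneBar k X) ⊗ₜ oneBar k X := by
      rw [swapBar_tmul k oneBar_mem_degBar (rE_mem_degBar x oneBar_mem_degBar), zero_mul, pow_zero,
        one_smul]
    have hs : sSq k X (swapBar k X (comulRightBar k X (sBar k X u))) =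
        swapBar k X (comulRightBar k X u) := by
      rw [← swapBar_sSq, ← hR.sBar, sBar_sBar]
    have hd : swapBar k X (comulRightBar k X (sBar k X (dBar k X u))) =
        - dSq k X (swapBar k X (comulRightBar k X (sBar k X u))) := by
      rw [← swapBar_dSq, ← hR.dBar, sBar_dBar, map_neg, map_neg]
    have ih' := congrArg (rEE k x) ih
    rw [map_add, map_sub] at ih'
    rw [(isCoprod_comulLeftBar k X).map_rE, hR.map_rE, htpy_rE, map_add (dSq k X), dSq_rEE, dSq_rF,
      hs, dBar_rE, map_sub, map_add, htpy_rE, htpy_rG, hd, htpy_sBar, map_add (swapBar k X),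
      swapBar_rEE, map_smul]
    simp only [one_smul, zero_smul, add_zero, zero_add, hx, map_neg]
    rw [eq_sub_iff_add_eq] at ih'
    rw [← ih']
    abel

/-- Maps that vanish outside degrees `p` and `q` turn the signed flip into the plain one. -/
theorem map_swapBar {M N : Type*} [AddCommGroup M] [Module k M] [AddCommGroup N]
    [Module k N] {φ : Bbar k X →ₗ[k] M} {ψ : Bbar k X →ₗ[k] N} {p q : ℕ}
    (hφ : ∀ m, m ≠ p → ∀ u ∈ degBar k X m, φ u = 0)
    (hψ : ∀ m, m ≠ q → ∀ u ∈ degBar k X m, ψ u = 0) (t : Bbar k X ⊗[k] Bbar k X) :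
    TensorProduct.map φ ψ (swapBar k X t) =
      (-1 : k) ^ (p * q) • TensorProduct.comm k _ _ (TensorProduct.map ψ φ t) := by
  suffices h : TensorProduct.map φ ψ ∘ₗ swapBar k X = (-1 : k) ^ (p * q) •
    ((TensorProduct.comm k _ _).toLinearMap ∘ₗ TensorProduct.map ψ φ) from LinearMap.congr_fun h t
  refine sq_ext fun a b => ?_
  simp only [LinearMap.comp_apply, LinearMap.smul_apply, swapBar_wBar, map_smul,
    TensorProduct.map_tmul, LinearEquiv.coe_coe, TensorProduct.comm_tmul]
  by_cases ha : a.length = q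
  · by_cases hb : b.length = p
    · rw [ha, hb, mul_comm]
    · rw [hφ _ hb _ (wBar_mem_degBar b)]
      simp
  · rw [hψ _ ha _ (wBar_mem_degBar a)]
    simp

end Homotopy

/-! ### The projection of `B̄` to `B̄^N` and its compatibility with `d` and the coproducts. -/

section NormBar

variable (k : Type v) [CommRing k] {X : Type u} [Shelf X]

theorem normBar_mem (u : Bbar k X) : normBar k X u ∈ BbarN k X := by
  obtain ⟨b, rfl⟩ := toBar_surjective k u
  exact ⟨norm k b, norm_mem_BN k b, rfl⟩

theorem sub_normBar_mem (u : Bbar k X) : u - normBar k X u ∈ BbarD k X := by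
  obtain ⟨b, rfl⟩ := toBar_surjective k u
  exact ⟨b - norm k b, sub_norm_mem_BD k b, map_sub _ _ _⟩

theorem normBar_of_mem_BbarN {u : Bbar k X} (hu : u ∈ BbarN k X) : normBar k X u = u := by
  obtain ⟨b, hb, rfl⟩ := hu
  rw [normBar_toBar, norm_of_mem_BN k hb]

theorem normBar_of_mem_BbarD {u : Bbar k X} (hu : u ∈ BbarD k X) : normBar k X u = 0 := by
  obtain ⟨b, hb, rfl⟩ := hu
  rw [normBar_toBar, norm_of_mem_BD k hb, map_zero]

theorem normBar_wBar (l : List X) : normBar k X (wBar k l) = toBar k X (nWord k l) := by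
  rw [wBar, normBar_toBar, norm_eWord]

/-- Both the image and the kernel of the projection are stable under `d`. -/
theorem d_norm (hX : ∀ x : X, Shelf.act x x = x) (b : B k X) : norm k (d k b) = d k (norm k b) := by
  have h₁ := norm_of_mem_BN k ((isDGSubbimodule_BN k X).d_mem _ (norm_mem_BN k b))
  have h₂ := norm_of_mem_BD k ((isDGSubbimodule_BD k hX).d_mem _ (sub_norm_mem_BD k b))
  rw [map_sub, map_sub, sub_eq_zero] at h₂
  rw [h₂, h₁]

theorem normBar_dBar (hX : ∀ x : X, Shelf.act x x = x) (u : Bbar k X) :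
    normBar k X (dBar k X u) = dBar k X (normBar k X u) := by
  obtain ⟨b, rfl⟩ := toBar_surjective k u
  rw [dBar_toBar, normBar_toBar, normBar_toBar, dBar_toBar, d_norm k hX]

/-- Membership in the image of `B ⊗ B^N` is recast as an equation, to which further maps, such as
pairs of class maps or cochains, can be applied. -/
theorem map_id_normBar_of_mem {t : B k X ⊗[k] B k X} (ht : t ∈ tens ⊤ (BN k X)) :
    TensorProduct.map LinearMap.id (normBar k X) (TensorProduct.map (toBar k X) (toBar k X) t) =
      TensorProduct.map (toBar k X) (toBar k X) t := by
  suffices h : tens ⊤ (BN k X) ≤ LinearMap.eqLocus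
    (TensorProduct.map LinearMap.id (normBar k X) ∘ₗ TensorProduct.map (toBar k X) (toBar k X))
    (TensorProduct.map (toBar k X) (toBar k X)) from h ht
  refine tens_le fun b _ c hc => ?_
  change toBar k X b ⊗ₜ normBar k X (toBar k X c) = toBar k X b ⊗ₜ toBar k X c
  rw [normBar_toBar, norm_of_mem_BN k hc]

theorem map_normBar_comulBar_of_mem {u : Bbar k X} (hu : u ∈ BbarN k X) :
    TensorProduct.map LinearMap.id (normBar k X) (comulBar k X u) = comulBar k X u := by
  obtain ⟨b, hb, rfl⟩ := hu
  exact map_id_normBar_of_mem k (comul_of_mem_BN k hb)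

theorem map_normBar_comulLeftBar_of_mem {u : Bbar k X} (hu : u ∈ BbarN k X) :
    TensorProduct.map LinearMap.id (normBar k X) (comulLeftBar k X u) = comulLeftBar k X u := by
  obtain ⟨b, hb, rfl⟩ := hu
  exact map_id_normBar_of_mem k (comulLeft_of_mem_BN k hb)

theorem map_normBar_comulRightBar_of_mem {u : Bbar k X} (hu : u ∈ BbarN k X) :
    TensorProduct.map LinearMap.id (normBar k X) (comulRightBar k X u) = comulRightBar k X u := by
  obtain ⟨b, hb, rfl⟩ := hu
  exact map_id_normBar_of_mem k (comulRight_of_mem_BN k hb)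

theorem map_normBar_normBar_comulBar (hX : ∀ x : X, Shelf.act x x = x) {u : Bbar k X}
    (hu : u ∈ BbarD k X) :
    TensorProduct.map (normBar k X) (normBar k X) (comulBar k X u) = 0 := by
  obtain ⟨b, hb, rfl⟩ := hu
  suffices h : tens (BD k X) ⊤ ⊔ tens ⊤ (BD k X) ≤ LinearMap.ker
    (TensorProduct.map (normBar k X) (normBar k X) ∘ₗ TensorProduct.map (toBar k X) (toBar k X)) from
    h (comul_of_mem_BD k hX hb)
  refine sup_le (tens_le fun b hb c _ => ?_) (tens_le fun b _ c hc => ?_)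
  · change normBar k X (toBar k X b) ⊗ₜ normBar k X (toBar k X c) = 0
    rw [normBar_toBar, norm_of_mem_BD k hb, map_zero, TensorProduct.zero_tmul]
  · change normBar k X (toBar k X b) ⊗ₜ normBar k X (toBar k X c) = 0
    rw [normBar_toBar k c, norm_of_mem_BD k hc, map_zero, TensorProduct.tmul_zero]

end NormBar

/-! ### Retracts, tensor products and transfer of structure. -/

section LinearAlgebra

variable {k : Type*} [CommRing k]

/-- The mixed composites vanish automatically: evaluating the sum formula at `i₂ u` gives `i₁ (p₁
(i₂ u)) = 0`, and `p₁` undoes `i₁`. -/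
theorem bijective_coprod_of_retracts {M M₁ M₂ : Type*} [AddCommGroup M] [Module k M]
    [AddCommGroup M₁] [Module k M₁] [AddCommGroup M₂] [Module k M₂] {i₁ : M₁ →ₗ[k] M}
    {i₂ : M₂ →ₗ[k] M} {p₁ : M →ₗ[k] M₁} {p₂ : M →ₗ[k] M₂} (h₁ : ∀ u, p₁ (i₁ u) = u)
    (h₂ : ∀ u, p₂ (i₂ u) = u) (h : ∀ u, i₁ (p₁ u) + i₂ (p₂ u) = u) :
    Function.Bijective (i₁.coprod i₂) := by
  have h₁₂ : ∀ u, p₁ (i₂ u) = 0 := fun u => by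
    have h' := h (i₂ u)
    rw [h₂, add_eq_right] at h'
    rw [← h₁ (p₁ (i₂ u)), h', map_zero]
  have h₂₁ : ∀ u, p₂ (i₁ u) = 0 := fun u => by
    have h' := h (i₁ u)
    rw [h₁, add_eq_left] at h'
    rw [← h₂ (p₂ (i₁ u)), h', map_zero]
  refine Function.bijective_iff_has_inverse.2 ⟨p₁.prod p₂, fun u => ?_, fun u => ?_⟩
  · simp [LinearMap.coprod_apply, h₁, h₂, h₁₂, h₂₁]
  · simp [LinearMap.coprod_apply, h]

/-- By `u ⊗ v - φ u ⊗ ψ v = (u - φ u) ⊗ v + φ u ⊗ (v - ψ v)`, every tensor differs from its image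
under `φ ⊗ ψ` by an element of the sum. No flatness is involved. -/
theorem mem_tens_sup_of_map_eq_zero {M N : Type*} [AddCommGroup M] [Module k M] [AddCommGroup N]
    [Module k N] {P : Submodule k M} {Q : Submodule k N} {φ : M →ₗ[k] M} {ψ : N →ₗ[k] N}
    (hφ : ∀ u, u - φ u ∈ P) (hψ : ∀ v, v - ψ v ∈ Q) {t : M ⊗[k] N}
    (ht : TensorProduct.map φ ψ t = 0) : t ∈ tens P ⊤ ⊔ tens ⊤ Q := by
  suffices h : ∀ t : M ⊗[k] N, t - TensorProduct.map φ ψ t ∈ tens P ⊤ ⊔ tens ⊤ Q by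
    have := h t
    rwa [ht, sub_zero] at this
  intro t
  induction t using TensorProduct.induction_on with
  | zero => simp
  | tmul u v =>
    have h : u ⊗ₜ[k] v - TensorProduct.map φ ψ (u ⊗ₜ v) =
        (u - φ u) ⊗ₜ v + φ u ⊗ₜ (v - ψ v) := by
      rw [TensorProduct.map_tmul, TensorProduct.sub_tmul, TensorProduct.tmul_sub]
      abel
    rw [h]
    exact add_mem (Submodule.mem_sup_left (tmul_mem_tens (hφ u) trivial))
      (Submodule.mem_sup_right (tmul_mem_tens trivial (hψ v)))
  | add s t hs ht =>
    rw [map_add, add_sub_add_comm]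
    exact add_mem hs ht

/-- A section of `f` over its range, extended to all of `N`. The assumption that `k` is a field acts
only through this splitting. -/
theorem exists_quasi_inverse (hk : IsField k) {M N : Type*} [AddCommGroup M] [Module k M]
    [AddCommGroup N] [Module k N] (f : M →ₗ[k] N) : ∃ s : N →ₗ[k] M, ∀ u, f (s (f u)) = f u := by
  let := hk.toField
  obtain ⟨g, hg⟩ := LinearMap.exists_rightInverse_of_surjective f.rangeRestrict
    (LinearMap.range_rangeRestrict f)
  obtain ⟨s, hs⟩ := LinearMap.exists_extend g
  refine ⟨s, fun u => ?_⟩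
  have h₁ : s (f u) = g (f.rangeRestrict u) := LinearMap.congr_fun hs (f.rangeRestrict u)
  have h₂ := LinearMap.congr_fun hg (f.rangeRestrict u)
  rw [h₁]
  exact congrArg Subtype.val h₂

theorem map_map_assoc {M₁ M₂ M₃ N₁ N₂ N₃ : Type*} [AddCommGroup M₁] [Module k M₁]
    [AddCommGroup M₂] [Module k M₂] [AddCommGroup M₃] [Module k M₃] [AddCommGroup N₁] [Module k N₁]
    [AddCommGroup N₂] [Module k N₂] [AddCommGroup N₃] [Module k N₃] (f : M₁ →ₗ[k] N₁)
    (g : M₂ →ₗ[k] N₂) (h : M₃ →ₗ[k] N₃) (t : (M₁ ⊗[k] M₂) ⊗[k] M₃) :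
    TensorProduct.assoc k _ _ _ (TensorProduct.map (TensorProduct.map f g) h t) =
      TensorProduct.map f (TensorProduct.map g h) (TensorProduct.assoc k _ _ _ t) :=
  LinearMap.congr_fun (TensorProduct.map_map_comp_assoc_eq f g h).symm t

theorem map_comp_apply {M₁ M₂ N₁ N₂ L₁ L₂ : Type*} [AddCommGroup M₁] [Module k M₁]
    [AddCommGroup M₂] [Module k M₂] [AddCommGroup N₁] [Module k N₁] [AddCommGroup N₂] [Module k N₂]
    [AddCommGroup L₁] [Module k L₁] [AddCommGroup L₂] [Module k L₂] (f' : N₁ →ₗ[k] L₁)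
    (g' : N₂ →ₗ[k] L₂) (f : M₁ →ₗ[k] N₁) (g : M₂ →ₗ[k] N₂) (t : M₁ ⊗[k] M₂) :
    TensorProduct.map f' g' (TensorProduct.map f g t) =
      TensorProduct.map (f' ∘ₗ f) (g' ∘ₗ g) t := by
  rw [TensorProduct.map_comp, LinearMap.comp_apply]

theorem map_comm_apply {M N M' N' : Type*} [AddCommGroup M] [Module k M] [AddCommGroup N]
    [Module k N] [AddCommGroup M'] [Module k M'] [AddCommGroup N'] [Module k N'] (f : M →ₗ[k] M')
    (g : N →ₗ[k] N') (t : M ⊗[k] N) :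
    TensorProduct.map g f (TensorProduct.comm k _ _ t) =
      TensorProduct.comm k _ _ (TensorProduct.map f g t) := by
  induction t using TensorProduct.induction_on with
  | zero => simp
  | tmul u v => simp
  | add s t hs ht => simp only [map_add, hs, ht]

/-- A graded submodule that is a retract and that is stable under the coproducts of a
`+`-coZinbiel coalgebra is a `+`-coZinbiel coalgebra. -/
theorem IsPlusCoZinbiel.of_retract {C C' : ℕ → Type*} [∀ n, AddCommGroup (C n)]
    [∀ n, Module k (C n)] [∀ n, AddCommGroup (C' n)] [∀ n, Module k (C' n)]
    {Δ L R : ∀ n p q : ℕ, p + q = n → C n →ₗ[k] C p ⊗[k] C q} (h : IsPlusCoZinbiel k C Δ L R)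
    {Δ' L' R' : ∀ n p q : ℕ, p + q = n → C' n →ₗ[k] C' p ⊗[k] C' q} (i : ∀ n, C' n →ₗ[k] C n)
    (r : ∀ n, C n →ₗ[k] C' n) (hri : ∀ n c, r n (i n c) = c)
    (hΔ : ∀ n p q h c, TensorProduct.map (i p) (i q) (Δ' n p q h c) = Δ n p q h (i n c))
    (hL : ∀ n p q h c, TensorProduct.map (i p) (i q) (L' n p q h c) = L n p q h (i n c))
    (hR : ∀ n p q h c, TensorProduct.map (i p) (i q) (R' n p q h c) = R n p q h (i n c)) :
    IsPlusCoZinbiel k C' Δ' L' R' := by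
  have hri' : ∀ n, r n ∘ₗ i n = LinearMap.id := fun n => LinearMap.ext (hri n)
  -- The retraction keeps the inclusions injective after tensoring, so each axiom may be checked in
  -- the ambient coalgebra.
  have inj₂ : ∀ p q, Function.Injective (TensorProduct.map (i p) (i q)) := fun p q =>
    Function.LeftInverse.injective (g := TensorProduct.map (r p) (r q)) fun t => by
      rw [map_comp_apply, hri', hri', TensorProduct.map_id, LinearMap.id_apply]
  have inj₃ : ∀ p q s, Function.Injective
      (TensorProduct.map (i p) (TensorProduct.map (i q) (i s))) := fun p q s =>
    Function.LeftInverse.injective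
      (g := TensorProduct.map (r p) (TensorProduct.map (r q) (r s))) fun t => by
      rw [map_comp_apply, ← TensorProduct.map_comp, hri', hri', hri', TensorProduct.map_id,
        TensorProduct.map_id, LinearMap.id_apply]
  -- Coassociativity and the three dendriform axioms all have the shape `(Ψ₁ ⊗ 1) Ψ₂ = (1 ⊗ Ψ₃) Ψ₄`,
  -- and are transferred together.
  have key : ∀ (Ψ₁ Ψ₂ Ψ₃ Ψ₄ : ∀ n p q : ℕ, p + q = n → C n →ₗ[k] C p ⊗[k] C q)
      (Ψ₁' Ψ₂' Ψ₃' Ψ₄' : ∀ n p q : ℕ, p + q = n → C' n →ₗ[k] C' p ⊗[k] C' q),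
      (∀ n p q h c, TensorProduct.map (i p) (i q) (Ψ₁' n p q h c) = Ψ₁ n p q h (i n c)) →
      (∀ n p q h c, TensorProduct.map (i p) (i q) (Ψ₂' n p q h c) = Ψ₂ n p q h (i n c)) →
      (∀ n p q h c, TensorProduct.map (i p) (i q) (Ψ₃' n p q h c) = Ψ₃ n p q h (i n c)) →
      (∀ n p q h c, TensorProduct.map (i p) (i q) (Ψ₄' n p q h c) = Ψ₄ n p q h (i n c)) →
      ∀ n p q s a b (h₁ : p + q = a) (h₂ : a + s = n) (h₃ : q + s = b) (h₄ : p + b = n) (c : C' n),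
        TensorProduct.assoc k _ _ _ ((Ψ₁ a p q h₁).rTensor _ (Ψ₂ n a s h₂ (i n c))) =
          (Ψ₃ b q s h₃).lTensor _ (Ψ₄ n p b h₄ (i n c)) →
        TensorProduct.assoc k _ _ _ ((Ψ₁' a p q h₁).rTensor _ (Ψ₂' n a s h₂ c)) =
          (Ψ₃' b q s h₃).lTensor _ (Ψ₄' n p b h₄ c) := by
    intro Ψ₁ Ψ₂ Ψ₃ Ψ₄ Ψ₁' Ψ₂' Ψ₃' Ψ₄' H₁ H₂ H₃ H₄ n p q s a b h₁ h₂ h₃ h₄ c hc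
    have e₁ : TensorProduct.map (i p) (i q) ∘ₗ Ψ₁' a p q h₁ = Ψ₁ a p q h₁ ∘ₗ i a :=
      LinearMap.ext (H₁ a p q h₁)
    have e₃ : TensorProduct.map (i q) (i s) ∘ₗ Ψ₃' b q s h₃ = Ψ₃ b q s h₃ ∘ₗ i b :=
      LinearMap.ext (H₃ b q s h₃)
    apply inj₃
    rw [← map_map_assoc, LinearMap.rTensor, map_comp_apply, e₁, LinearMap.lTensor, map_comp_apply,
      e₃, LinearMap.comp_id, LinearMap.comp_id]
    rw [← H₂, ← H₄, LinearMap.rTensor, LinearMap.lTensor, map_comp_apply, map_comp_apply,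
      LinearMap.id_comp, LinearMap.id_comp] at hc
    exact hc
  constructor
  · intro n q e
    ext c
    apply inj₂
    rw [hL, h.left_zero]
    simp
  · intro n p e
    ext c
    apply inj₂
    rw [hR, h.right_zero]
    simp
  · intro n p q e hn
    ext c
    apply inj₂
    rw [LinearMap.add_apply, map_add, hΔ, hL, hR, h.sum n p q e hn, LinearMap.add_apply]
  · intro n p q s a b h₁ h₂ h₃ h₄ c
    exact key _ _ _ _ _ _ _ _ hΔ hΔ hΔ hΔ n p q s a b h₁ h₂ h₃ h₄ c (h.coassoc _ _ _ _ _ _ _ _ _ _ _)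
  · intro n p q s a b h₁ h₂ h₃ h₄ c
    exact key _ _ _ _ _ _ _ _ hL hL hΔ hL n p q s a b h₁ h₂ h₃ h₄ c (h.dendri₁ _ _ _ _ _ _ _ _ _ _ _)
  · intro n p q s a b h₁ h₂ h₃ h₄ c
    exact (key _ _ _ _ _ _ _ _ hΔ hR hR hR n p q s a b h₁ h₂ h₃ h₄ c
      (h.dendri₂ _ _ _ _ _ _ _ _ _ _ _).symm).symm
  · intro n p q s a b h₁ h₂ h₃ h₄ c
    exact (key _ _ _ _ _ _ _ _ hR hL hL hR n p q s a b h₁ h₂ h₃ h₄ c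
      (h.dendri₃ _ _ _ _ _ _ _ _ _ _ _).symm).symm
  · intro n p q e e' c
    apply inj₂
    rw [hR, map_smul, map_comm_apply, hL, h.flip n p q e e']

/-- A graded quotient inherits the structure of a `+`-Zinbiel algebra. -/
theorem IsPlusZinbiel.of_surjective {C C' : ℕ → Type*} [∀ n, AddCommGroup (C n)]
    [∀ n, Module k (C n)] [∀ n, AddCommGroup (C' n)] [∀ n, Module k (C' n)]
    {cup L R : ∀ p q n : ℕ, p + q = n → C p →ₗ[k] C q →ₗ[k] C n} (h : IsPlusZinbiel k C cup L R)
    {cup' L' R' : ∀ p q n : ℕ, p + q = n → C' p →ₗ[k] C' q →ₗ[k] C' n} (r : ∀ n, C n →ₗ[k] C' n)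
    (hr : ∀ n, Function.Surjective (r n))
    (hcup : ∀ p q n h a b, r n (cup p q n h a b) = cup' p q n h (r p a) (r q b))
    (hL : ∀ p q n h a b, r n (L p q n h a b) = L' p q n h (r p a) (r q b))
    (hR : ∀ p q n h a b, r n (R p q n h a b) = R' p q n h (r p a) (r q b)) :
    IsPlusZinbiel k C' cup' L' R' := by
  constructor
  · intro q n e
    ext a b
    obtain ⟨a, rfl⟩ := hr _ a
    obtain ⟨b, rfl⟩ := hr _ b
    rw [← hL, h.left_zero]
    simp
  · intro p n e
    ext a b
    obtain ⟨a, rfl⟩ := hr _ a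
    obtain ⟨b, rfl⟩ := hr _ b
    rw [← hR, h.right_zero]
    simp
  · intro p q n e hn
    ext a b
    obtain ⟨a, rfl⟩ := hr _ a
    obtain ⟨b, rfl⟩ := hr _ b
    rw [LinearMap.add_apply, LinearMap.add_apply, ← hcup, ← hL, ← hR, h.sum p q n e hn]
    simp
  · intro p q s a b n h₁ h₂ h₃ h₄ x y z
    obtain ⟨x, rfl⟩ := hr _ x
    obtain ⟨y, rfl⟩ := hr _ y
    obtain ⟨z, rfl⟩ := hr _ z
    rw [← hcup, ← hcup, ← hcup, ← hcup, h.assoc p q s a b n h₁ h₂ h₃ h₄]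
  · intro p q s a b n h₁ h₂ h₃ h₄ x y z
    obtain ⟨x, rfl⟩ := hr _ x
    obtain ⟨y, rfl⟩ := hr _ y
    obtain ⟨z, rfl⟩ := hr _ z
    rw [← hL, ← hL, ← hcup, ← hL, h.dendri₁ p q s a b n h₁ h₂ h₃ h₄]
  · intro p q s a b n h₁ h₂ h₃ h₄ x y z
    obtain ⟨x, rfl⟩ := hr _ x
    obtain ⟨y, rfl⟩ := hr _ y
    obtain ⟨z, rfl⟩ := hr _ z
    rw [← hR, ← hR, ← hcup, ← hR, h.dendri₂ p q s a b n h₁ h₂ h₃ h₄]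
  · intro p q s a b n h₁ h₂ h₃ h₄ x y z
    obtain ⟨x, rfl⟩ := hr _ x
    obtain ⟨y, rfl⟩ := hr _ y
    obtain ⟨z, rfl⟩ := hr _ z
    rw [← hL, ← hR, ← hR, ← hL, h.dendri₃ p q s a b n h₁ h₂ h₃ h₄]
  · intro p q n e e' a b
    obtain ⟨a, rfl⟩ := hr _ a
    obtain ⟨b, rfl⟩ := hr _ b
    rw [← hR, ← hL, ← map_smul, h.flip p q n e e']

end LinearAlgebra

/-! ### The decomposition of the homology of `B̄` -/

section HlgyDecomposition

variable {k : Type v} [CommRing k] {X : Type u} [Shelf X]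

theorem mem_cyc {S : Submodule k (Bbar k X)} {n : ℕ} {z : Bbar k X} :
    z ∈ cyc k S n ↔ dBar k X z = 0 ∧ z ∈ S ∧ z ∈ degBar k X n := by
  rw [cyc, Submodule.mem_inf, Submodule.mem_inf, LinearMap.mem_ker, and_assoc]

theorem hlgyIncl_mk {S : Submodule k (Bbar k X)} {n : ℕ} {z : Bbar k X} (hz : z ∈ cyc k S n)
    (hz' : z ∈ cyc k (⊤ : Submodule k (Bbar k X)) n) :
    hlgyIncl k S n (Submodule.Quotient.mk ⟨z, hz⟩) = Submodule.Quotient.mk ⟨z, hz'⟩ := rfl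

theorem exists_hlgy_rep {S : Submodule k (Bbar k X)} {n : ℕ} (c : Hlgy k S n) :
    ∃ (z : Bbar k X) (hz : z ∈ cyc k S n), c = Submodule.Quotient.mk ⟨z, hz⟩ := by
  obtain ⟨⟨z, hz⟩, rfl⟩ := Submodule.Quotient.mk_surjective _ c
  exact ⟨z, hz, rfl⟩

variable (k) in
/-- A projection of the complex `B̄` to a graded subcomplex. -/
structure IsChainProj (S : Submodule k (Bbar k X)) (Q : Bbar k X →ₗ[k] Bbar k X) : Prop where
  map_dBar : ∀ u, Q (dBar k X u) = dBar k X (Q u)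
  map_degBar : ∀ n, ∀ u ∈ degBar k X n, Q u ∈ degBar k X n
  mem : ∀ u, Q u ∈ S
  fix : ∀ u ∈ S, Q u = u

variable (k X) in
theorem isChainProj_normBar (hX : ∀ x : X, Shelf.act x x = x) :
    IsChainProj k (BbarN k X) (normBar k X) where
  map_dBar := normBar_dBar k hX
  map_degBar _ _ := normBar_mem_degBar
  mem := normBar_mem k
  fix _ := normBar_of_mem_BbarN k

variable (k X) in
theorem isChainProj_sub_normBar (hX : ∀ x : X, Shelf.act x x = x) :
    IsChainProj k (BbarD k X) (LinearMap.id - normBar k X) where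
  map_dBar u := by
    simp only [LinearMap.sub_apply, LinearMap.id_apply, map_sub, normBar_dBar k hX]
  map_degBar _ _ hu := sub_mem hu (normBar_mem_degBar hu)
  mem := sub_normBar_mem k
  fix u hu := by
    rw [LinearMap.sub_apply, normBar_of_mem_BbarD k hu, sub_zero, LinearMap.id_apply]

variable {S : Submodule k (Bbar k X)} {Q : Bbar k X →ₗ[k] Bbar k X}

theorem IsChainProj.mem_cyc (h : IsChainProj k S Q) {n : ℕ} {z : Bbar k X}
    (hz : z ∈ cyc k (⊤ : Submodule k (Bbar k X)) n) : Q z ∈ cyc k S n := by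
  rw [RackBialg.mem_cyc] at hz ⊢
  exact ⟨by rw [← h.map_dBar, hz.1, map_zero], h.mem z, h.map_degBar n z hz.2.2⟩

/-- The retraction in homology given by a projection to a graded subcomplex. -/
def hlgyProj (h : IsChainProj k S Q) (n : ℕ) :
    Hlgy k (⊤ : Submodule k (Bbar k X)) n →ₗ[k] Hlgy k S n :=
  Submodule.mapQ _ _ (Q.restrict fun _ hz => h.mem_cyc hz) (by
    rintro ⟨z, hz⟩ ⟨b, hb, hbz⟩
    exact ⟨Q b, ⟨h.mem b, h.map_degBar _ _ hb.2⟩, by rw [← h.map_dBar, hbz]; rfl⟩)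

theorem hlgyProj_mk (h : IsChainProj k S Q) {n : ℕ} {z : Bbar k X}
    (hz : z ∈ cyc k (⊤ : Submodule k (Bbar k X)) n) :
    hlgyProj h n (Submodule.Quotient.mk ⟨z, hz⟩) = Submodule.Quotient.mk ⟨Q z, h.mem_cyc hz⟩ := rfl

theorem cyc_le_top (S : Submodule k (Bbar k X)) (n : ℕ) :
    cyc k S n ≤ cyc k (⊤ : Submodule k (Bbar k X)) n :=
  inf_le_inf_right _ (inf_le_inf_left _ le_top)

theorem hlgyProj_hlgyIncl (h : IsChainProj k S Q) (n : ℕ) (c : Hlgy k S n) :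
    hlgyProj h n (hlgyIncl k S n c) = c := by
  obtain ⟨z, hz, rfl⟩ := exists_hlgy_rep c
  rw [hlgyIncl_mk hz (cyc_le_top S n hz), hlgyProj_mk h]
  congr 2
  exact h.fix z (mem_cyc.1 hz).2.1

variable (k) in
theorem hlgyIncl_add_hlgyIncl (hX : ∀ x : X, Shelf.act x x = x) (n : ℕ)
    (c : Hlgy k (⊤ : Submodule k (Bbar k X)) n) :
    hlgyIncl k (BbarN k X) n (hlgyProj (isChainProj_normBar k X hX) n c) +
      hlgyIncl k (BbarD k X) n (hlgyProj (isChainProj_sub_normBar k X hX) n c) = c := by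
  obtain ⟨z, hz, rfl⟩ := exists_hlgy_rep c
  rw [hlgyProj_mk, hlgyProj_mk,
    hlgyIncl_mk _ (cyc_le_top _ n ((isChainProj_normBar k X hX).mem_cyc hz)),
    hlgyIncl_mk _ (cyc_le_top _ n ((isChainProj_sub_normBar k X hX).mem_cyc hz)),
    ← Submodule.Quotient.mk_add]
  congr 1
  exact Subtype.ext (add_sub_cancel (normBar k X z) z)

variable (k) in
theorem bijective_hlgyIncl_coprod (hX : ∀ x : X, Shelf.act x x = x) (n : ℕ) : Function.Bijective
    ((hlgyIncl k (BbarN k X) n).coprod (hlgyIncl k (BbarD k X) n)) :=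
  bijective_coprod_of_retracts (hlgyProj_hlgyIncl (isChainProj_normBar k X hX) n)
    (hlgyProj_hlgyIncl (isChainProj_sub_normBar k X hX) n) (hlgyIncl_add_hlgyIncl k hX n)

end HlgyDecomposition

/-! ### Coproducts in homology over a field -/

section HlgyCoprod

variable {k : Type v} [CommRing k] {X : Type u} [Shelf X]

section Cycles

variable {M N : Type*} [AddCommGroup M] [Module k M] [AddCommGroup N] [Module k N]
  {t : Bbar k X ⊗[k] Bbar k X}

/-- On cycles of `B̄ ⊗ B̄`, a map that kills boundaries on the right factor only sees cycles in the
left factor. -/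
theorem map_eq_map_of_cycles_left (hk : IsField k) {φ φ' : Bbar k X →ₗ[k] M} {ψ : Bbar k X →ₗ[k] N}
    (h : ∀ u, dBar k X u = 0 → φ u = φ' u) (hψ : ∀ u, ψ (dBar k X u) = 0)
    (ht : dSq k X t = 0) : TensorProduct.map φ ψ t = TensorProduct.map φ' ψ t := by
  obtain ⟨s, hs⟩ := exists_quasi_inverse hk (dBar k X)
  -- The difference `φ - φ'` kills cycles, so it factors through `d` by means of the quasi-inverse
  -- `s`. As `t` is a cycle, `d` on the left factor can be traded for `d` on the right one, where
  -- `ψ` kills it.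
  have hφ : φ = φ' + ((φ - φ') ∘ₗ s) ∘ₗ dBar k X := by
    refine LinearMap.ext fun u => ?_
    have h' := h (u - s (dBar k X u)) (by rw [map_sub, hs, sub_self])
    rw [map_sub, map_sub] at h'
    simp only [LinearMap.add_apply, LinearMap.comp_apply, LinearMap.sub_apply]
    rw [sub_eq_iff_eq_add] at h'
    rw [h']
    abel
  have hd : TensorProduct.map (dBar k X) LinearMap.id t =
      - TensorProduct.map (sBar k X) (dBar k X) t := eq_neg_of_add_eq_zero_left ht
  have hψ' : ψ ∘ₗ dBar k X = 0 := LinearMap.ext hψ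
  have h₀ : TensorProduct.map (((φ - φ') ∘ₗ s) ∘ₗ dBar k X) ψ t = 0 := by
    have h₁ := congrArg (TensorProduct.map ((φ - φ') ∘ₗ s) ψ) hd
    rwa [map_neg, map_comp_apply, map_comp_apply, hψ', TensorProduct.map_zero_right,
      LinearMap.zero_apply, neg_zero, LinearMap.comp_id] at h₁
  rw [hφ, TensorProduct.map_add_left, LinearMap.add_apply, h₀, add_zero]

/-- The mirror image of the previous argument. Here `φ` is first composed with the sign
automorphism, to cancel the one that accompanies `d` on the right factor in `dSq`. -/
theorem map_eq_map_of_cycles_right (hk : IsField k) {φ : Bbar k X →ₗ[k] M} {ψ ψ' : Bbar k X →ₗ[k] N}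
    (h : ∀ u, dBar k X u = 0 → ψ u = ψ' u) (hφ : ∀ u, φ (dBar k X u) = 0)
    (ht : dSq k X t = 0) : TensorProduct.map φ ψ t = TensorProduct.map φ ψ' t := by
  obtain ⟨s, hs⟩ := exists_quasi_inverse hk (dBar k X)
  have hψ : ψ = ψ' + ((ψ - ψ') ∘ₗ s) ∘ₗ dBar k X := by
    refine LinearMap.ext fun u => ?_
    have h' := h (u - s (dBar k X u)) (by rw [map_sub, hs, sub_self])
    rw [map_sub, map_sub] at h'
    simp only [LinearMap.add_apply, LinearMap.comp_apply, LinearMap.sub_apply]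
    rw [sub_eq_iff_eq_add] at h'
    rw [h']
    abel
  have hd : TensorProduct.map (sBar k X) (dBar k X) t =
      - TensorProduct.map (dBar k X) LinearMap.id t := eq_neg_of_add_eq_zero_right ht
  have hφ' : (φ ∘ₗ sBar k X) ∘ₗ dBar k X = 0 := by
    refine LinearMap.ext fun u => ?_
    rw [LinearMap.comp_apply, LinearMap.comp_apply, sBar_dBar, map_neg, hφ, neg_zero,
      LinearMap.zero_apply]
  have hs' : (φ ∘ₗ sBar k X) ∘ₗ sBar k X = φ := by
    refine LinearMap.ext fun u => ?_
    simp
  have h₀ : TensorProduct.map φ (((ψ - ψ') ∘ₗ s) ∘ₗ dBar k X) t = 0 := by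
    have h₁ := congrArg (TensorProduct.map (φ ∘ₗ sBar k X) ((ψ - ψ') ∘ₗ s)) hd
    rwa [map_neg, map_comp_apply, map_comp_apply, hφ', hs', TensorProduct.map_zero_left,
      LinearMap.zero_apply, neg_zero] at h₁
  rw [hψ, TensorProduct.map_add_right, LinearMap.add_apply, h₀, add_zero]

end Cycles

theorem map_dSq_eq_zero {M N : Type*} [AddCommGroup M] [Module k M] [AddCommGroup N] [Module k N]
    {φ : Bbar k X →ₗ[k] M} {ψ : Bbar k X →ₗ[k] N} (hφ : ∀ u, φ (dBar k X u) = 0)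
    (hψ : ∀ u, ψ (dBar k X u) = 0) (t : Bbar k X ⊗[k] Bbar k X) :
    TensorProduct.map φ ψ (dSq k X t) = 0 := by
  have hφ' : φ ∘ₗ dBar k X = 0 := LinearMap.ext hφ
  have hψ' : ψ ∘ₗ dBar k X = 0 := LinearMap.ext hψ
  rw [dSq, LinearMap.add_apply, map_add, map_comp_apply, map_comp_apply, hφ', hψ',
    TensorProduct.map_zero_left, TensorProduct.map_zero_right, LinearMap.zero_apply, add_zero]

/-- Linear maps that agree on homogeneous cycles agree on cycles. -/
theorem eq_of_eq_on_cyc {M : Type*} [AddCommGroup M] [Module k M] {φ φ' : Bbar k X →ₗ[k] M}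
    (h : ∀ m, ∀ z ∈ cyc k (⊤ : Submodule k (Bbar k X)) m, φ z = φ' z) (u : Bbar k X)
    (hu : dBar k X u = 0) : φ u = φ' u := by
  obtain ⟨N, hN⟩ := exists_sum_prBar u
  rw [← hN N le_rfl, map_sum, map_sum]
  refine Finset.sum_congr rfl fun m _ => h m _ (mem_cyc.2 ⟨?_, trivial, prBar_mem m u⟩)
  cases m with
  | zero => exact dBar_of_mem_zero (prBar_mem 0 u)
  | succ m => rw [← prBar_dBar, hu, map_zero]

/-- Linear maps from `B̄` to its homology that send homogeneous cycles to their classes, and that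
kill the boundaries. -/
structure IsClassMap (r : ∀ n, Bbar k X →ₗ[k] Hlgy k (⊤ : Submodule k (Bbar k X)) n) : Prop where
  class_eq : ∀ n z (hz : z ∈ cyc k (⊤ : Submodule k (Bbar k X)) n),
    r n z = Submodule.Quotient.mk ⟨z, hz⟩
  map_dBar : ∀ n u, r n (dBar k X u) = 0
  of_ne : ∀ n m, m ≠ n → ∀ u ∈ degBar k X m, r n u = 0

/-- With `d s d = d`, the map `u ↦ u - s (d u)` projects to cycles. It is placed between two degree
projections because `s` need not be homogeneous; the outer one preserves cycles since `d` is graded.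
-/
theorem exists_projection_to_cycles (hk : IsField k) (n : ℕ) :
    ∃ c : Bbar k X →ₗ[k] Bbar k X, (∀ u, c u ∈ cyc k (⊤ : Submodule k (Bbar k X)) n) ∧
      (∀ u ∈ cyc k (⊤ : Submodule k (Bbar k X)) n, c u = u) ∧ ∀ u, c (prBar k X n u) = c u := by
  obtain ⟨s, hs⟩ := exists_quasi_inverse hk (dBar k X)
  refine ⟨prBar k X n ∘ₗ (LinearMap.id - s ∘ₗ dBar k X) ∘ₗ prBar k X n, fun u => ?_, fun z hz => ?_,
    fun u => ?_⟩
  · refine mem_cyc.2 ⟨?_, trivial, prBar_mem n _⟩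
    cases n with
    | zero => exact dBar_of_mem_zero (prBar_mem 0 _)
    | succ n =>
      have h : ∀ v, dBar k X (v - s (dBar k X v)) = 0 := fun v => by rw [map_sub, hs, sub_self]
      have e := prBar_dBar n (prBar k X (n + 1) u - s (dBar k X (prBar k X (n + 1) u)))
      rw [h, map_zero] at e
      exact e.symm
  · have h := mem_cyc.1 hz
    simp only [LinearMap.comp_apply, LinearMap.sub_apply, LinearMap.id_apply]
    rw [prBar_of_mem_same h.2.2, h.1, map_zero, sub_zero, prBar_of_mem_same h.2.2]
  · simp only [LinearMap.comp_apply]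
    rw [prBar_of_mem_same (prBar_mem n u)]

/-- Projecting to cycles extends the class map to all of `B̄`. Two extensions agree on cycles, and
by `map_eq_map_of_cycles_left` and its mirror image only those values matter in what follows. -/
theorem exists_isClassMap (hk : IsField k) :
    ∃ r : ∀ n, Bbar k X →ₗ[k] Hlgy k (⊤ : Submodule k (Bbar k X)) n, IsClassMap r := by
  choose c hc hfix hpr using exists_projection_to_cycles (X := X) hk
  refine ⟨fun n => Submodule.mkQ _ ∘ₗ (c n).codRestrict _ (hc n), ⟨?_, ?_, ?_⟩⟩
  · intro n z hz
    rw [LinearMap.comp_apply, Submodule.mkQ_apply]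
    congr 1
    exact Subtype.ext (hfix n z hz)
  · intro n u
    rw [LinearMap.comp_apply, Submodule.mkQ_apply, Submodule.Quotient.mk_eq_zero]
    refine ⟨prBar k X (n + 1) u, ⟨trivial, prBar_mem _ _⟩, ?_⟩
    rw [Submodule.subtype_apply, LinearMap.codRestrict_apply, ← hpr, prBar_dBar, hfix]
    exact mem_cyc.2 ⟨dBar_dBar k _, trivial, dBar_mem_degBar (prBar_mem _ _)⟩
  · intro n m hm u hu
    rw [LinearMap.comp_apply, Submodule.mkQ_apply]
    have h : (c n).codRestrict _ (hc n) u = 0 := by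
      refine Subtype.ext ?_
      rw [LinearMap.codRestrict_apply, ← hpr, prBar_of_mem_ne hu hm, map_zero]
      rfl
    rw [h, Submodule.Quotient.mk_zero]

variable {r : ∀ n, Bbar k X →ₗ[k] Hlgy k (⊤ : Submodule k (Bbar k X)) n}
  {Φ : Bbar k X →ₗ[k] Bbar k X ⊗[k] Bbar k X} {α β γ : k}

/-- The component `H_n → H_p ⊗ H_q` of the map in homology that is induced by a coproduct. -/
def hlgyCoprod (hr : IsClassMap r) (hΦ : IsCoprod k X Φ α β γ) (n p q : ℕ) :
    Hlgy k (⊤ : Submodule k (Bbar k X)) n →ₗ[k]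
      Hlgy k (⊤ : Submodule k (Bbar k X)) p ⊗[k] Hlgy k (⊤ : Submodule k (Bbar k X)) q :=
  Submodule.liftQ _ (TensorProduct.map (r p) (r q) ∘ₗ Φ ∘ₗ (cyc k ⊤ n).subtype) (by
    rintro ⟨z, hz⟩ ⟨b, -, h⟩
    change TensorProduct.map (r p) (r q) (Φ z) = 0
    change dBar k X b = z at h
    rw [← h, hΦ.dBar, map_dSq_eq_zero (hr.map_dBar p) (hr.map_dBar q)])

theorem hlgyCoprod_mk (hr : IsClassMap r) (hΦ : IsCoprod k X Φ α β γ) {n : ℕ} (p q : ℕ)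
    {z : Bbar k X} (hz : z ∈ cyc k (⊤ : Submodule k (Bbar k X)) n) :
    hlgyCoprod hr hΦ n p q (Submodule.Quotient.mk ⟨z, hz⟩) =
      TensorProduct.map (r p) (r q) (Φ z) := rfl

theorem IsCoprod.dSq_of_cyc (hΦ : IsCoprod k X Φ α β γ) {n : ℕ} {z : Bbar k X}
    {S : Submodule k (Bbar k X)} (hz : z ∈ cyc k S n) : dSq k X (Φ z) = 0 := by
  rw [← hΦ.dBar, (mem_cyc.1 hz).1, map_zero]

/-- On cycles of degree `n` this is the definition; in other degrees both sides vanish. Stated for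
all cycles, it has the form needed to substitute one coproduct into a tensor factor of another. -/
theorem hlgyCoprod_class (hr : IsClassMap r) (hΦ : IsCoprod k X Φ α β γ) {n p q : ℕ}
    (h : p + q = n) (u : Bbar k X) (hu : dBar k X u = 0) :
    (hlgyCoprod hr hΦ n p q ∘ₗ r n) u = (TensorProduct.map (r p) (r q) ∘ₗ Φ) u := by
  refine eq_of_eq_on_cyc (fun m z hz => ?_) u hu
  rw [LinearMap.comp_apply, LinearMap.comp_apply]
  by_cases hm : m = n
  · subst hm
    rw [hr.class_eq m z hz, hlgyCoprod_mk]
  · have hz' := (mem_cyc.1 hz).2.2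
    rw [hr.of_ne n m hm z hz', map_zero, map_eq_zero_of_mem_degSq (hr.of_ne p) (hr.of_ne q)
      (fun h' => hm (h'.symm.trans h)) (hΦ.mem_degSq hz')]

/-- Since `Φ₂ z` and `Φ₄ z` are cycles, the inner coproducts on classes may be replaced by those on
chains. The claim is then the chain identity `H` followed by three class maps. -/
theorem hlgyCoprod_coassoc (hk : IsField k) (hr : IsClassMap r)
    {Φ₁ Φ₂ Φ₃ Φ₄ : Bbar k X →ₗ[k] Bbar k X ⊗[k] Bbar k X}
    {α₁ β₁ γ₁ α₂ β₂ γ₂ α₃ β₃ γ₃ α₄ β₄ γ₄ : k}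
    (h₁ : IsCoprod k X Φ₁ α₁ β₁ γ₁) (h₂ : IsCoprod k X Φ₂ α₂ β₂ γ₂)
    (h₃ : IsCoprod k X Φ₃ α₃ β₃ γ₃) (h₄ : IsCoprod k X Φ₄ α₄ β₄ γ₄)
    (H : ∀ u, TensorProduct.assoc k _ _ _ (Φ₁.rTensor _ (Φ₂ u)) = Φ₃.lTensor _ (Φ₄ u))
    {n p q s a b : ℕ} (e₁ : p + q = a) (e₃ : q + s = b)
    (c : Hlgy k (⊤ : Submodule k (Bbar k X)) n) :
    TensorProduct.assoc k _ _ _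
        ((hlgyCoprod hr h₁ a p q).rTensor _ (hlgyCoprod hr h₂ n a s c)) =
      (hlgyCoprod hr h₃ b q s).lTensor _ (hlgyCoprod hr h₄ n p b c) := by
  obtain ⟨z, hz, rfl⟩ := exists_hlgy_rep c
  rw [hlgyCoprod_mk, hlgyCoprod_mk, LinearMap.rTensor, LinearMap.lTensor, map_comp_apply,
    map_comp_apply, LinearMap.id_comp, LinearMap.id_comp,
    map_eq_map_of_cycles_left hk (hlgyCoprod_class hr h₁ e₁) (hr.map_dBar s) (h₂.dSq_of_cyc hz),
    map_eq_map_of_cycles_right hk (hlgyCoprod_class hr h₃ e₃) (hr.map_dBar p) (h₄.dSq_of_cyc hz)]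
  have e := congrArg (TensorProduct.map (r p) (TensorProduct.map (r q) (r s))) (H z)
  rwa [← map_map_assoc, LinearMap.rTensor, LinearMap.lTensor, map_comp_apply, map_comp_apply,
    LinearMap.comp_id, LinearMap.comp_id] at e

/-- On cycles, `r p` followed by passage to `B̄ / im d` is the degree `p` component modulo
boundaries. The summands are thus the bidegree components of `Φ z`, and `Φ z` has total degree `n`.
-/
theorem inducedOnHlgy_hlgyCoprod (hk : IsField k) (hr : IsClassMap r)
    (hΦ : IsCoprod k X Φ α β γ) :
    InducedOnHlgy k X Φ fun n p q _ => hlgyCoprod hr hΦ n p q := by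
  intro n z hz
  set π := (LinearMap.range (dBar k X)).mkQ with hπ
  have hπd : ∀ u, π (dBar k X u) = 0 := fun u => by
    rw [hπ, Submodule.mkQ_apply, Submodule.Quotient.mk_eq_zero]
    exact ⟨u, rfl⟩
  have hj : ∀ p u, dBar k X u = 0 → (hlgyToCoker k X p ∘ₗ r p) u = (π ∘ₗ prBar k X p) u := by
    intro p u hu
    refine eq_of_eq_on_cyc (fun m z hz => ?_) u hu
    rw [LinearMap.comp_apply, LinearMap.comp_apply]
    have hz' := (mem_cyc.1 hz).2.2
    by_cases hm : m = p
    · subst hm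
      rw [hr.class_eq m z hz, prBar_of_mem_same hz']
      rfl
    · rw [hr.of_ne p m hm z hz', prBar_of_mem_ne hz' hm, map_zero, map_zero]
  have hjd : ∀ p u, (hlgyToCoker k X p ∘ₗ r p) (dBar k X u) = 0 := fun p u => by
    rw [LinearMap.comp_apply, hr.map_dBar, map_zero]
  have hpd : ∀ p u, (π ∘ₗ prBar k X p) (dBar k X u) = 0 := fun p u => by
    rw [LinearMap.comp_apply, prBar_dBar, hπd]
  have hterm : ∀ p q, TensorProduct.map (hlgyToCoker k X p) (hlgyToCoker k X q)
      (hlgyCoprod hr hΦ n p q (Submodule.Quotient.mk ⟨z, hz⟩)) =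
        TensorProduct.map (π ∘ₗ prBar k X p) (π ∘ₗ prBar k X q) (Φ z) := fun p q => by
    rw [hlgyCoprod_mk, map_comp_apply,
      map_eq_map_of_cycles_left hk (hj p) (hjd q) (hΦ.dSq_of_cyc hz),
      map_eq_map_of_cycles_right hk (hj q) (hpd p) (hΦ.dSq_of_cyc hz)]
  simp only [hterm]
  rw [Finset.sum_attach (Finset.HasAntidiagonal.antidiagonal n)
    (fun i => TensorProduct.map (π ∘ₗ prBar k X i.1) (π ∘ₗ prBar k X i.2) (Φ z))]
  have hs := hΦ.mem_degSq (mem_cyc.1 hz).2.2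
  generalize Φ z = t at hs ⊢
  induction hs using Submodule.span_induction with
  | mem t ht =>
    obtain ⟨p, q, u, v, rfl, hu, hv, rfl⟩ := ht
    rw [Finset.sum_eq_single (p, q)]
    · simp only [TensorProduct.map_tmul, LinearMap.comp_apply, prBar_of_mem_same hu,
        prBar_of_mem_same hv]
    · rintro ⟨p', q'⟩ h hne
      have h' : p ≠ p' := by
        rintro rfl
        have := Finset.HasAntidiagonal.mem_antidiagonal.1 h
        exact hne (by rw [Prod.mk.injEq]; simp only at this; omega)
      simp only [TensorProduct.map_tmul, LinearMap.comp_apply, prBar_of_mem_ne hu h', map_zero,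
        TensorProduct.zero_tmul]
    · intro h
      exact absurd (Finset.HasAntidiagonal.mem_antidiagonal.2 (rfl : (p, q).1 + (p, q).2 = p + q)) h
  | zero => simp
  | add s t _ _ hs ht => simp only [map_add, Finset.sum_add_distrib, hs, ht]
  | smul c t _ ht => simp only [map_smul, ← Finset.smul_sum, ht]

/-- A map that vanishes in positive degrees factors through the counit. -/
theorem eq_counitBar_smul {M : Type*} [AddCommGroup M] [Module k M] {φ : Bbar k X →ₗ[k] M}
    (hφ : ∀ m, m ≠ 0 → ∀ u ∈ degBar k X m, φ u = 0) (u : Bbar k X) :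
    φ u = counitBar k X u • φ (oneBar k X) := by
  suffices h : φ = (counitBar k X).smulRight (φ (oneBar k X)) from LinearMap.congr_fun h u
  refine bar_ext_wBar fun l => ?_
  rw [LinearMap.smulRight_apply]
  induction l using List.reverseRecOn with
  | nil => rw [wBar_nil, counitBar_one, one_smul]
  | append_singleton l x _ =>
    rw [hφ _ (by simp) _ (wBar_mem_degBar (l ++ [x])), wBar_concat, counitBar_rE, zero_smul]

/-- Components with a degree zero left factor are expressed through the counit, so
`IsCoprod.counit_rTensor` computes them. This gives the vanishing of the left half there, and later
the unit law for cochains. -/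
theorem map_eq_of_left_zero {M N : Type*} [AddCommGroup M] [Module k M] [AddCommGroup N]
    [Module k N] {φ : Bbar k X →ₗ[k] M} (ψ : Bbar k X →ₗ[k] N)
    (hφ : ∀ m, m ≠ 0 → ∀ u ∈ degBar k X m, φ u = 0) (t : Bbar k X ⊗[k] Bbar k X) :
    TensorProduct.map φ ψ t =
      φ (oneBar k X) ⊗ₜ ψ (TensorProduct.lid k _ ((counitBar k X).rTensor _ t)) := by
  induction t using TensorProduct.induction_on with
  | zero => simp
  | tmul u v =>
    rw [TensorProduct.map_tmul, eq_counitBar_smul hφ u, LinearMap.rTensor_tmul,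
      TensorProduct.lid_tmul, map_smul, TensorProduct.tmul_smul, TensorProduct.smul_tmul']
  | add s t hs ht => simp only [map_add, TensorProduct.tmul_add, hs, ht]

theorem map_eq_of_right_zero {M N : Type*} [AddCommGroup M] [Module k M] [AddCommGroup N]
    [Module k N] (φ : Bbar k X →ₗ[k] M) {ψ : Bbar k X →ₗ[k] N}
    (hψ : ∀ m, m ≠ 0 → ∀ u ∈ degBar k X m, ψ u = 0) (t : Bbar k X ⊗[k] Bbar k X) :
    TensorProduct.map φ ψ t =
      φ (TensorProduct.rid k _ ((counitBar k X).lTensor _ t)) ⊗ₜ ψ (oneBar k X) := by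
  induction t using TensorProduct.induction_on with
  | zero => simp
  | tmul u v =>
    rw [TensorProduct.map_tmul, eq_counitBar_smul hψ v, LinearMap.lTensor_tmul,
      TensorProduct.rid_tmul, map_smul, TensorProduct.tmul_smul, TensorProduct.smul_tmul']
  | add s t hs ht => simp only [map_add, TensorProduct.add_tmul, hs, ht]

theorem counitBar_of_mem {n : ℕ} (hn : n ≠ 0) {u : Bbar k X} (hu : u ∈ degBar k X n) :
    counitBar k X u = 0 := by
  obtain ⟨b, hb, rfl⟩ := hu
  rw [deg_eq_span] at hb
  induction hb using Submodule.span_induction with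
  | mem b hb =>
    obtain ⟨a, l, rfl, rfl⟩ := hb
    rw [toBar_gWord_mul]
    induction l using List.reverseRecOn with
    | nil => simp at hn
    | append_singleton l x _ => exact (congrArg _ (wBar_concat k l x)).trans (counitBar_rE k x _)
  | zero => simp
  | add u v _ _ hu hv => rw [map_add, map_add, hu, hv, add_zero]
  | smul c u _ hu => rw [map_smul, map_smul, hu, smul_zero]

variable (hr : IsClassMap r)

/-- The class maps are applied to the homotopy identity at a cycle: the boundary term is killed, the
term with `d z` is zero, and the signed flip becomes the plain flip up to `(-1) ^ (p q)`. -/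
theorem hlgyCoprod_flip (n p q : ℕ) (c : Hlgy k (⊤ : Submodule k (Bbar k X)) n) :
    hlgyCoprod hr (isCoprod_comulRightBar k X) n p q c = (-1 : k) ^ (p * q) •
      TensorProduct.comm k _ _ (hlgyCoprod hr (isCoprod_comulLeftBar k X) n q p c) := by
  obtain ⟨z, hz, rfl⟩ := exists_hlgy_rep c
  have h := congrArg (TensorProduct.map (r q) (r p)) (dSq_htpy k z)
  rw [(mem_cyc.1 hz).1, map_zero, add_zero, map_dSq_eq_zero (hr.map_dBar q) (hr.map_dBar p),
    map_sub, eq_comm, sub_eq_zero, map_swapBar k (hr.of_ne q) (hr.of_ne p)] at h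
  rw [hlgyCoprod_mk, hlgyCoprod_mk, h, map_smul, smul_smul, mul_comm q p, ← pow_add,
    (Even.add_self (p * q)).neg_one_pow, one_smul]
  generalize TensorProduct.map (r p) (r q) (comulRightBar k X z) = t
  exact ((TensorProduct.comm k _ _).symm_apply_apply t).symm

theorem isPlusCoZinbiel_hlgyCoprod (hk : IsField k) :
    IsPlusCoZinbiel k (Hlgy k (⊤ : Submodule k (Bbar k X)))
      (fun n p q _ => hlgyCoprod hr (isCoprod_comulBar k X) n p q)
      (fun n p q _ => hlgyCoprod hr (isCoprod_comulLeftBar k X) n p q)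
      (fun n p q _ => hlgyCoprod hr (isCoprod_comulRightBar k X) n p q) where
  left_zero n q _ := by
    refine LinearMap.ext fun c => ?_
    obtain ⟨z, hz, rfl⟩ := exists_hlgy_rep c
    rw [hlgyCoprod_mk, map_eq_of_left_zero _ (hr.of_ne 0),
      (isCoprod_comulLeftBar k X).counit_rTensor rfl, zero_smul, map_zero, TensorProduct.tmul_zero,
      LinearMap.zero_apply]
  right_zero n p _ := by
    refine LinearMap.ext fun c => ?_
    obtain ⟨z, hz, rfl⟩ := exists_hlgy_rep c
    rw [hlgyCoprod_mk, map_eq_of_right_zero _ (hr.of_ne 0),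
      (isCoprod_comulRightBar k X).counit_lTensor rfl, zero_smul, map_zero, TensorProduct.zero_tmul,
      LinearMap.zero_apply]
  sum n p q _ hn := by
    refine LinearMap.ext fun c => ?_
    obtain ⟨z, hz, rfl⟩ := exists_hlgy_rep c
    rw [LinearMap.add_apply, hlgyCoprod_mk, hlgyCoprod_mk, hlgyCoprod_mk, comulBar_eq_add,
      counitBar_of_mem (by omega) (mem_cyc.1 hz).2.2, zero_smul, add_zero, map_add]
  coassoc _ _ _ _ _ _ e₁ _ e₃ _ c := hlgyCoprod_coassoc hk hr _ _ _ _ (comulBar_coassoc k X) e₁ e₃ c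
  dendri₁ _ _ _ _ _ _ e₁ _ e₃ _ c := hlgyCoprod_coassoc hk hr _ _ _ _ (comulBar_dendri₁ k X) e₁ e₃ c
  dendri₂ _ _ _ _ _ _ e₁ _ e₃ _ c :=
    (hlgyCoprod_coassoc hk hr _ _ _ _ (comulBar_dendri₂ k X) e₁ e₃ c).symm
  dendri₃ _ _ _ _ _ _ e₁ _ e₃ _ c :=
    (hlgyCoprod_coassoc hk hr _ _ _ _ (comulBar_dendri₃ k X) e₁ e₃ c).symm
  flip n p q _ _ c := hlgyCoprod_flip hr n p q c

/-! ### The normalized and the degenerate part -/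

variable (hX : ∀ x : X, Shelf.act x x = x)

/-- The projection of the homology of `B̄` to the image of the homology of `B̄^N`. -/
def hlgyNorm (n : ℕ) : Hlgy k (⊤ : Submodule k (Bbar k X)) n →ₗ[k]
    Hlgy k (⊤ : Submodule k (Bbar k X)) n :=
  hlgyIncl k (BbarN k X) n ∘ₗ hlgyProj (isChainProj_normBar k X hX) n

theorem hlgyNorm_class (hr : IsClassMap r) (hX : ∀ x : X, Shelf.act x x = x) (n : ℕ) (u : Bbar k X) (hu : dBar k X u = 0) :
    (hlgyNorm hX n ∘ₗ r n) u = (r n ∘ₗ normBar k X) u := by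
  refine eq_of_eq_on_cyc (fun m z hz => ?_) u hu
  rw [LinearMap.comp_apply, LinearMap.comp_apply]
  have hz' := (mem_cyc.1 hz).2.2
  by_cases hm : m = n
  · subst hm
    have hP := (isChainProj_normBar k X hX).mem_cyc hz
    rw [hr.class_eq m z hz, hr.class_eq m _ (cyc_le_top _ m hP), hlgyNorm, LinearMap.comp_apply, hlgyProj_mk,
      hlgyIncl_mk]
  · rw [hr.of_ne n m hm z hz', map_zero, hr.of_ne n m hm _ (normBar_mem_degBar hz')]

theorem class_normBar_dBar (hr : IsClassMap r) (hX : ∀ x : X, Shelf.act x x = x) (n : ℕ) (u : Bbar k X) : (r n ∘ₗ normBar k X) (dBar k X u) = 0 := by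
  rw [LinearMap.comp_apply, normBar_dBar k hX, hr.map_dBar]

/-- It suffices that the normalizing projection in both factors gives zero. On cycles it can be
moved inside the class maps, one factor at a time, where the coideal property on chains applies. -/
theorem hlgyCoprod_mem_of_BbarD (hX : ∀ x : X, Shelf.act x x = x) (hk : IsField k) (n p q : ℕ) (c : Hlgy k (BbarD k X) n) :
    hlgyCoprod hr (isCoprod_comulBar k X) n p q (hlgyIncl k (BbarD k X) n c) ∈
      tens (LinearMap.range (hlgyIncl k (BbarD k X) p)) ⊤ ⊔
        tens ⊤ (LinearMap.range (hlgyIncl k (BbarD k X) q)) := by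
  have hsub : ∀ m c, c - hlgyNorm hX m c ∈ LinearMap.range (hlgyIncl k (BbarD k X) m) := by
    intro m c
    refine ⟨hlgyProj (isChainProj_sub_normBar k X hX) m c, ?_⟩
    rw [eq_sub_iff_add_eq, add_comm]
    exact hlgyIncl_add_hlgyIncl k hX m c
  refine mem_tens_sup_of_map_eq_zero (hsub p) (hsub q) ?_
  obtain ⟨z, hz, rfl⟩ := exists_hlgy_rep c
  have ht := (isCoprod_comulBar k X).dSq_of_cyc hz
  have hd : ∀ u, (hlgyNorm hX q ∘ₗ r q) (dBar k X u) = 0 := fun u => by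
    rw [LinearMap.comp_apply, hr.map_dBar, map_zero]
  rw [hlgyIncl_mk hz (cyc_le_top _ n hz), hlgyCoprod_mk, map_comp_apply,
    map_eq_map_of_cycles_left hk (hlgyNorm_class hr hX p) hd ht,
    map_eq_map_of_cycles_right hk (hlgyNorm_class hr hX q) (class_normBar_dBar hr hX p) ht,
    ← map_comp_apply, map_normBar_normBar_comulBar k hX (mem_cyc.1 hz).2.1, map_zero]

theorem map_id_hlgyNorm_hlgyCoprod (hk : IsField k) (hΦ : IsCoprod k X Φ α β γ)
    (hN : ∀ u ∈ BbarN k X, TensorProduct.map LinearMap.id (normBar k X) (Φ u) = Φ u) (n p q : ℕ)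
    (c : Hlgy k (BbarN k X) n) :
    TensorProduct.map LinearMap.id (hlgyNorm hX q)
        (hlgyCoprod hr hΦ n p q (hlgyIncl k (BbarN k X) n c)) =
      hlgyCoprod hr hΦ n p q (hlgyIncl k (BbarN k X) n c) := by
  obtain ⟨z, hz, rfl⟩ := exists_hlgy_rep c
  rw [hlgyIncl_mk hz (cyc_le_top _ n hz), hlgyCoprod_mk, map_comp_apply, LinearMap.id_comp,
    map_eq_map_of_cycles_right hk (hlgyNorm_class hr hX q) (hr.map_dBar p) (hΦ.dSq_of_cyc hz)]
  have h := congrArg (TensorProduct.map (r p) (r q)) (hN z (mem_cyc.1 hz).2.1)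
  rwa [map_comp_apply, LinearMap.comp_id] at h

theorem map_hlgyNorm_id_of_flip {p q : ℕ}
    {s : Hlgy k (⊤ : Submodule k (Bbar k X)) p ⊗[k] Hlgy k (⊤ : Submodule k (Bbar k X)) q}
    {t : Hlgy k (⊤ : Submodule k (Bbar k X)) q ⊗[k] Hlgy k (⊤ : Submodule k (Bbar k X)) p} {a : k}
    (h : s = a • TensorProduct.comm k _ _ t)
    (ht : TensorProduct.map LinearMap.id (hlgyNorm hX p) t = t) :
    TensorProduct.map (hlgyNorm hX p) LinearMap.id s = s := by
  rw [h, map_smul, map_comm_apply, ht]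

/-- The right factor is normalized because it is so on chains. The left factor is the right factor
of the right half, up to sign and flip, and this exchange is available only in homology. -/
theorem map_hlgyNorm_comulLeft (hk : IsField k) (n p q : ℕ) (c : Hlgy k (BbarN k X) n) :
    TensorProduct.map (hlgyNorm hX p) (hlgyNorm hX q)
        (hlgyCoprod hr (isCoprod_comulLeftBar k X) n p q (hlgyIncl k (BbarN k X) n c)) =
      hlgyCoprod hr (isCoprod_comulLeftBar k X) n p q (hlgyIncl k (BbarN k X) n c) := by
  have h₁ := map_id_hlgyNorm_hlgyCoprod hr hX hk (isCoprod_comulLeftBar k X)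
    (fun _ => map_normBar_comulLeftBar_of_mem k) n p q c
  have h₂ := map_id_hlgyNorm_hlgyCoprod hr hX hk (isCoprod_comulRightBar k X)
    (fun _ => map_normBar_comulRightBar_of_mem k) n q p c
  have hf : hlgyCoprod hr (isCoprod_comulLeftBar k X) n p q (hlgyIncl k (BbarN k X) n c) =
      (-1 : k) ^ (p * q) • TensorProduct.comm k _ _
        (hlgyCoprod hr (isCoprod_comulRightBar k X) n q p (hlgyIncl k (BbarN k X) n c)) := by
    rw [hlgyCoprod_flip, map_smul, smul_smul, mul_comm q p, ← pow_add,
      (Even.add_self (p * q)).neg_one_pow, one_smul]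
    exact ((TensorProduct.comm k _ _).symm_apply_apply _).symm
  have h₃ := map_hlgyNorm_id_of_flip hX hf h₂
  conv_rhs => rw [← h₃, ← h₁]
  rw [map_comp_apply, LinearMap.comp_id, LinearMap.id_comp]

theorem map_hlgyNorm_comulRight (hk : IsField k) (n p q : ℕ) (c : Hlgy k (BbarN k X) n) :
    TensorProduct.map (hlgyNorm hX p) (hlgyNorm hX q)
        (hlgyCoprod hr (isCoprod_comulRightBar k X) n p q (hlgyIncl k (BbarN k X) n c)) =
      hlgyCoprod hr (isCoprod_comulRightBar k X) n p q (hlgyIncl k (BbarN k X) n c) := by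
  rw [hlgyCoprod_flip, map_smul, map_comm_apply, map_hlgyNorm_comulLeft hr hX hk]

/-- The coproduct is the sum of its halves and a multiple of `1 ⊗ 1`, and `1` is normalized. -/
theorem map_hlgyNorm_comul (hk : IsField k) (n p q : ℕ) (c : Hlgy k (BbarN k X) n) :
    TensorProduct.map (hlgyNorm hX p) (hlgyNorm hX q)
        (hlgyCoprod hr (isCoprod_comulBar k X) n p q (hlgyIncl k (BbarN k X) n c)) =
      hlgyCoprod hr (isCoprod_comulBar k X) n p q (hlgyIncl k (BbarN k X) n c) := by
  have hone : ∀ m, hlgyNorm hX m (r m (oneBar k X)) = r m (oneBar k X) := fun m => by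
    have h := hlgyNorm_class hr hX m (oneBar k X) (dBar_one k)
    rw [LinearMap.comp_apply, LinearMap.comp_apply] at h
    rw [h, ← wBar_nil, normBar_wBar]
    rfl
  obtain ⟨a, h⟩ : ∃ a : k,
      hlgyCoprod hr (isCoprod_comulBar k X) n p q (hlgyIncl k (BbarN k X) n c) =
      hlgyCoprod hr (isCoprod_comulLeftBar k X) n p q (hlgyIncl k (BbarN k X) n c) +
      hlgyCoprod hr (isCoprod_comulRightBar k X) n p q (hlgyIncl k (BbarN k X) n c) +
      a • (r p (oneBar k X) ⊗ₜ r q (oneBar k X)) := by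
    obtain ⟨z, hz, rfl⟩ := exists_hlgy_rep c
    refine ⟨counitBar k X z, ?_⟩
    rw [hlgyIncl_mk hz (cyc_le_top _ n hz), hlgyCoprod_mk, hlgyCoprod_mk, hlgyCoprod_mk,
      comulBar_eq_add, map_add, map_add, map_smul, TensorProduct.map_tmul]
  rw [h, map_add, map_add, map_hlgyNorm_comulLeft hr hX hk, map_hlgyNorm_comulRight hr hX hk,
    map_smul, TensorProduct.map_tmul, hone, hone]

/-- The component of a coproduct on the homology of `B̄^N`. -/
def hlgyCoprodN (hΦ : IsCoprod k X Φ α β γ) (n p q : ℕ) : Hlgy k (BbarN k X) n →ₗ[k]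
    Hlgy k (BbarN k X) p ⊗[k] Hlgy k (BbarN k X) q :=
  TensorProduct.map (hlgyProj (isChainProj_normBar k X hX) p)
    (hlgyProj (isChainProj_normBar k X hX) q) ∘ₗ
      hlgyCoprod hr hΦ n p q ∘ₗ hlgyIncl k (BbarN k X) n

theorem map_hlgyIncl_hlgyCoprodN (hΦ : IsCoprod k X Φ α β γ) (n p q : ℕ)
    (c : Hlgy k (BbarN k X) n) :
    TensorProduct.map (hlgyIncl k (BbarN k X) p) (hlgyIncl k (BbarN k X) q)
        (hlgyCoprodN hr hX hΦ n p q c) =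
      TensorProduct.map (hlgyNorm hX p) (hlgyNorm hX q)
        (hlgyCoprod hr hΦ n p q (hlgyIncl k (BbarN k X) n c)) := by
  rw [hlgyCoprodN, LinearMap.comp_apply, LinearMap.comp_apply, map_comp_apply]
  rfl

variable (k X) in
theorem counitBar_of_mem_BbarD {u : Bbar k X} (hu : u ∈ BbarD k X) : counitBar k X u = 0 := by
  obtain ⟨b, hb, rfl⟩ := hu
  exact counit_of_mem_BD k hb

end HlgyCoprod

/-! ### Cochains and functionals on `B̄` -/

section Cochains

variable {k : Type v} [CommRing k] {X : Type u} [Shelf X]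

variable (k X) in
/-- The functional on `B̄` that corresponds to a cochain. -/
def evBar (n : ℕ) : Cochain k X n →ₗ[k] Bbar k X →ₗ[k] k where
  toFun f := Finsupp.linearCombination k
    (fun w : List X => if h : w.length = n then f fun i => w.get (i.cast h.symm) else 0) ∘ₗ
      wordsBar k X
  map_add' f f' := LinearMap.ext fun u => by
    obtain ⟨b, rfl⟩ := toBar_surjective k u
    exact LinearMap.congr_fun (ev_add f f') b
  map_smul' c f := LinearMap.ext fun u => by
    obtain ⟨b, rfl⟩ := toBar_surjective k u
    exact LinearMap.congr_fun (ev_smul c f) b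

theorem evBar_comp_toBar {n : ℕ} (f : Cochain k X n) : evBar k X n f ∘ₗ toBar k X = ev f := rfl

theorem evBar_wBar {n : ℕ} (f : Cochain k X n) (l : List X) :
    evBar k X n f (wBar k l) =
      if h : l.length = n then f fun i => l.get (i.cast h.symm) else 0 := ev_eWord f l

theorem evBar_ofFn {n : ℕ} (f : Cochain k X n) (x : Fin n → X) :
    evBar k X n f (wBar k (List.ofFn x)) = f x := by
  rw [evBar_wBar, dif_pos (List.length_ofFn)]
  congr 1
  funext i
  simp

theorem evBar_of_ne {n : ℕ} (f : Cochain k X n) (m : ℕ) (hm : m ≠ n) (u : Bbar k X)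
    (hu : u ∈ degBar k X m) : evBar k X n f u = 0 := by
  rw [degBar_eq_span] at hu
  induction hu using Submodule.span_induction with
  | mem u hu => obtain ⟨l, rfl, rfl⟩ := hu; rw [evBar_wBar, dif_neg hm]
  | zero => simp
  | add u v _ _ hu hv => rw [map_add, hu, hv, add_zero]
  | smul c u _ hu => rw [map_smul, hu, smul_zero]

/-- The cochain of degree `n` given by the values of a functional on words. -/
def cochain (n : ℕ) : (Bbar k X →ₗ[k] k) →ₗ[k] Cochain k X n where
  toFun φ x := φ (wBar k (List.ofFn x))
  map_add' _ _ := rfl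
  map_smul' _ _ := rfl

theorem cochain_apply {n : ℕ} (φ : Bbar k X →ₗ[k] k) (x : Fin n → X) :
    cochain n φ x = φ (wBar k (List.ofFn x)) := rfl

theorem cochain_evBar {n : ℕ} (f : Cochain k X n) : cochain n (evBar k X n f) = f :=
  funext fun x => evBar_ofFn f x

theorem wBar_ofFn_mem_degBar {n : ℕ} (x : Fin n → X) : wBar k (List.ofFn x) ∈ degBar k X n := by
  have h := wBar_mem_degBar (k := k) (List.ofFn x)
  rwa [List.length_ofFn] at h

theorem cochain_congr {n : ℕ} {φ ψ : Bbar k X →ₗ[k] k} (h : ∀ u ∈ degBar k X n, φ u = ψ u) :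
    cochain n φ = cochain n ψ := funext fun x => h _ (wBar_ofFn_mem_degBar x)

theorem evBar_cochain (n : ℕ) (φ : Bbar k X →ₗ[k] k) :
    evBar k X n (cochain n φ) = φ ∘ₗ prBar k X n := by
  refine bar_ext_wBar fun l => ?_
  rw [LinearMap.comp_apply, prBar_wBar]
  split_ifs with h
  · subst h
    have e := evBar_ofFn (cochain l.length φ) l.get
    rw [cochain_apply, List.ofFn_get] at e
    exact e
  · rw [map_zero, evBar_wBar, dif_neg h]

theorem evBar_cochain_of_ne {n : ℕ} {φ : Bbar k X →ₗ[k] k}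
    (hφ : ∀ m, m ≠ n → ∀ u ∈ degBar k X m, φ u = 0) : evBar k X n (cochain n φ) = φ := by
  rw [evBar_cochain]
  refine bar_ext_wBar fun l => ?_
  rw [LinearMap.comp_apply, prBar_wBar]
  split_ifs with h
  · rfl
  · rw [map_zero, hφ _ h _ (wBar_mem_degBar l)]

theorem rG_wBar (x : X) (l : List X) : rG k x (wBar k l) = wBar k (l.map fun y => up y x) := by
  rw [wBar, rG_toBar, eWord_mul_g, toBar_g_mul]
  rfl

theorem wBar_ofFn_castSucc {n : ℕ} (x : Fin (n + 1) → X) : wBar k (List.ofFn x) =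
    rE k (x (Fin.last n)) (wBar k (List.ofFn fun i => x i.castSucc)) := by
  rw [List.ofFn_succ', List.concat_eq_append, wBar_concat]

theorem face₀_last {X : Type*} {n : ℕ} (x : Fin (n + 1) → X) :
    face₀ (Fin.last n) x = fun i => x i.castSucc := by
  funext i
  simp [face₀]

theorem face₁_last {n : ℕ} (x : Fin (n + 1) → X) :
    face₁ (Fin.last n) x = fun i => up (x i.castSucc) (x (Fin.last n)) := by
  funext i
  rw [face₁, if_pos (Fin.castSucc_lt_last i)]

theorem wBar_face₀_castSucc {n : ℕ} (i : Fin (n + 1)) (x : Fin (n + 2) → X) :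
    wBar k (List.ofFn (face₀ i.castSucc x)) = rE k (x (Fin.last (n + 1)))
      (wBar k (List.ofFn (face₀ i fun j => x j.castSucc))) := by
  rw [wBar_ofFn_castSucc]
  congr 3
  · simp [face₀]
  · funext j
    simp only [face₀]
    rw [Fin.castSucc_succAbove_castSucc]

theorem wBar_face₁_castSucc {n : ℕ} (i : Fin (n + 1)) (x : Fin (n + 2) → X) :
    wBar k (List.ofFn (face₁ i.castSucc x)) = rE k (x (Fin.last (n + 1)))
      (wBar k (List.ofFn (face₁ i fun j => x j.castSucc))) := by
  rw [wBar_ofFn_castSucc]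
  congr 3
  · have h : ¬ (Fin.last n).castSucc < i.castSucc := by
      simp [Fin.le_last]
    rw [face₁, if_neg h, Fin.succ_last]

/-- The differential of `B̄` in terms of the faces of a word. -/
theorem dBar_wBar_ofFn {n : ℕ} (x : Fin (n + 1) → X) : dBar k X (wBar k (List.ofFn x)) =
    ∑ i : Fin (n + 1), (-1 : k) ^ (i : ℕ) •
      (wBar k (List.ofFn (face₀ i x)) - wBar k (List.ofFn (face₁ i x))) := by
  -- The last pair of faces comes from `d e_x = 1 - x` at the last letter; the other faces commute
  -- with appending that letter.
  have hlast : ∀ {n : ℕ} (x : Fin (n + 1) → X),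
      sBar k X (wBar k (List.ofFn fun i => x i.castSucc)) -
        rG k (x (Fin.last n)) (sBar k X (wBar k (List.ofFn fun i => x i.castSucc))) =
      (-1 : k) ^ n • (wBar k (List.ofFn (face₀ (Fin.last n) x)) -
        wBar k (List.ofFn (face₁ (Fin.last n) x))) := by
    intro n x
    rw [sBar_wBar, map_smul, rG_wBar, List.length_ofFn, smul_sub, face₀_last, face₁_last,
      List.map_ofFn]
    rfl
  induction n with
  | zero =>
    rw [wBar_ofFn_castSucc, dBar_rE, add_sub_assoc, hlast, Fin.sum_univ_castSucc]
    simp [wBar_nil]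
  | succ n ih =>
    rw [wBar_ofFn_castSucc, dBar_rE, add_sub_assoc, hlast, Fin.sum_univ_castSucc, ih, map_sum]
    congr 1
    refine Finset.sum_congr rfl fun i _ => ?_
    rw [map_smul, map_sub, wBar_face₀_castSucc, wBar_face₁_castSucc]
    rfl

theorem delta_cochain (n : ℕ) (φ : Bbar k X →ₗ[k] k) :
    delta k X n (cochain n φ) = cochain (n + 1) (φ ∘ₗ dBar k X) := by
  funext x
  rw [cochain_apply, LinearMap.comp_apply, dBar_wBar_ofFn, map_sum]
  simp only [map_smul, map_sub, smul_eq_mul]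
  rfl

theorem delta_eq {n : ℕ} (f : Cochain k X n) :
    delta k X n f = cochain (n + 1) (evBar k X n f ∘ₗ dBar k X) := by
  rw [← delta_cochain, cochain_evBar]

theorem evBar_delta {n : ℕ} (f : Cochain k X n) :
    evBar k X (n + 1) (delta k X n f) = evBar k X n f ∘ₗ dBar k X := by
  rw [delta_eq]
  refine evBar_cochain_of_ne fun m hm u hu => ?_
  rw [LinearMap.comp_apply]
  cases m with
  | zero => rw [dBar_of_mem_zero hu, map_zero]
  | succ m => exact evBar_of_ne f m (by omega) _ (dBar_mem_degBar hu)

theorem evBar_dBar_of_cocyc {n : ℕ} {f : Cochain k X n} {S : ∀ n, Submodule k (Cochain k X n)}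
    (hf : f ∈ cocyc k X S n) (u : Bbar k X) : evBar k X n f (dBar k X u) = 0 := by
  rw [← LinearMap.comp_apply, ← evBar_delta, LinearMap.mem_ker.1 hf.1, map_zero,
    LinearMap.zero_apply]

theorem cochain_comp_dBar_mem_cobdry (n : ℕ) (φ : Bbar k X →ₗ[k] k) :
    cochain n (φ ∘ₗ dBar k X) ∈ cobdry k X (fun _ => ⊤) n := by
  cases n with
  | zero =>
    refine (Submodule.mem_bot k).2 (funext fun x => ?_)
    rw [cochain_apply, LinearMap.comp_apply, dBar_of_mem_zero (wBar_ofFn_mem_degBar x), map_zero]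
    rfl
  | succ n => exact ⟨cochain n φ, trivial, delta_cochain n φ⟩

/-! ### Products of cochains -/

/-- The product of functionals that is dual to `Φ`. -/
def conv (Φ : Bbar k X →ₗ[k] Bbar k X ⊗[k] Bbar k X) (φ ψ : Bbar k X →ₗ[k] k) :
    Bbar k X →ₗ[k] k :=
  LinearMap.mul' k k ∘ₗ TensorProduct.map φ ψ ∘ₗ Φ

variable (Φ : Bbar k X →ₗ[k] Bbar k X ⊗[k] Bbar k X) {α β γ : k}

theorem conv_apply (φ ψ : Bbar k X →ₗ[k] k) (u : Bbar k X) :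
    conv Φ φ ψ u = LinearMap.mul' k k (TensorProduct.map φ ψ (Φ u)) := rfl

/-- The product of cochains that is dual to `Φ`. -/
def cochProd (p q n : ℕ) : Cochain k X p →ₗ[k] Cochain k X q →ₗ[k] Cochain k X n :=
  LinearMap.mk₂ k (fun f f' => (-1 : k) ^ (p * q) • cochain n (conv Φ (evBar k X p f) (evBar k X q f')))
    (fun f g h => by
      funext x
      simp only [Pi.add_apply, Pi.smul_apply, cochain_apply, conv_apply, map_add,
        TensorProduct.map_add_left, LinearMap.add_apply, smul_add])
    (fun c f h => by
      funext x
      simp only [Pi.smul_apply, cochain_apply, conv_apply, map_smul,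
        TensorProduct.map_smul_left, LinearMap.smul_apply]
      rw [smul_comm])
    (fun f g h => by
      funext x
      simp only [Pi.add_apply, Pi.smul_apply, cochain_apply, conv_apply, map_add,
        TensorProduct.map_add_right, LinearMap.add_apply, smul_add])
    (fun c f h => by
      funext x
      simp only [Pi.smul_apply, cochain_apply, conv_apply, map_smul,
        TensorProduct.map_smul_right, LinearMap.smul_apply]
      rw [smul_comm])

theorem cochProd_eq {p q : ℕ} (n : ℕ) (f : Cochain k X p) (f' : Cochain k X q) :
    cochProd Φ p q n f f' =
      (-1 : k) ^ (p * q) • cochain n (conv Φ (evBar k X p f) (evBar k X q f')) := rfl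

theorem dualProd_eq {Ψ : B k X →ₗ[k] B k X ⊗[k] B k X}
    (h : ∀ b, Φ (toBar k X b) = TensorProduct.map (toBar k X) (toBar k X) (Ψ b)) {p q : ℕ} (n : ℕ)
    (f : Cochain k X p) (f' : Cochain k X q) : dualProd Ψ f f' n = cochProd Φ p q n f f' := by
  funext x
  rw [cochProd_eq, Pi.smul_apply, cochain_apply, conv_apply, wBar, h, map_comp_apply,
    evBar_comp_toBar, evBar_comp_toBar, smul_eq_mul, dualProd]

variable {Φ}

theorem evBar_cochProd (hΦ : IsCoprod k X Φ α β γ) {p q n : ℕ} (h : p + q = n)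
    (f : Cochain k X p) (f' : Cochain k X q) : evBar k X n (cochProd Φ p q n f f') =
      (-1 : k) ^ (p * q) • conv Φ (evBar k X p f) (evBar k X q f') := by
  rw [cochProd_eq, map_smul, evBar_cochain_of_ne]
  intro m hm u hu
  rw [conv_apply, map_eq_zero_of_mem_degSq (evBar_of_ne f) (evBar_of_ne f')
    (fun h' => hm (h'.symm.trans h)) (hΦ.mem_degSq hu), map_zero]

theorem evBar_comp_sBar {n : ℕ} (f : Cochain k X n) :
    evBar k X n f ∘ₗ sBar k X = (-1 : k) ^ n • evBar k X n f := by
  refine bar_ext_wBar fun l => ?_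
  rw [LinearMap.comp_apply, sBar_wBar, LinearMap.smul_apply, map_smul]
  by_cases h : l.length = n
  · rw [h]
  · rw [evBar_wBar, dif_neg h, smul_zero, smul_zero]

/-- This is dual to `Φ` being a chain map. The sign sits on the first term because the Koszul factor
changes from `(-1) ^ (p q)` to `(-1) ^ ((p + 1) q)` there; in the second term the change by `(-1) ^
p` absorbs the sign from `dSq`. -/
theorem delta_cochProd (hΦ : IsCoprod k X Φ α β γ) {p q n : ℕ} (h : p + q = n)
    (f : Cochain k X p) (f' : Cochain k X q) : delta k X n (cochProd Φ p q n f f') =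
      (-1 : k) ^ q • cochProd Φ (p + 1) q (n + 1) (delta k X p f) f' +
        cochProd Φ p (q + 1) (n + 1) f (delta k X q f') := by
  rw [delta_eq, evBar_cochProd hΦ h, cochProd_eq, cochProd_eq, evBar_delta, evBar_delta, smul_smul]
  funext x
  simp only [Pi.add_apply, Pi.smul_apply, cochain_apply, conv_apply, LinearMap.comp_apply,
    LinearMap.smul_apply]
  rw [hΦ.dBar, dSq, LinearMap.add_apply, map_add, map_add, map_comp_apply, map_comp_apply,
    LinearMap.comp_id, evBar_comp_sBar, TensorProduct.map_smul_left, LinearMap.smul_apply, map_smul,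
    smul_add, smul_smul, ← pow_add, ← pow_add]
  congr 2
  exact neg_one_pow_eq_of_even k ⟨p * q + q, by ring⟩

end Cochains

/-! ### Products in rack cohomology -/

section CohProd

variable {k : Type v} [CommRing k] {X : Type u} [Shelf X]

theorem mem_cocyc {S : ∀ n, Submodule k (Cochain k X n)} {n : ℕ} {f : Cochain k X n} :
    f ∈ cocyc k X S n ↔ delta k X n f = 0 ∧ f ∈ S n := Iff.rfl

theorem exists_coh_rep {S : ∀ n, Submodule k (Cochain k X n)} {n : ℕ} (c : Coh k X S n) :
    ∃ (f : Cochain k X n) (hf : f ∈ cocyc k X S n), c = Submodule.Quotient.mk ⟨f, hf⟩ := by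
  obtain ⟨⟨f, hf⟩, rfl⟩ := Submodule.Quotient.mk_surjective _ c
  exact ⟨f, hf, rfl⟩

theorem cocyc_le_top (S : ∀ n, Submodule k (Cochain k X n)) (n : ℕ) :
    cocyc k X S n ≤ cocyc k X (fun _ => ⊤) n := inf_le_inf_left _ le_top

theorem cohIncl_mk {S : ∀ n, Submodule k (Cochain k X n)} {n : ℕ} {f : Cochain k X n}
    (hf : f ∈ cocyc k X S n) (hf' : f ∈ cocyc k X (fun _ => ⊤) n) :
    cohIncl k X S n (Submodule.Quotient.mk ⟨f, hf⟩) = Submodule.Quotient.mk ⟨f, hf'⟩ := rfl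

variable {Φ : Bbar k X →ₗ[k] Bbar k X ⊗[k] Bbar k X} {α β γ : k}

theorem cochProd_mem_cocyc (hΦ : IsCoprod k X Φ α β γ) {p q n : ℕ} (h : p + q = n)
    {f : Cochain k X p} {f' : Cochain k X q} (hf : f ∈ cocyc k X (fun _ => ⊤) p)
    (hf' : f' ∈ cocyc k X (fun _ => ⊤) q) :
    cochProd Φ p q n f f' ∈ cocyc k X (fun _ => ⊤) n := by
  refine mem_cocyc.2 ⟨?_, trivial⟩
  rw [delta_cochProd hΦ h, (mem_cocyc.1 hf).1, (mem_cocyc.1 hf').1, map_zero, map_zero,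
    LinearMap.zero_apply, smul_zero, add_zero]

theorem cochProd_mem_cobdry_left (hΦ : IsCoprod k X Φ α β γ) {p q n : ℕ} (h : p + q = n)
    {f : Cochain k X p} {f' : Cochain k X q} (hf : f ∈ cobdry k X (fun _ => ⊤) p)
    (hf' : f' ∈ cocyc k X (fun _ => ⊤) q) :
    cochProd Φ p q n f f' ∈ cobdry k X (fun _ => ⊤) n := by
  cases p with
  | zero =>
    rw [(Submodule.mem_bot k).1 hf, map_zero, LinearMap.zero_apply]
    exact zero_mem _
  | succ p =>
    obtain ⟨g, -, rfl⟩ := hf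
    obtain ⟨m, rfl⟩ : ∃ m, n = m + 1 := ⟨p + q, by omega⟩
    -- The factor undoes the sign in the Leibniz rule.
    refine ⟨(-1 : k) ^ q • cochProd Φ p q m g f', trivial, ?_⟩
    rw [map_smul, delta_cochProd hΦ (by omega), (mem_cocyc.1 hf').1, map_zero, add_zero, smul_smul,
      ← pow_add, (Even.add_self q).neg_one_pow, one_smul]

theorem cochProd_mem_cobdry_right (hΦ : IsCoprod k X Φ α β γ) {p q n : ℕ} (h : p + q = n)
    {f : Cochain k X p} {f' : Cochain k X q} (hf : f ∈ cocyc k X (fun _ => ⊤) p)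
    (hf' : f' ∈ cobdry k X (fun _ => ⊤) q) :
    cochProd Φ p q n f f' ∈ cobdry k X (fun _ => ⊤) n := by
  cases q with
  | zero =>
    rw [(Submodule.mem_bot k).1 hf', map_zero]
    exact zero_mem _
  | succ q =>
    obtain ⟨g, -, rfl⟩ := hf'
    obtain ⟨m, rfl⟩ : ∃ m, n = m + 1 := ⟨p + q, by omega⟩
    refine ⟨cochProd Φ p q m f g, trivial, ?_⟩
    rw [delta_cochProd hΦ (by omega), (mem_cocyc.1 hf).1, map_zero, LinearMap.zero_apply, smul_zero,
      zero_add]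

/-- The product of cocycles, with values in cohomology. -/
def cocycProd (hΦ : IsCoprod k X Φ α β γ) (p q n : ℕ) (h : p + q = n) :
    ↥(cocyc k X (fun _ => ⊤) p) →ₗ[k] ↥(cocyc k X (fun _ => ⊤) q) →ₗ[k] HR k X n :=
  LinearMap.mk₂ k
    (fun f f' => Submodule.Quotient.mk ⟨cochProd Φ p q n f f', cochProd_mem_cocyc hΦ h f.2 f'.2⟩)
    (fun f f' g => by
      rw [← Submodule.Quotient.mk_add]
      congr 1
      exact Subtype.ext (by simp))
    (fun c f g => by
      rw [← Submodule.Quotient.mk_smul]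
      congr 1
      exact Subtype.ext (by simp))
    (fun f g g' => by
      rw [← Submodule.Quotient.mk_add]
      congr 1
      exact Subtype.ext (by simp))
    (fun c f g => by
      rw [← Submodule.Quotient.mk_smul]
      congr 1
      exact Subtype.ext (by simp))

/-- The product in rack cohomology that is dual to `Φ`. -/
def cohProd (hΦ : IsCoprod k X Φ α β γ) (p q n : ℕ) (h : p + q = n) :
    HR k X p →ₗ[k] HR k X q →ₗ[k] HR k X n :=
  (Submodule.liftQ _ (Submodule.liftQ _ (cocycProd hΦ p q n h) (fun f hf => LinearMap.ext fun f' =>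
      (Submodule.Quotient.mk_eq_zero _).2 (cochProd_mem_cobdry_left hΦ h hf f'.2))).flip
    (fun f' hf' => LinearMap.ext fun c => by
      obtain ⟨f, hf, rfl⟩ := exists_coh_rep c
      exact (Submodule.Quotient.mk_eq_zero _).2 (cochProd_mem_cobdry_right hΦ h hf hf'))).flip

theorem cohProd_mk (hΦ : IsCoprod k X Φ α β γ) {p q n : ℕ} (h : p + q = n)
    {f : Cochain k X p} {f' : Cochain k X q} (hf : f ∈ cocyc k X (fun _ => ⊤) p)
    (hf' : f' ∈ cocyc k X (fun _ => ⊤) q) :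
    cohProd hΦ p q n h (Submodule.Quotient.mk ⟨f, hf⟩) (Submodule.Quotient.mk ⟨f', hf'⟩) =
      Submodule.Quotient.mk ⟨cochProd Φ p q n f f', cochProd_mem_cocyc hΦ h hf hf'⟩ := rfl

theorem inducedOnCoh_cohProd (hΦ : IsCoprod k X Φ α β γ) {Ψ : B k X →ₗ[k] B k X ⊗[k] B k X}
    (hΨ : ∀ b, Φ (toBar k X b) = TensorProduct.map (toBar k X) (toBar k X) (Ψ b)) :
    InducedOnCoh k X Ψ (cohProd hΦ) := by
  intro p q n h f f' hf hf'
  have e := dualProd_eq Φ hΨ n f f'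
  refine ⟨e ▸ cochProd_mem_cocyc hΦ h hf hf', ?_⟩
  rw [cohProd_mk]
  congr 1
  exact Subtype.ext e.symm

theorem mk_eq_mk_of_sub {n : ℕ} {f f' : Cochain k X n} (hf : f ∈ cocyc k X (fun _ => ⊤) n)
    (hf' : f' ∈ cocyc k X (fun _ => ⊤) n) (h : f - f' ∈ cobdry k X (fun _ => ⊤) n) :
    (Submodule.Quotient.mk ⟨f, hf⟩ : HR k X n) = Submodule.Quotient.mk ⟨f', hf'⟩ :=
  (Submodule.Quotient.eq _).2 h

theorem mul'_map_assoc {M₁ M₂ M₃ : Type*} [AddCommGroup M₁] [Module k M₁] [AddCommGroup M₂]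
    [Module k M₂] [AddCommGroup M₃] [Module k M₃] (φ₁ : M₁ →ₗ[k] k) (φ₂ : M₂ →ₗ[k] k)
    (φ₃ : M₃ →ₗ[k] k) (t : (M₁ ⊗[k] M₂) ⊗[k] M₃) :
    LinearMap.mul' k k (TensorProduct.map (LinearMap.mul' k k ∘ₗ TensorProduct.map φ₁ φ₂) φ₃ t) =
      LinearMap.mul' k k (TensorProduct.map φ₁ (LinearMap.mul' k k ∘ₗ TensorProduct.map φ₂ φ₃)
        (TensorProduct.assoc k _ _ _ t)) := by
  suffices h : LinearMap.mul' k k ∘ₗ TensorProduct.map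
      (LinearMap.mul' k k ∘ₗ TensorProduct.map φ₁ φ₂) φ₃ = LinearMap.mul' k k ∘ₗ
      TensorProduct.map φ₁ (LinearMap.mul' k k ∘ₗ TensorProduct.map φ₂ φ₃) ∘ₗ
        (TensorProduct.assoc k M₁ M₂ M₃).toLinearMap from LinearMap.congr_fun h t
  refine TensorProduct.ext_threefold fun x y z => ?_
  simp [mul_assoc]

/-- Dual to the chain identity `H`. The Koszul signs on both sides multiply to `(-1) ^ (p q + p r +
q r)`. -/
theorem cochProd_assoc {Φ₁ Φ₂ Φ₃ Φ₄ : Bbar k X →ₗ[k] Bbar k X ⊗[k] Bbar k X}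
    {α₁ β₁ γ₁ α₃ β₃ γ₃ : k} (h₁ : IsCoprod k X Φ₁ α₁ β₁ γ₁) (h₃ : IsCoprod k X Φ₃ α₃ β₃ γ₃)
    (H : ∀ u, TensorProduct.assoc k _ _ _ (Φ₁.rTensor _ (Φ₂ u)) = Φ₃.lTensor _ (Φ₄ u))
    {p q r s t : ℕ} (n : ℕ) (e₁ : p + q = s) (e₃ : q + r = t) (a : Cochain k X p)
    (b : Cochain k X q) (c : Cochain k X r) :
    cochProd Φ₂ s r n (cochProd Φ₁ p q s a b) c = cochProd Φ₄ p t n a (cochProd Φ₃ q r t b c) := by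
  rw [cochProd_eq, cochProd_eq Φ₄, evBar_cochProd h₁ e₁, evBar_cochProd h₃ e₃]
  funext x
  simp only [Pi.smul_apply, cochain_apply, conv_apply, TensorProduct.map_smul_left,
    TensorProduct.map_smul_right, LinearMap.smul_apply, map_smul, smul_smul, ← pow_add]
  have e : s * r + p * q = p * t + q * r := by
    subst e₁ e₃
    ring
  rw [e]
  congr 1
  generalize wBar k (List.ofFn x) = u
  have h := mul'_map_assoc (evBar k X p a) (evBar k X q b) (evBar k X r c) (Φ₁.rTensor _ (Φ₂ u))
  rw [H, LinearMap.rTensor, LinearMap.lTensor, map_comp_apply, map_comp_apply, LinearMap.comp_id,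
    LinearMap.comp_id] at h
  exact h

theorem cohProd_assoc {Φ₁ Φ₂ Φ₃ Φ₄ : Bbar k X →ₗ[k] Bbar k X ⊗[k] Bbar k X}
    {α₁ β₁ γ₁ α₂ β₂ γ₂ α₃ β₃ γ₃ α₄ β₄ γ₄ : k}
    (h₁ : IsCoprod k X Φ₁ α₁ β₁ γ₁) (h₂ : IsCoprod k X Φ₂ α₂ β₂ γ₂)
    (h₃ : IsCoprod k X Φ₃ α₃ β₃ γ₃) (h₄ : IsCoprod k X Φ₄ α₄ β₄ γ₄)
    (H : ∀ u, TensorProduct.assoc k _ _ _ (Φ₁.rTensor _ (Φ₂ u)) = Φ₃.lTensor _ (Φ₄ u))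
    {p q r s t n : ℕ} (e₁ : p + q = s) (e₂ : s + r = n) (e₃ : q + r = t) (e₄ : p + t = n)
    (a : HR k X p) (b : HR k X q) (c : HR k X r) :
    cohProd h₂ s r n e₂ (cohProd h₁ p q s e₁ a b) c =
      cohProd h₄ p t n e₄ a (cohProd h₃ q r t e₃ b c) := by
  obtain ⟨a, ha, rfl⟩ := exists_coh_rep a
  obtain ⟨b, hb, rfl⟩ := exists_coh_rep b
  obtain ⟨c, hc, rfl⟩ := exists_coh_rep c
  rw [cohProd_mk, cohProd_mk, cohProd_mk, cohProd_mk]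
  congr 1
  exact Subtype.ext (cochProd_assoc h₁ h₃ H n e₁ e₃ a b c)

theorem mul'_comm (t : k ⊗[k] k) :
    LinearMap.mul' k k (TensorProduct.comm k k k t) = LinearMap.mul' k k t := by
  induction t using TensorProduct.induction_on with
  | zero => simp
  | tmul a b => simp [mul_comm]
  | add s t hs ht => simp only [map_add, hs, ht]

theorem cohProd_flip {p q n : ℕ} (h : p + q = n) (h' : q + p = n) (a : HR k X p) (b : HR k X q) :
    cohProd (isCoprod_comulRightBar k X) p q n h a b =
      (-1 : k) ^ (p * q) • cohProd (isCoprod_comulLeftBar k X) q p n h' b a := by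
  obtain ⟨f, hf, rfl⟩ := exists_coh_rep a
  obtain ⟨f', hf', rfl⟩ := exists_coh_rep b
  rw [cohProd_mk, cohProd_mk, ← Submodule.Quotient.mk_smul]
  symm
  refine mk_eq_mk_of_sub (Submodule.smul_mem _ _
    (cochProd_mem_cocyc (isCoprod_comulLeftBar k X) h' hf' hf)) _ ?_
  -- The primitive is the homotopy paired with `f' ⊗ f`. In the homotopy identity the term `dSq
  -- (htpy u)` contributes nothing, because cocycles vanish on boundaries, so only `htpy (d u)` is
  -- left.
  convert cochain_comp_dBar_mem_cobdry n (LinearMap.mul' k k ∘ₗ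
    TensorProduct.map (evBar k X q f') (evBar k X p f) ∘ₗ htpy k X) using 1
  funext x
  simp only [Pi.sub_apply, Pi.smul_apply, cochain_apply, cochProd_eq, conv_apply,
    LinearMap.comp_apply, smul_smul]
  generalize wBar k (List.ofFn x) = u
  have e := congrArg (fun t => LinearMap.mul' k k
    (TensorProduct.map (evBar k X q f') (evBar k X p f) t)) (dSq_htpy k u)
  simp only [map_add, map_sub] at e
  rw [map_dSq_eq_zero (evBar_dBar_of_cocyc hf') (evBar_dBar_of_cocyc hf), map_zero, zero_add,
    map_swapBar k (evBar_of_ne f') (evBar_of_ne f), map_smul, mul'_comm] at e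
  rw [e, mul_comm q p, ← pow_add, (Even.add_self (p * q)).neg_one_pow, one_smul]

theorem cohProd_left_zero (q n : ℕ) (h : 0 + q = n) :
    cohProd (isCoprod_comulLeftBar k X) 0 q n h = 0 := by
  refine LinearMap.ext fun a => LinearMap.ext fun b => ?_
  obtain ⟨f, hf, rfl⟩ := exists_coh_rep a
  obtain ⟨f', hf', rfl⟩ := exists_coh_rep b
  rw [cohProd_mk, LinearMap.zero_apply, LinearMap.zero_apply, ← Submodule.Quotient.mk_zero]
  congr 1
  refine Subtype.ext (funext fun x => ?_)
  change cochProd _ 0 q n f f' x = 0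
  rw [cochProd_eq, Pi.smul_apply, cochain_apply, conv_apply, map_eq_of_left_zero _ (evBar_of_ne f),
    (isCoprod_comulLeftBar k X).counit_rTensor rfl, zero_smul, map_zero, TensorProduct.tmul_zero,
    map_zero, smul_zero]

theorem cohProd_right_zero (p n : ℕ) (h : p + 0 = n) :
    cohProd (isCoprod_comulRightBar k X) p 0 n h = 0 := by
  refine LinearMap.ext fun a => LinearMap.ext fun b => ?_
  obtain ⟨f, hf, rfl⟩ := exists_coh_rep a
  obtain ⟨f', hf', rfl⟩ := exists_coh_rep b
  rw [cohProd_mk, LinearMap.zero_apply, LinearMap.zero_apply, ← Submodule.Quotient.mk_zero]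
  congr 1
  refine Subtype.ext (funext fun x => ?_)
  change cochProd _ p 0 n f f' x = 0
  rw [cochProd_eq, Pi.smul_apply, cochain_apply, conv_apply, map_eq_of_right_zero _ (evBar_of_ne f'),
    (isCoprod_comulRightBar k X).counit_lTensor rfl, zero_smul, map_zero, TensorProduct.zero_tmul,
    map_zero, smul_zero]

theorem cochProd_comul {p q n : ℕ} (hn : 1 ≤ n) (f : Cochain k X p) (f' : Cochain k X q) :
    cochProd (comulBar k X) p q n f f' =
      cochProd (comulLeftBar k X) p q n f f' + cochProd (comulRightBar k X) p q n f f' := by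
  rw [cochProd_eq, cochProd_eq, cochProd_eq, ← smul_add, ← map_add]
  congr 1
  refine cochain_congr fun u hu => ?_
  rw [LinearMap.add_apply, conv_apply, conv_apply, conv_apply, comulBar_eq_add,
    counitBar_of_mem (by omega) hu, zero_smul, add_zero, map_add, map_add]

theorem cohProd_comul {p q n : ℕ} (h : p + q = n) (hn : 1 ≤ n) (a : HR k X p) (b : HR k X q) :
    cohProd (isCoprod_comulBar k X) p q n h a b = cohProd (isCoprod_comulLeftBar k X) p q n h a b +
      cohProd (isCoprod_comulRightBar k X) p q n h a b := by
  obtain ⟨f, hf, rfl⟩ := exists_coh_rep a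
  obtain ⟨f', hf', rfl⟩ := exists_coh_rep b
  rw [cohProd_mk, cohProd_mk, cohProd_mk, ← Submodule.Quotient.mk_add]
  congr 1
  exact Subtype.ext (cochProd_comul hn f f')

variable (k X) in
theorem isPlusZinbiel_cohProd : IsPlusZinbiel k (HR k X) (cohProd (isCoprod_comulBar k X))
    (cohProd (isCoprod_comulLeftBar k X)) (cohProd (isCoprod_comulRightBar k X)) where
  left_zero := cohProd_left_zero
  right_zero := cohProd_right_zero
  sum _ _ _ h hn := LinearMap.ext fun a => LinearMap.ext fun b => cohProd_comul h hn a b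
  assoc _ _ _ _ _ _ e₁ e₂ e₃ e₄ a b c :=
    cohProd_assoc _ _ _ _ (comulBar_coassoc k X) e₁ e₂ e₃ e₄ a b c
  dendri₁ _ _ _ _ _ _ e₁ e₂ e₃ e₄ a b c :=
    cohProd_assoc _ _ _ _ (comulBar_dendri₁ k X) e₁ e₂ e₃ e₄ a b c
  dendri₂ _ _ _ _ _ _ e₁ e₂ e₃ e₄ a b c :=
    (cohProd_assoc _ _ _ _ (comulBar_dendri₂ k X) e₁ e₂ e₃ e₄ a b c).symm
  dendri₃ _ _ _ _ _ _ e₁ e₂ e₃ e₄ a b c :=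
    (cohProd_assoc _ _ _ _ (comulBar_dendri₃ k X) e₁ e₂ e₃ e₄ a b c).symm
  flip _ _ _ h h' a b := cohProd_flip h h' a b

/-! ### The unit -/

variable (k X) in
/-- The unit cochain. -/
def unitCochain : Cochain k X 0 := cochain 0 (counitBar k X)

theorem unitCochain_mem_cocyc : unitCochain k X ∈ cocyc k X (CQ k X) 0 := by
  refine mem_cocyc.2 ⟨?_, fun _ i => i.elim0⟩
  rw [unitCochain, delta_cochain]
  funext x
  rw [cochain_apply, LinearMap.comp_apply, counitBar_dBar]
  rfl

theorem evBar_unitCochain_one : evBar k X 0 (unitCochain k X) (oneBar k X) = 1 := by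
  rw [unitCochain, evBar_cochain, LinearMap.comp_apply, prBar_of_mem_same oneBar_mem_degBar,
    counitBar_one]

/-- The unit cochain is the counit, and applying the counit to the left factor of `Δ` gives the
identity. -/
theorem unitCochain_cochProd {n : ℕ} (f : Cochain k X n) :
    cochProd (comulBar k X) 0 n n (unitCochain k X) f = f := by
  funext x
  rw [cochProd_eq, Pi.smul_apply, cochain_apply, conv_apply,
    map_eq_of_left_zero _ (evBar_of_ne (unitCochain k X)),
    (isCoprod_comulBar k X).counit_rTensor rfl, one_smul, evBar_unitCochain_one,
    LinearMap.mul'_apply, one_mul, zero_mul, pow_zero, one_smul, evBar_ofFn]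

theorem cochProd_unitCochain {n : ℕ} (f : Cochain k X n) :
    cochProd (comulBar k X) n 0 n f (unitCochain k X) = f := by
  funext x
  rw [cochProd_eq, Pi.smul_apply, cochain_apply, conv_apply,
    map_eq_of_right_zero _ (evBar_of_ne (unitCochain k X)),
    (isCoprod_comulBar k X).counit_lTensor rfl, one_smul, evBar_unitCochain_one,
    LinearMap.mul'_apply, mul_one, mul_zero, pow_zero, one_smul, evBar_ofFn]

end CohProd

/-! ### The decomposition of rack cohomology -/

section CohDecomposition

variable {k : Type v} [CommRing k] {X : Type u} [Shelf X]

variable (k) in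
/-- A projection of the complex of rack cochains to a graded subcomplex. -/
structure IsCochProj (S : ∀ n, Submodule k (Cochain k X n))
    (Q : ∀ n, Cochain k X n →ₗ[k] Cochain k X n) : Prop where
  map_delta : ∀ n f, Q (n + 1) (delta k X n f) = delta k X n (Q n f)
  mem : ∀ n f, Q n f ∈ S n
  fix : ∀ n, ∀ f ∈ S n, Q n f = f

variable {S : ∀ n, Submodule k (Cochain k X n)} {Q : ∀ n, Cochain k X n →ₗ[k] Cochain k X n}

theorem IsCochProj.mem_cocyc (h : IsCochProj k S Q) {n : ℕ} {f : Cochain k X n}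
    (hf : f ∈ cocyc k X (fun _ => ⊤) n) : Q n f ∈ cocyc k X S n :=
  RackBialg.mem_cocyc.2
    ⟨by rw [← h.map_delta, (RackBialg.mem_cocyc.1 hf).1, map_zero], h.mem n f⟩

/-- The retraction in cohomology given by a projection to a graded subcomplex. -/
def cohProj (h : IsCochProj k S Q) (n : ℕ) : HR k X n →ₗ[k] Coh k X S n :=
  Submodule.mapQ _ _ ((Q n).restrict fun _ hf => h.mem_cocyc hf) (by
    rintro ⟨f, hf⟩ hb
    change Q n f ∈ cobdry k X S n
    replace hb : f ∈ cobdry k X (fun _ => ⊤) n := hb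
    cases n with
    | zero =>
      rw [(Submodule.mem_bot k).1 hb, map_zero]
      exact zero_mem _
    | succ n =>
      obtain ⟨f', -, rfl⟩ := hb
      exact ⟨Q n f', h.mem n f', (h.map_delta n f').symm⟩)

theorem cohProj_mk (h : IsCochProj k S Q) {n : ℕ} {f : Cochain k X n}
    (hf : f ∈ cocyc k X (fun _ => ⊤) n) :
    cohProj h n (Submodule.Quotient.mk ⟨f, hf⟩) = Submodule.Quotient.mk ⟨Q n f, h.mem_cocyc hf⟩ :=
  rfl

theorem cohProj_cohIncl (h : IsCochProj k S Q) (n : ℕ) (c : Coh k X S n) :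
    cohProj h n (cohIncl k X S n c) = c := by
  obtain ⟨f, hf, rfl⟩ := exists_coh_rep c
  rw [cohIncl_mk hf (cocyc_le_top S n hf), cohProj_mk h]
  congr 1
  exact Subtype.ext (h.fix n f (mem_cocyc.1 hf).2)

variable (k X) in
/-- The projection of the rack cochains to the quandle cochains. -/
def normCoch (n : ℕ) : Cochain k X n →ₗ[k] Cochain k X n :=
  cochain n ∘ₗ (normBar k X).lcomp k k ∘ₗ evBar k X n

theorem normCoch_eq {n : ℕ} (f : Cochain k X n) :
    normCoch k X n f = cochain n (evBar k X n f ∘ₗ normBar k X) := rfl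

theorem evBar_normCoch {n : ℕ} (f : Cochain k X n) :
    evBar k X n (normCoch k X n f) = evBar k X n f ∘ₗ normBar k X := by
  rw [normCoch_eq]
  exact evBar_cochain_of_ne fun m hm u hu => evBar_of_ne f m hm _ (normBar_mem_degBar hu)

theorem normCoch_delta (hX : ∀ x : X, Shelf.act x x = x) {n : ℕ} (f : Cochain k X n) :
    normCoch k X (n + 1) (delta k X n f) = delta k X n (normCoch k X n f) := by
  rw [normCoch_eq, evBar_delta, delta_eq, evBar_normCoch, LinearMap.comp_assoc,
    LinearMap.comp_assoc]
  congr 2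
  exact LinearMap.ext fun u => (normBar_dBar k hX u).symm

theorem exists_ofFn_eq_append {X : Type*} {n : ℕ} (x : Fin n → X) {i j : Fin n}
    (h : (i : ℕ) + 1 = j) (hx : x i = x j) : ∃ l y l', List.ofFn x = l ++ y :: y :: l' := by
  have hj : (i : ℕ) + 1 < (List.ofFn x).length := by
    rw [List.length_ofFn, h]
    exact j.2
  refine ⟨(List.ofFn x).take i, x i, (List.ofFn x).drop (i + 2), ?_⟩
  have e₁ := List.drop_eq_getElem_cons (Nat.lt_of_succ_lt hj)
  have e₂ := List.drop_eq_getElem_cons hj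
  have h₁ : (List.ofFn x)[(i : ℕ)]'(Nat.lt_of_succ_lt hj) = x i := by simp
  have h₂ : (List.ofFn x)[(i : ℕ) + 1]'hj = x i := by simp [h, hx]
  rw [h₁] at e₁
  rw [h₂] at e₂
  conv_lhs => rw [← List.take_append_drop i (List.ofFn x), e₁, e₂]

theorem evBar_eq_zero_of_repSpan {n : ℕ} {f : Cochain k X n} (hf : f ∈ CQ k X n) {m : ℕ}
    {b : B k X} (hb : b ∈ repSpan k m) : evBar k X n f (toBar k X b) = 0 := by
  induction hb using Submodule.span_induction with
  | mem b h =>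
    obtain ⟨l, l', y, rfl, rfl⟩ := h
    change evBar k X n f (wBar k _) = 0
    rw [evBar_wBar]
    split_ifs with hn
    · refine hf _ ⟨l.length, by simp at hn; omega⟩ ⟨l.length + 1, by simp at hn; omega⟩ rfl ?_
      simp
    · rfl
  | zero => simp
  | add a b _ _ ha hb => rw [map_add, map_add, ha, hb, add_zero]
  | smul c b _ hb => rw [map_smul, map_smul, hb, smul_zero]

/-- A word differs from its normalization by a combination of words with equal neighbours, where `f`
vanishes. -/
theorem normCoch_of_mem_CQ {n : ℕ} {f : Cochain k X n} (hf : f ∈ CQ k X n) :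
    normCoch k X n f = f := by
  funext x
  have h := evBar_eq_zero_of_repSpan hf (eWord_sub_nWord_mem k (List.ofFn x))
  rw [map_sub, map_sub, sub_eq_zero, ← normBar_wBar] at h
  rw [normCoch_eq, cochain_apply, LinearMap.comp_apply, ← h]
  exact evBar_ofFn f x

/-- A word with equal neighbours represents an element of `B̄^D`, which the projection kills. -/
theorem normCoch_mem_CQ {n : ℕ} (f : Cochain k X n) : normCoch k X n f ∈ CQ k X n := by
  intro x i j h hx
  obtain ⟨l, y, l', e⟩ := exists_ofFn_eq_append x h hx
  have hD : wBar k (List.ofFn x) ∈ BbarD k X :=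
    ⟨_, repSpan_le_BD k _ (Submodule.subset_span ⟨l, l', y, rfl, rfl⟩), by rw [e, wBar]⟩
  rw [normCoch_eq, cochain_apply, LinearMap.comp_apply, normBar_of_mem_BbarD k hD, map_zero]

theorem mem_CD_iff {n : ℕ} {f : Cochain k X n} :
    f ∈ CD k X n ↔ ∀ u ∈ BbarN k X, evBar k X n f u = 0 := by
  constructor
  · rintro hf _ ⟨b, hb, rfl⟩
    exact hf b hb
  · intro h b hb
    exact h _ ⟨b, hb, rfl⟩

theorem normCoch_of_mem_CD {n : ℕ} {f : Cochain k X n} (hf : f ∈ CD k X n) :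
    normCoch k X n f = 0 := by
  funext x
  exact mem_CD_iff.1 hf _ (normBar_mem k _)

variable (k X) in
theorem isCochProj_normCoch (hX : ∀ x : X, Shelf.act x x = x) :
    IsCochProj k (CQ k X) (normCoch k X) where
  map_delta _ := normCoch_delta hX
  mem _ := normCoch_mem_CQ
  fix _ _ := normCoch_of_mem_CQ

variable (k X) in
theorem isCochProj_sub_normCoch (hX : ∀ x : X, Shelf.act x x = x) :
    IsCochProj k (CD k X) (fun n => LinearMap.id - normCoch k X n) where
  map_delta n f := by
    simp only [LinearMap.sub_apply, LinearMap.id_apply, map_sub, normCoch_delta hX]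
  mem n f := mem_CD_iff.2 fun u hu => by
    rw [LinearMap.sub_apply, LinearMap.id_apply, map_sub, LinearMap.sub_apply, evBar_normCoch,
      LinearMap.comp_apply, normBar_of_mem_BbarN k hu, sub_self]
  fix n f hf := by
    rw [LinearMap.sub_apply, normCoch_of_mem_CD hf, sub_zero, LinearMap.id_apply]

theorem cohIncl_add_cohIncl (hX : ∀ x : X, Shelf.act x x = x) (n : ℕ) (c : HR k X n) :
    cohIncl k X (CQ k X) n (cohProj (isCochProj_normCoch k X hX) n c) +
      cohIncl k X (CD k X) n (cohProj (isCochProj_sub_normCoch k X hX) n c) = c := by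
  obtain ⟨f, hf, rfl⟩ := exists_coh_rep c
  rw [cohProj_mk, cohProj_mk,
    cohIncl_mk _ (cocyc_le_top _ n ((isCochProj_normCoch k X hX).mem_cocyc hf)),
    cohIncl_mk _ (cocyc_le_top _ n ((isCochProj_sub_normCoch k X hX).mem_cocyc hf)),
    ← Submodule.Quotient.mk_add]
  congr 1
  exact Subtype.ext (add_sub_cancel (normCoch k X n f) f)

variable (k) in
theorem bijective_cohIncl_coprod (hX : ∀ x : X, Shelf.act x x = x) (n : ℕ) : Function.Bijective
    ((cohIncl k X (CQ k X) n).coprod (cohIncl k X (CD k X) n)) :=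
  bijective_coprod_of_retracts (cohProj_cohIncl (isCochProj_normCoch k X hX) n)
    (cohProj_cohIncl (isCochProj_sub_normCoch k X hX) n) (cohIncl_add_cohIncl hX n)

theorem ker_cohProj (hX : ∀ x : X, Shelf.act x x = x) (n : ℕ) :
    LinearMap.ker (cohProj (isCochProj_normCoch k X hX) n) =
      LinearMap.range (cohIncl k X (CD k X) n) := by
  refine le_antisymm (fun c hc => ?_) ?_
  · have h := cohIncl_add_cohIncl hX n c
    rw [LinearMap.mem_ker.1 hc, map_zero, zero_add] at h
    exact ⟨_, h⟩
  · rintro _ ⟨c, rfl⟩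
    obtain ⟨f, hf, rfl⟩ := exists_coh_rep c
    rw [LinearMap.mem_ker, cohIncl_mk hf (cocyc_le_top _ n hf), cohProj_mk,
      ← Submodule.Quotient.mk_zero]
    congr 1
    exact Subtype.ext (normCoch_of_mem_CD (mem_cocyc.1 hf).2)

/-! ### Compatibility of the products with the decomposition -/

theorem evBar_comp_normBar {n : ℕ} {f : Cochain k X n} (hf : f ∈ CQ k X n) :
    evBar k X n f ∘ₗ normBar k X = evBar k X n f := by
  rw [← evBar_normCoch, normCoch_of_mem_CQ hf]

theorem evBar_comp_normBar_of_mem_CD {n : ℕ} {f : Cochain k X n} (hf : f ∈ CD k X n) :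
    evBar k X n f ∘ₗ normBar k X = 0 := by
  rw [← evBar_normCoch, normCoch_of_mem_CD hf, map_zero]

/-- Quandle cochains are those unchanged by composition with the projection, so this is dual to
`B^D` being a coideal. -/
theorem cochProd_mem_CQ (hX : ∀ x : X, Shelf.act x x = x) {p q n : ℕ} (h : p + q = n)
    {f : Cochain k X p} {f' : Cochain k X q} (hf : f ∈ CQ k X p) (hf' : f' ∈ CQ k X q) :
    cochProd (comulBar k X) p q n f f' ∈ CQ k X n := by
  suffices e : normCoch k X n (cochProd (comulBar k X) p q n f f') =
      cochProd (comulBar k X) p q n f f' from e ▸ normCoch_mem_CQ _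
  rw [normCoch_eq, evBar_cochProd (isCoprod_comulBar k X) h, cochProd_eq, LinearMap.smul_comp,
    map_smul]
  congr 1
  refine cochain_congr fun u _ => ?_
  have e := congrArg (fun t => LinearMap.mul' k k (TensorProduct.map (evBar k X p f)
    (evBar k X q f') t)) (map_normBar_normBar_comulBar k hX (sub_normBar_mem k u))
  simp only [map_comp_apply, evBar_comp_normBar hf, evBar_comp_normBar hf', map_sub, map_zero] at e
  exact (sub_eq_zero.1 e).symm

/-- Dual to the inclusion of `Φ (B^N)` in `B ⊗ B^N`; for this reason the degenerate cochain has to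
be the right factor. -/
theorem cochProd_mem_CD {Φ : Bbar k X →ₗ[k] Bbar k X ⊗[k] Bbar k X} {α β γ : k}
    (hΦ : IsCoprod k X Φ α β γ)
    (hN : ∀ u ∈ BbarN k X, TensorProduct.map LinearMap.id (normBar k X) (Φ u) = Φ u) {p q n : ℕ}
    (h : p + q = n) (f : Cochain k X p) {f' : Cochain k X q} (hf' : f' ∈ CD k X q) :
    cochProd Φ p q n f f' ∈ CD k X n := by
  refine mem_CD_iff.2 fun u hu => ?_
  rw [evBar_cochProd hΦ h, LinearMap.smul_apply, conv_apply, ← hN u hu, map_comp_apply,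
    evBar_comp_normBar_of_mem_CD hf', TensorProduct.map_zero_right, LinearMap.zero_apply, map_zero,
    smul_zero]

theorem eq_zero_of_mem_CD_zero {f : Cochain k X 0} (hf : f ∈ CD k X 0) : f = 0 := by
  have hQ : f ∈ CQ k X 0 := fun _ i => i.elim0
  rw [← normCoch_of_mem_CQ hQ, normCoch_of_mem_CD hf]

theorem cohProd_mem_range_CQ (hX : ∀ x : X, Shelf.act x x = x) {p q n : ℕ} (h : p + q = n)
    (a : HQ k X p) (b : HQ k X q) : cohProd (isCoprod_comulBar k X) p q n h
      (cohIncl k X (CQ k X) p a) (cohIncl k X (CQ k X) q b) ∈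
        LinearMap.range (cohIncl k X (CQ k X) n) := by
  obtain ⟨f, hf, rfl⟩ := exists_coh_rep a
  obtain ⟨f', hf', rfl⟩ := exists_coh_rep b
  rw [cohIncl_mk hf (cocyc_le_top _ p hf), cohIncl_mk hf' (cocyc_le_top _ q hf'), cohProd_mk]
  exact ⟨Submodule.Quotient.mk ⟨_, mem_cocyc.2 ⟨(mem_cocyc.1 (cochProd_mem_cocyc (isCoprod_comulBar k X) h
    (cocyc_le_top _ p hf) (cocyc_le_top _ q hf'))).1,
      cochProd_mem_CQ hX h (mem_cocyc.1 hf).2 (mem_cocyc.1 hf').2⟩⟩, rfl⟩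

theorem cohProd_mem_range_CD {Φ : Bbar k X →ₗ[k] Bbar k X ⊗[k] Bbar k X} {α β γ : k}
    (hΦ : IsCoprod k X Φ α β γ)
    (hN : ∀ u ∈ BbarN k X, TensorProduct.map LinearMap.id (normBar k X) (Φ u) = Φ u) {p q n : ℕ}
    (h : p + q = n) (a : HR k X p) (b : HD k X q) :
    cohProd hΦ p q n h a (cohIncl k X (CD k X) q b) ∈ LinearMap.range (cohIncl k X (CD k X) n) := by
  obtain ⟨f, hf, rfl⟩ := exists_coh_rep a
  obtain ⟨f', hf', rfl⟩ := exists_coh_rep b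
  rw [cohIncl_mk hf' (cocyc_le_top _ q hf'), cohProd_mk]
  exact ⟨Submodule.Quotient.mk ⟨_, mem_cocyc.2 ⟨(mem_cocyc.1 (cochProd_mem_cocyc hΦ h hf
    (cocyc_le_top _ q hf'))).1, cochProd_mem_CD hΦ hN h f (mem_cocyc.1 hf').2⟩⟩, rfl⟩

theorem comul_mem_range_CD {p q n : ℕ} (h : p + q = n) (a : HR k X p) (b : HD k X q) :
    cohProd (isCoprod_comulBar k X) p q n h a (cohIncl k X (CD k X) q b) ∈
      LinearMap.range (cohIncl k X (CD k X) n) :=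
  cohProd_mem_range_CD _ (fun _ => map_normBar_comulBar_of_mem k) h a b

theorem comulLeft_mem_range_CD {p q n : ℕ} (h : p + q = n) (a : HR k X p) (b : HD k X q) :
    cohProd (isCoprod_comulLeftBar k X) p q n h a (cohIncl k X (CD k X) q b) ∈
      LinearMap.range (cohIncl k X (CD k X) n) :=
  cohProd_mem_range_CD _ (fun _ => map_normBar_comulLeftBar_of_mem k) h a b

theorem comulRight_mem_range_CD {p q n : ℕ} (h : p + q = n) (a : HR k X p) (b : HD k X q) :
    cohProd (isCoprod_comulRightBar k X) p q n h a (cohIncl k X (CD k X) q b) ∈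
      LinearMap.range (cohIncl k X (CD k X) n) :=
  cohProd_mem_range_CD _ (fun _ => map_normBar_comulRightBar_of_mem k) h a b

/-- A degenerate left factor is not covered on cochains. In cohomology the symmetry of the two
halves moves it to the right, at the price of exchanging `≻` and `≺`. -/
theorem comulRight_mem_range_CD' {p q n : ℕ} (h : p + q = n) (a : HD k X p) (b : HR k X q) :
    cohProd (isCoprod_comulRightBar k X) p q n h (cohIncl k X (CD k X) p a) b ∈
      LinearMap.range (cohIncl k X (CD k X) n) := by
  rw [cohProd_flip h ((add_comm q p).trans h)]
  exact Submodule.smul_mem _ _ (comulLeft_mem_range_CD _ b a)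

theorem comulLeft_mem_range_CD' {p q n : ℕ} (h : p + q = n) (a : HD k X p) (b : HR k X q) :
    cohProd (isCoprod_comulLeftBar k X) p q n h (cohIncl k X (CD k X) p a) b ∈
      LinearMap.range (cohIncl k X (CD k X) n) := by
  have e := cohProd_flip ((add_comm q p).trans h) h b (cohIncl k X (CD k X) p a)
  have e' : cohProd (isCoprod_comulLeftBar k X) p q n h (cohIncl k X (CD k X) p a) b =
      (-1 : k) ^ (q * p) • cohProd (isCoprod_comulRightBar k X) q p n ((add_comm q p).trans h) b
        (cohIncl k X (CD k X) p a) := by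
    rw [e, smul_smul, ← pow_add, (Even.add_self (q * p)).neg_one_pow, one_smul]
  rw [e']
  exact Submodule.smul_mem _ _ (comulRight_mem_range_CD _ b a)

theorem comul_mem_range_CD' {p q n : ℕ} (h : p + q = n) (a : HD k X p) (b : HR k X q) :
    cohProd (isCoprod_comulBar k X) p q n h (cohIncl k X (CD k X) p a) b ∈
      LinearMap.range (cohIncl k X (CD k X) n) := by
  rcases Nat.eq_zero_or_pos n with hn | hn
  -- The cup product is the sum of its halves only in positive degree; in degree zero the only
  -- degenerate cochain is zero.
  · obtain rfl : p = 0 := by omega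
    obtain ⟨f, hf, rfl⟩ := exists_coh_rep a
    have e : (⟨f, hf⟩ : ↥(cocyc k X (CD k X) 0)) = 0 :=
      Subtype.ext (eq_zero_of_mem_CD_zero (mem_cocyc.1 hf).2)
    rw [e, Submodule.Quotient.mk_zero, map_zero, map_zero, LinearMap.zero_apply]
    exact zero_mem _
  · rw [cohProd_comul h hn]
    exact add_mem (comulLeft_mem_range_CD' h a b) (comulRight_mem_range_CD' h a b)

end CohDecomposition

/-! ### Products on the quotient of rack cohomology by its degenerate part. -/

section Quotient

variable {k : Type v} [CommRing k] {X : Type u} [Shelf X]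

/-- The product on quandle cohomology, as a retract of rack cohomology. -/
def quandleProd (hX : ∀ x : X, Shelf.act x x = x)
    (m : ∀ p q n : ℕ, p + q = n → HR k X p →ₗ[k] HR k X q →ₗ[k] HR k X n) (p q n : ℕ)
    (h : p + q = n) : HQ k X p →ₗ[k] HQ k X q →ₗ[k] HQ k X n :=
  ((m p q n h).compl₁₂ (cohIncl k X (CQ k X) p) (cohIncl k X (CQ k X) q)).compr₂
    (cohProj (isCochProj_normCoch k X hX) n)

theorem quandleProd_apply (hX : ∀ x : X, Shelf.act x x = x)
    (m : ∀ p q n : ℕ, p + q = n → HR k X p →ₗ[k] HR k X q →ₗ[k] HR k X n) (p q n : ℕ)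
    (h : p + q = n) (a : HQ k X p) (b : HQ k X q) : quandleProd hX m p q n h a b =
      cohProj (isCochProj_normCoch k X hX) n
        (m p q n h (cohIncl k X (CQ k X) p a) (cohIncl k X (CQ k X) q b)) := rfl

/-- If `H_D` is an ideal for a product on `H_R`, then the product passes to the quotient `H_Q`. -/
theorem cohProj_prod (hX : ∀ x : X, Shelf.act x x = x)
    {m : ∀ p q n : ℕ, p + q = n → HR k X p →ₗ[k] HR k X q →ₗ[k] HR k X n}
    (hl : ∀ {p q n : ℕ} (h : p + q = n) (a : HD k X p) (b : HR k X q),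
      m p q n h (cohIncl k X (CD k X) p a) b ∈ LinearMap.range (cohIncl k X (CD k X) n))
    (hr : ∀ {p q n : ℕ} (h : p + q = n) (a : HR k X p) (b : HD k X q),
      m p q n h a (cohIncl k X (CD k X) q b) ∈ LinearMap.range (cohIncl k X (CD k X) n))
    (p q n : ℕ) (h : p + q = n) (a : HR k X p) (b : HR k X q) :
    cohProj (isCochProj_normCoch k X hX) n (m p q n h a b) = quandleProd hX m p q n h
      (cohProj (isCochProj_normCoch k X hX) p a) (cohProj (isCochProj_normCoch k X hX) q b) := by
  rw [quandleProd_apply]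
  have hl' : ∀ c b, cohProj (isCochProj_normCoch k X hX) n
      (m p q n h (cohIncl k X (CD k X) p c) b) = 0 := fun c b => by
    rw [← LinearMap.mem_ker, ker_cohProj hX]
    exact hl h c b
  have hr' : ∀ a c, cohProj (isCochProj_normCoch k X hX) n
      (m p q n h a (cohIncl k X (CD k X) q c)) = 0 := fun a c => by
    rw [← LinearMap.mem_ker, ker_cohProj hX]
    exact hr h a c
  -- Each argument is split into its quandle and degenerate components; the degenerate ones
  -- contribute to the kernel of the projection.
  conv_lhs => rw [← cohIncl_add_cohIncl hX p a, map_add, LinearMap.add_apply, map_add, hl',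
    add_zero, ← cohIncl_add_cohIncl hX q b, map_add, map_add, hr', add_zero]

end Quotient

end RackBialg

end

open RackBialg in
theorem mainTheorem3 (k : Type*) [CommRing k] (X : Type*) [Shelf X]
    (hX : ∀ x : X, Shelf.act x x = x) :
    -- the decomposition of the d.g. bialgebra `B(X, k)`
    (IsCompl (BN k X) (BD k X) ∧ IsDGSubbimodule k X (BN k X) ∧ IsDGSubbimodule k X (BD k X) ∧
      (∀ b ∈ BD k X, comul k b ∈ tens (BD k X) ⊤ ⊔ tens ⊤ (BD k X)) ∧
      (∀ b ∈ BD k X, counit k b = 0) ∧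
      (∀ b ∈ BN k X, comul k b ∈ tens ⊤ (BN k X)) ∧
      (∀ b ∈ BN k X, comulLeft k b ∈ tens ⊤ (BN k X)) ∧
      (∀ b ∈ BN k X, comulRight k b ∈ tens ⊤ (BN k X))) ∧
    -- the decomposition of the homology of `B̄(X, k)`
    (∀ n, Function.Bijective
      ((hlgyIncl k (BbarN k X) n).coprod (hlgyIncl k (BbarD k X) n))) ∧
    -- the coalgebra structures in homology over a field
    (IsField k → ∃ Δ L R : ∀ n p q : ℕ, p + q = n →
      Hlgy k (⊤ : Submodule k (Bbar k X)) n →ₗ[k]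
        Hlgy k (⊤ : Submodule k (Bbar k X)) p ⊗[k] Hlgy k (⊤ : Submodule k (Bbar k X)) q,
      InducedOnHlgy k X (comulBar k X) Δ ∧ InducedOnHlgy k X (comulLeftBar k X) L ∧
      InducedOnHlgy k X (comulRightBar k X) R ∧
      IsPlusCoZinbiel k (Hlgy k (⊤ : Submodule k (Bbar k X))) Δ L R ∧
      -- the degenerate part is a coideal
      (∀ n p q (h : p + q = n) (c : Hlgy k (BbarD k X) n),
        Δ n p q h (hlgyIncl k (BbarD k X) n c) ∈
          tens (LinearMap.range (hlgyIncl k (BbarD k X) p)) ⊤ ⊔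
            tens ⊤ (LinearMap.range (hlgyIncl k (BbarD k X) q))) ∧
      (∀ n, ∀ z ∈ cyc k (BbarD k X) n, counitBar k X z = 0) ∧
      -- the normalized part is a coZinbiel coalgebra
      ∃ ΔN LN RN : ∀ n p q : ℕ, p + q = n →
        Hlgy k (BbarN k X) n →ₗ[k] Hlgy k (BbarN k X) p ⊗[k] Hlgy k (BbarN k X) q,
        (∀ n p q (h : p + q = n) (c : Hlgy k (BbarN k X) n),
          TensorProduct.map (hlgyIncl k (BbarN k X) p) (hlgyIncl k (BbarN k X) q) (ΔN n p q h c) =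
            Δ n p q h (hlgyIncl k (BbarN k X) n c) ∧
          TensorProduct.map (hlgyIncl k (BbarN k X) p) (hlgyIncl k (BbarN k X) q) (LN n p q h c) =
            L n p q h (hlgyIncl k (BbarN k X) n c) ∧
          TensorProduct.map (hlgyIncl k (BbarN k X) p) (hlgyIncl k (BbarN k X) q) (RN n p q h c) =
            R n p q h (hlgyIncl k (BbarN k X) n c)) ∧
        IsPlusCoZinbiel k (Hlgy k (BbarN k X)) ΔN LN RN) ∧
    -- the decomposition of rack cohomology
    (∀ n, Function.Bijective ((cohIncl k X (CQ k X) n).coprod (cohIncl k X (CD k X) n))) ∧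
    -- the algebra structures in cohomology
    ∃ cup L R : ∀ p q n : ℕ, p + q = n → HR k X p →ₗ[k] HR k X q →ₗ[k] HR k X n,
      InducedOnCoh k X (comul k) cup ∧ InducedOnCoh k X (comulLeft k) L ∧
      InducedOnCoh k X (comulRight k) R ∧
      IsPlusZinbiel k (HR k X) cup L R ∧
      -- quandle cohomology is a unital associative subalgebra
      (∃ u : HQ k X 0, ∀ n (a : HR k X n),
        cup 0 n n (zero_add n) (cohIncl k X (CQ k X) 0 u) a = a ∧
        cup n 0 n (add_zero n) a (cohIncl k X (CQ k X) 0 u) = a) ∧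
      (∀ p q n (h : p + q = n) (a : HQ k X p) (b : HQ k X q),
        cup p q n h (cohIncl k X (CQ k X) p a) (cohIncl k X (CQ k X) q b) ∈
          LinearMap.range (cohIncl k X (CQ k X) n)) ∧
      -- the degenerate part is an ideal for the cup product and for the Zinbiel product
      (∀ p q n (h : p + q = n) (a : HD k X p) (b : HR k X q),
        cup p q n h (cohIncl k X (CD k X) p a) b ∈ LinearMap.range (cohIncl k X (CD k X) n) ∧
        L p q n h (cohIncl k X (CD k X) p a) b ∈ LinearMap.range (cohIncl k X (CD k X) n)) ∧
      (∀ p q n (h : p + q = n) (a : HR k X p) (b : HD k X q),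
        cup p q n h a (cohIncl k X (CD k X) q b) ∈ LinearMap.range (cohIncl k X (CD k X) n) ∧
        L p q n h a (cohIncl k X (CD k X) q b) ∈ LinearMap.range (cohIncl k X (CD k X) n)) ∧
      -- quandle cohomology, as the quotient by the degenerate part, inherits a Zinbiel product
      ∃ (π : ∀ n, HR k X n →ₗ[k] HQ k X n)
        (cupQ LQ RQ : ∀ p q n : ℕ, p + q = n → HQ k X p →ₗ[k] HQ k X q →ₗ[k] HQ k X n),
        (∀ n (a : HQ k X n), π n (cohIncl k X (CQ k X) n a) = a) ∧
        (∀ n, LinearMap.ker (π n) = LinearMap.range (cohIncl k X (CD k X) n)) ∧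
        (∀ p q n (h : p + q = n) (a : HR k X p) (b : HR k X q),
          π n (cup p q n h a b) = cupQ p q n h (π p a) (π q b) ∧
          π n (L p q n h a b) = LQ p q n h (π p a) (π q b) ∧
          π n (R p q n h a b) = RQ p q n h (π p a) (π q b)) ∧
        (∀ p q n (h : p + q = n) (a : HQ k X p) (b : HQ k X q),
          cohIncl k X (CQ k X) n (cupQ p q n h a b) =
            cup p q n h (cohIncl k X (CQ k X) p a) (cohIncl k X (CQ k X) q b)) ∧
        IsPlusZinbiel k (HQ k X) cupQ LQ RQ := by
  refine ⟨⟨isCompl_BN_BD k X, isDGSubbimodule_BN k X, isDGSubbimodule_BD k hX,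
    fun _ => comul_of_mem_BD k hX, fun _ => counit_of_mem_BD k, fun _ => comul_of_mem_BN k,
    fun _ => comulLeft_of_mem_BN k, fun _ => comulRight_of_mem_BN k⟩,
    bijective_hlgyIncl_coprod k hX, fun hk => ?_, bijective_cohIncl_coprod k hX, ?_⟩
  · obtain ⟨r, hr⟩ := exists_isClassMap (X := X) hk
    have hΔ : ∀ n p q (_ : p + q = n) c, _ := fun n p q _ c =>
      (map_hlgyIncl_hlgyCoprodN hr hX (isCoprod_comulBar k X) n p q c).trans
        (map_hlgyNorm_comul hr hX hk n p q c)
    have hL : ∀ n p q (_ : p + q = n) c, _ := fun n p q _ c =>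
      (map_hlgyIncl_hlgyCoprodN hr hX (isCoprod_comulLeftBar k X) n p q c).trans
        (map_hlgyNorm_comulLeft hr hX hk n p q c)
    have hR : ∀ n p q (_ : p + q = n) c, _ := fun n p q _ c =>
      (map_hlgyIncl_hlgyCoprodN hr hX (isCoprod_comulRightBar k X) n p q c).trans
        (map_hlgyNorm_comulRight hr hX hk n p q c)
    exact ⟨fun n p q _ => hlgyCoprod hr (isCoprod_comulBar k X) n p q,
      fun n p q _ => hlgyCoprod hr (isCoprod_comulLeftBar k X) n p q,
      fun n p q _ => hlgyCoprod hr (isCoprod_comulRightBar k X) n p q,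
      inducedOnHlgy_hlgyCoprod hk hr _, inducedOnHlgy_hlgyCoprod hk hr _,
      inducedOnHlgy_hlgyCoprod hk hr _, isPlusCoZinbiel_hlgyCoprod hr hk,
      fun n p q _ c => hlgyCoprod_mem_of_BbarD hr hX hk n p q c,
      fun _ z hz => counitBar_of_mem_BbarD k X (mem_cyc.1 hz).2.1,
      fun n p q _ => hlgyCoprodN hr hX (isCoprod_comulBar k X) n p q,
      fun n p q _ => hlgyCoprodN hr hX (isCoprod_comulLeftBar k X) n p q,
      fun n p q _ => hlgyCoprodN hr hX (isCoprod_comulRightBar k X) n p q,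
      fun n p q h c => ⟨hΔ n p q h c, hL n p q h c, hR n p q h c⟩,
      (isPlusCoZinbiel_hlgyCoprod hr hk).of_retract (hlgyIncl k (BbarN k X))
        (hlgyProj (isChainProj_normBar k X hX)) (hlgyProj_hlgyIncl _) hΔ hL hR⟩
  · have hcup := cohProj_prod hX (k := k) comul_mem_range_CD' comul_mem_range_CD
    have hL := cohProj_prod hX (k := k) comulLeft_mem_range_CD' comulLeft_mem_range_CD
    have hR := cohProj_prod hX (k := k) comulRight_mem_range_CD' comulRight_mem_range_CD
    have hπ := cohProj_cohIncl (isCochProj_normCoch k X hX)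
    refine ⟨cohProd (isCoprod_comulBar k X), cohProd (isCoprod_comulLeftBar k X),
      cohProd (isCoprod_comulRightBar k X), inducedOnCoh_cohProd _ (comulBar_toBar k),
      inducedOnCoh_cohProd _ (comulLeftBar_toBar k), inducedOnCoh_cohProd _ (comulRightBar_toBar k),
      isPlusZinbiel_cohProd k X, ⟨Submodule.Quotient.mk ⟨_, unitCochain_mem_cocyc⟩, fun n a => ?_⟩,
      fun _ _ _ => cohProd_mem_range_CQ hX,
      fun _ _ _ h a b => ⟨comul_mem_range_CD' h a b, comulLeft_mem_range_CD' h a b⟩,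
      fun _ _ _ h a b => ⟨comul_mem_range_CD h a b, comulLeft_mem_range_CD h a b⟩,
      cohProj (isCochProj_normCoch k X hX), quandleProd hX _, quandleProd hX _, quandleProd hX _,
      hπ, ker_cohProj hX, fun p q n h a b => ⟨hcup p q n h a b, hL p q n h a b, hR p q n h a b⟩,
      fun p q n h a b => ?_, (isPlusZinbiel_cohProd k X).of_surjective _
        (fun n c => ⟨_, hπ n c⟩) hcup hL hR⟩
    · obtain ⟨f, hf, rfl⟩ := exists_coh_rep a
      rw [cohIncl_mk unitCochain_mem_cocyc (cocyc_le_top _ 0 unitCochain_mem_cocyc), cohProd_mk,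
        cohProd_mk]
      constructor
      · congr 1
        exact Subtype.ext (unitCochain_cochProd f)
      · congr 1
        exact Subtype.ext (cochProd_unitCochain f)
    -- The cup product of two quandle classes already lies in the image of quandle cohomology, so
    -- projecting it and including it back changes nothing.
    · obtain ⟨c, hc⟩ := cohProd_mem_range_CQ hX h a b
      rw [quandleProd_apply, ← hc, hπ]
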